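/- All graphs are simple and undirected. An edge-colouring (not necessarily proper) of a connected graph $G$ is *rainbow connected* if any two vertices of $G$ are joined by a path whose edges have pairwise distinct colours. The *rainbow connection number* $rc(G)$ is the least integer $r\ge 1$ such that $G$ has a rainbow connected edge-colouring $E(G)\to\{1,\dots,r\}$. The *list rainbow connection number* $rc^\ell(G)$ is the least integer $r\ge 1$ such that, for every assignment to each edge $e$ of a set $L(e)\subseteq\mathbb N$ with $|L(e)|\ge r$, there is a rainbow connected edge-colouring $c$ of $G$ with $c(e)\in L(e)$ for every edge $e$. A *degree $2$ vertex duplication* of a graph takes a vertex $v$ of degree $2$ and adds a new vertex joined to exactly the two neighbours of $v$. Let $G_7$ be the graph obtained from $K_4$ by subdividing once each of the three edges at one vertex. Let $\mathcal G$ be the smallest family of graphs, closed under isomorphism, that contains the cycle $C_5$, the graph $G_7$ and the Petersen graph $\mathsf P_{10}$, and is closed under degree $2$ vertex duplications. For $p\ge q\ge 1$, let $G_{p,q}$ be the graph with vertices $u_1,\dots,u_p,v_1,\dots,v_q,x_1,x_2,y$ and edges $u_iy,\ u_ix_1,\ v_jy,\ v_jx_2$ (for all $i,j$) and $x_1x_2$.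 For $p\ge q\ge r\ge 1$, let $G_{p,q,r}$ be the graph with vertices $u_1,\dots,u_p,v_1,\dots,v_q,w_1,\dots,w_r,x_1,x_2,x_3,y$ and edges $u_iy,\ u_ix_1,\ v_jy,\ v_jx_2,\ w_ky,\ w_kx_3$ (for all $i,j,k$) and $x_1x_2,\ x_1x_3,\ x_2x_3$. **Theorem.** For every $G\in\mathcal G$ we have $rc(G)=rc^\ell(G)\in\{3,4\}$. More precisely, up to isomorphism $\mathcal G$ consists exactly of $\mathsf P_{10}$, the graphs $G_{p,q}$ with $p\ge q\ge 1$, and the graphs $G_{p,q,r}$ with $p\ge q\ge r\ge 1$, and the values are as follows. - $rc(\mathsf P_{10})=rc^\ell(\mathsf P_{10})=3$. - For $p\ge q\ge 1$, $$rc(G_{p,q})=rc^\ell(G_{p,q})=\begin{cases}3,&\text{if } p+q\le 7\text{ or }(p,q)\in\{(6,2),(5,3),(4,4),(6,3)\},\\ 4,&\text{if } p+q\ge 10\text{ or }(p,q)\in\{(7,1),(8,1),(7,2),(5,4)\}.\end{cases}$$ - For $p\ge q\ge r\ge 1$, $$rc(G_{p,q,r})=rc^\ell(G_{p,q,r})=\begin{cases}3,&\text{if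 } p+q+r\le 8\text{ or }(p,q,r)\in\{(7,1,1),(4,4,1),(5,2,2),(3,3,3)\},\\ 4,&\text{if } p+q+r\ge 10\text{ or }(p,q,r)\in\{(6,2,1),(5,3,1),(4,3,2)\}.\end{cases}$$ -/

import Mathlib

universe u

namespace RainbowConnection

/-! ### Rainbow connection numbers -/

section Parameters

variable {V : Type*} (G : SimpleGraph V)

/-- A (not necessarily proper) edge-colouring `c` of `G` is rainbow connected if any two vertices
are joined by a path on which no two distinct edges have the same colour. -/
def IsRainbowConnected {K : Type*} (c : G.EdgeLabeling K) : Prop :=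
  ∀ a b : V, ∃ p : G.Walk a b, p.IsPath ∧ Set.InjOn c {e : G.edgeSet | (e : Sym2 V) ∈ p.edges}

/-- The rainbow connection number: the least positive integer `r` such that `G` has a rainbow
connected edge-colouring with `r` colours. -/
noncomputable def rc : ℕ :=
  sInf {r : ℕ | 0 < r ∧ ∃ c : G.EdgeLabeling (Fin r), IsRainbowConnected G c}

/-- The list rainbow connection number: the least positive integer `r` such that, whenever every
edge `e` is given a list `L e ⊆ ℕ` of at least `r` colours, one can choose a colour `c e ∈ L e` for
every edge `e` so that `c` is rainbow connected. -/
noncomputable def rcList : ℕ :=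
  sInf {r : ℕ | 0 < r ∧ ∀ L : G.EdgeLabeling (Set ℕ), (∀ e, (r : ℕ∞) ≤ (L e).encard) →
    ∃ c : G.EdgeLabeling ℕ, (∀ e, c e ∈ L e) ∧ IsRainbowConnected G c}

end Parameters

/-! ### The family of graphs -/

/-- The graph obtained from `G` by adding a new vertex `none` joined to the neighbours of `v`. -/
def duplicate {V : Type*} (G : SimpleGraph V) (v : V) : SimpleGraph (Option V) where
  Adj
    | some a, some b => G.Adj a b
    | some a, none => G.Adj v a
    | none, some b => G.Adj v b
    | none, none => False
  symm := ⟨by rintro (_ | a) (_ | b) h <;> first | exact h | exact SimpleGraph.Adj.symm h⟩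
  loopless := ⟨by rintro (_ | a) h <;> first | exact h | exact G.loopless.irrefl a h⟩

/-- The Petersen graph: an outer 5-cycle `inl i`, an inner pentagram `inr i`, and spokes. -/
def petersen : SimpleGraph (ZMod 5 ⊕ ZMod 5) :=
  SimpleGraph.fromRel fun
    | .inl i, .inl j => j = i + 1
    | .inr i, .inr j => j = i + 2
    | .inl i, .inr j => i = j
    | .inr _, .inl _ => False

/-- The graph obtained from `K₄`, with vertices `inl 0, …, inl 3`, by subdividing once each of the
three edges at `inl 0`; the vertex `inr i` subdivides the edge between `inl 0` and
`inl (i + 1)`. -/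
def G7 : SimpleGraph (Fin 4 ⊕ Fin 3) :=
  SimpleGraph.fromRel fun
    | .inl a, .inl b => a ≠ 0 ∧ b ≠ 0
    | .inr i, .inl a => a = 0 ∨ a = i.succ
    | _, _ => False

/-- The smallest isomorphism-closed family of graphs that contains `C₅`, `G7` and the Petersen
graph and is closed under degree 2 vertex duplications. -/
inductive Family : ∀ {V : Type u}, SimpleGraph V → Prop
  | base_C5 {V : Type u} {G : SimpleGraph V} (e : G ≃g SimpleGraph.cycleGraph 5) : Family G
  | base_G7 {V : Type u} {G : SimpleGraph V} (e : G ≃g G7) : Family G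
  | base_petersen {V : Type u} {G : SimpleGraph V} (e : G ≃g petersen) : Family G
  | dup {V W : Type u} {G : SimpleGraph V} {H : SimpleGraph W} (v : V)
      (hG : Family G) (hv : (G.neighborSet v).encard = 2) (e : H ≃g duplicate G v) : Family H

/-- The vertices of `G_{p,q}`. -/
inductive Vertex₂ (p q : ℕ) : Type
  | u (i : Fin p)
  | v (j : Fin q)
  | x₁
  | x₂
  | y
  deriving DecidableEq

/-- The graph `G_{p,q}`. -/
def G₂ (p q : ℕ) : SimpleGraph (Vertex₂ p q) :=
  SimpleGraph.fromRel fun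
    | .u _, .y => True
    | .u _, .x₁ => True
    | .v _, .y => True
    | .v _, .x₂ => True
    | .x₁, .x₂ => True
    | _, _ => False

/-- The vertices of `G_{p,q,r}`. -/
inductive Vertex₃ (p q r : ℕ) : Type
  | u (i : Fin p)
  | v (j : Fin q)
  | w (k : Fin r)
  | x₁
  | x₂
  | x₃
  | y
  deriving DecidableEq

/-- The graph `G_{p,q,r}`. -/
def G₃ (p q r : ℕ) : SimpleGraph (Vertex₃ p q r) :=
  SimpleGraph.fromRel fun
    | .u _, .y => True
    | .u _, .x₁ => True
    | .v _, .y => True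
    | .v _, .x₂ => True
    | .w _, .y => True
    | .w _, .x₃ => True
    | .x₁, .x₂ => True
    | .x₁, .x₃ => True
    | .x₂, .x₃ => True
    | _, _ => False

end RainbowConnection

/-!
A graph of the family other than the Petersen graph has a *hub*, a complete *rim* on two or three
vertices, and *middle* vertices, each joined to the hub and to one rim vertex. Duplicating a vertex
of degree two adds a middle vertex; when a rim vertex or the hub has degree two, a symmetry of the
graph moves it to a middle vertex.

With three colours, two middle vertices whose edges to the hub agree must be joined by a rainbow
path through the rim, so their edges to the rim differ. Hence there are at most nine middle
vertices. If there are nine, all nine pairs of colours occur, and three middle vertices with the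
same colour at the hub lie in a single part or in three different ones, which leaves a condition on
the part sizes modulo `3`.

From lists of three colours, Hall's theorem gives colours of the hub edges in which every colour is
used at most twice, and pairs of middle vertices are harmless. It fails only if seven lists coincide
or nine lists share four colours, and then larger colour classes are designed according to the part
sizes. From lists of four colours, a special middle vertex in every part, whose colours are avoided
elsewhere in the part, provides paths of length four.

For the Petersen graph, and for the octahedron which arises from three parts, enough pairs of
edges are required to have different colours that three colours admit one solution up to a
permutation. The number of pairs is twice the number of variables, so Lagrange interpolation on a
grid expresses the coefficient of the monomial with all exponents `2` in the product of the
differences through that solution. It is not zero, so any lists of three colours admit a solution,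
as in the combinatorial Nullstellensatz.
-/

namespace RainbowConnection

section RainbowJoined

variable {V W K : Type*} {G : SimpleGraph V} {H : SimpleGraph W} {f : Sym2 V → K}

/-- The vertices `a` and `b` are joined by a path of `G` whose edges have distinct colours under
`f`. Colours are given to all unordered pairs; those of non-edges are irrelevant. -/
def RainbowJoined (G : SimpleGraph V) (f : Sym2 V → K) (a b : V) : Prop :=
  ∃ p : G.Walk a b, p.IsPath ∧ (p.edges.map f).Nodup

theorem isRainbowConnected_restrict_iff :
    IsRainbowConnected G (fun e : G.edgeSet => f e) ↔ ∀ a b, RainbowJoined G f a b := by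
  refine forall₂_congr fun a b => exists_congr fun p => and_congr_right fun hp => ?_
  rw [List.nodup_map_iff_inj_on hp.isTrail.edges_nodup]
  exact ⟨fun h x hx y hy hxy => congrArg Subtype.val
      (@h ⟨x, p.edges_subset_edgeSet hx⟩ hx ⟨y, p.edges_subset_edgeSet hy⟩ hy hxy),
    fun h x hx y hy hxy => Subtype.ext (h x hx y hy hxy)⟩

theorem exists_restrict_eq [Nonempty K] (c : G.EdgeLabeling K) :
    ∃ f : Sym2 V → K, (fun e : G.edgeSet => f e) = c :=
  ⟨Function.extend Subtype.val c fun _ => Classical.arbitrary K,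
    funext fun e => Subtype.val_injective.extend_apply c _ e⟩

namespace RainbowJoined

theorem refl (f : Sym2 V → K) (a : V) : RainbowJoined G f a a := ⟨.nil, by simp, by simp⟩

theorem symm {a b : V} (h : RainbowJoined G f a b) : RainbowJoined G f b a := by
  obtain ⟨p, hp, hn⟩ := h
  exact ⟨p.reverse, hp.reverse, by simpa using hn⟩

theorem of_adj (f : Sym2 V → K) {a b : V} (h : G.Adj a b) : RainbowJoined G f a b :=
  ⟨.cons h .nil, by simp [h.ne], by simp⟩

theorem of_adj_two {a m b : V} (h₁ : G.Adj a m) (h₂ : G.Adj m b) (hab : a ≠ b)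
    (hf : f s(a, m) ≠ f s(m, b)) : RainbowJoined G f a b :=
  ⟨.cons h₁ (.cons h₂ .nil), by simp [h₁.ne, h₂.ne, hab], by simp [hf]⟩

theorem of_adj_three {a m n b : V} (h₁ : G.Adj a m) (h₂ : G.Adj m n) (h₃ : G.Adj n b)
    (hv : [a, m, n, b].Nodup) (hf : [f s(a, m), f s(m, n), f s(n, b)].Nodup) :
    RainbowJoined G f a b :=
  ⟨.cons h₁ (.cons h₂ (.cons h₃ .nil)), by
    rw [SimpleGraph.Walk.isPath_def]; simpa using hv, by simpa using hf⟩

theorem of_adj_four {a m n o b : V} (h₁ : G.Adj a m) (h₂ : G.Adj m n) (h₃ : G.Adj n o)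
    (h₄ : G.Adj o b) (hv : [a, m, n, o, b].Nodup)
    (hf : [f s(a, m), f s(m, n), f s(n, o), f s(o, b)].Nodup) : RainbowJoined G f a b :=
  ⟨.cons h₁ (.cons h₂ (.cons h₃ (.cons h₄ .nil))), by
    rw [SimpleGraph.Walk.isPath_def]; simpa using hv, by simpa using hf⟩

theorem cases_of_card_le_three [Fintype K] (hK : Fintype.card K ≤ 3) {a b : V}
    (h : RainbowJoined G f a b) :
    a = b ∨ G.Adj a b ∨ (∃ m, G.Adj a m ∧ G.Adj m b ∧ f s(a, m) ≠ f s(m, b)) ∨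
      ∃ m n, G.Adj a m ∧ G.Adj m n ∧ G.Adj n b ∧ a ≠ n ∧ m ≠ b ∧
        f s(a, m) ≠ f s(m, n) ∧ f s(a, m) ≠ f s(n, b) ∧ f s(m, n) ≠ f s(n, b) := by
  obtain ⟨p, hp, hn⟩ := h
  have hl : p.length ≤ 3 := by simpa using hn.length_le_card.trans hK
  match p with
  | .nil => exact .inl rfl
  | .cons h₁ .nil => exact .inr (.inl h₁)
  | .cons (v := m) h₁ (.cons h₂ .nil) => exact .inr (.inr (.inl ⟨m, h₁, h₂, by simpa using hn⟩))
  | .cons (v := m) h₁ (.cons (v := n) h₂ (.cons h₃ .nil)) =>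
    refine .inr (.inr (.inr ⟨m, n, h₁, h₂, h₃, ?_⟩))
    simp only [SimpleGraph.Walk.isPath_def, SimpleGraph.Walk.support_cons,
      SimpleGraph.Walk.support_nil, SimpleGraph.Walk.edges_cons, SimpleGraph.Walk.edges_nil,
      List.map_cons, List.map_nil, List.nodup_cons, List.mem_cons, List.not_mem_nil, or_false,
      not_or] at hp hn
    tauto
  | .cons _ (.cons _ (.cons _ (.cons _ p))) =>
    simp only [SimpleGraph.Walk.length_cons] at hl
    omega

theorem cases_of_card_le_two [Fintype K] (hK : Fintype.card K ≤ 2) {a b : V}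
    (h : RainbowJoined G f a b) :
    a = b ∨ G.Adj a b ∨ ∃ m, G.Adj a m ∧ G.Adj m b ∧ f s(a, m) ≠ f s(m, b) := by
  obtain h | h | h | ⟨m, n, -, -, -, -, -, h₁, h₂, h₃⟩ := h.cases_of_card_le_three (by omega)
  · exact .inl h
  · exact .inr (.inl h)
  · exact .inr (.inr h)
  · exact absurd (Fintype.two_lt_card_iff.2 ⟨_, _, _, h₁, h₂, h₃⟩) hK.not_gt

theorem comp_injective {K' : Type*} {g : K → K'} (hg : Function.Injective g) {a b : V}
    (h : RainbowJoined G f a b) : RainbowJoined G (g ∘ f) a b := by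
  obtain ⟨p, hp, hn⟩ := h
  exact ⟨p, hp, by simpa using hn.map hg⟩

theorem map {f : Sym2 W → K} (φ : G ↪g H) {a b : V}
    (h : RainbowJoined G (f ∘ Sym2.map φ) a b) : RainbowJoined H f (φ a) (φ b) := by
  obtain ⟨p, hp, hn⟩ := h
  exact ⟨p.map φ.toHom, hp.map φ.injective, by simpa using hn⟩

end RainbowJoined

end RainbowJoined

section Parameters

variable {V W : Type*} {G : SimpleGraph V} {H : SimpleGraph W} {r s : ℕ}

/-- `G` has a rainbow connected colouring with `r` colours. -/
def RainbowColorable (G : SimpleGraph V) (r : ℕ) : Prop :=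
  ∃ f : Sym2 V → Fin r, ∀ a b, RainbowJoined G f a b

/-- `G` has a rainbow connected colouring from any lists of exactly `r` colours at its edges. Lists
and colours are given to all unordered pairs; those of non-edges are irrelevant. -/
def RainbowChoosable (G : SimpleGraph V) (r : ℕ) : Prop :=
  ∀ L : Sym2 V → Finset ℕ, (∀ e ∈ G.edgeSet, (L e).card = r) →
    ∃ f : Sym2 V → ℕ, (∀ e ∈ G.edgeSet, f e ∈ L e) ∧ ∀ a b, RainbowJoined G f a b

theorem rc_eq_sInf (G : SimpleGraph V) : rc G = sInf {r | 0 < r ∧ RainbowColorable G r} := by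
  refine congrArg sInf (Set.ext fun r => and_congr_right fun hr => ⟨?_, ?_⟩)
  · rintro ⟨c, hc⟩
    have : Nonempty (Fin r) := ⟨⟨0, hr⟩⟩
    obtain ⟨f, rfl⟩ := exists_restrict_eq c
    exact ⟨f, isRainbowConnected_restrict_iff.1 hc⟩
  · rintro ⟨f, hf⟩
    exact ⟨_, isRainbowConnected_restrict_iff.2 hf⟩

theorem rainbowChoosable_iff : RainbowChoosable G r ↔
    ∀ L : G.EdgeLabeling (Set ℕ), (∀ e, (r : ℕ∞) ≤ (L e).encard) →
      ∃ c : G.EdgeLabeling ℕ, (∀ e, c e ∈ L e) ∧ IsRainbowConnected G c := by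
  refine ⟨fun h L hL => ?_, fun h L hL => ?_⟩
  · have exists_sublist (e : G.edgeSet) : ∃ t : Finset ℕ, (t : Set ℕ) ⊆ L e ∧ t.card = r := by
      obtain ⟨t, ht, htr⟩ := Set.exists_subset_encard_eq (hL e)
      lift t to Finset ℕ using Set.finite_of_encard_eq_coe htr
      exact ⟨t, ht, by simpa using htr⟩
    choose t ht htr using exists_sublist
    obtain ⟨L', hL'⟩ := exists_restrict_eq t
    have hL'_apply (e : G.edgeSet) : L' e = t e := congrFun hL' e
    obtain ⟨f, hf, hJ⟩ := h L' fun e he => by rw [hL'_apply ⟨e, he⟩, htr]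
    exact ⟨_, fun e => ht e (hL'_apply e ▸ hf e e.2), isRainbowConnected_restrict_iff.2 hJ⟩
  · obtain ⟨c, hc, hR⟩ := h (fun e => L e) fun e => by simp [hL e e.2]
    obtain ⟨f, rfl⟩ := exists_restrict_eq c
    exact ⟨f, fun e he => hc ⟨e, he⟩, isRainbowConnected_restrict_iff.1 hR⟩

theorem rcList_eq_sInf (G : SimpleGraph V) :
    rcList G = sInf {r | 0 < r ∧ RainbowChoosable G r} := by
  simp only [rcList, rainbowChoosable_iff]

theorem RainbowColorable.mono (h : RainbowColorable G r) (hrs : r ≤ s) : RainbowColorable G s :=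
  let ⟨f, hf⟩ := h
  ⟨Fin.castLE hrs ∘ f, fun a b => (hf a b).comp_injective (Fin.castLE_injective hrs)⟩

theorem RainbowChoosable.colorable (h : RainbowChoosable G r) (hr : 0 < r) :
    RainbowColorable G r := by
  obtain ⟨c, hc, hJ⟩ := rainbowChoosable_iff.1 h (fun _ => Finset.range r) fun _ => by
    rw [Set.encard_coe_eq_coe_finsetCard, Finset.card_range]
  have : Nonempty (Fin r) := ⟨⟨0, hr⟩⟩
  obtain ⟨f, hf⟩ := exists_restrict_eq fun e => (⟨c e, by simpa using hc e⟩ : Fin r)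
  refine ⟨f, isRainbowConnected_restrict_iff.1 ?_⟩
  rw [hf]
  intro a b
  obtain ⟨p, hp, hi⟩ := hJ a b
  exact ⟨p, hp, fun x hx y hy hxy => hi hx hy (by simpa using hxy)⟩

theorem rc_eq_and_rcList_eq (hlow : ¬ RainbowColorable G r) (hup : RainbowChoosable G (r + 1)) :
    rc G = r + 1 ∧ rcList G = r + 1 := by
  have lt_of_colorable {s : ℕ} (hs : RainbowColorable G s) : r < s :=
    lt_of_not_ge fun hsr => hlow (hs.mono hsr)
  rw [rc_eq_sInf, rcList_eq_sInf]
  exact ⟨IsLeast.csInf_eq ⟨⟨r.succ_pos, hup.colorable r.succ_pos⟩,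
      fun s hs => lt_of_colorable hs.2⟩,
    IsLeast.csInf_eq ⟨⟨r.succ_pos, hup⟩, fun s hs => lt_of_colorable (hs.2.colorable hs.1)⟩⟩

theorem RainbowJoined.of_iso {K : Type*} {f : Sym2 V → K} (φ : G ≃g H)
    (h : ∀ a b, RainbowJoined G f a b) (a b : W) : RainbowJoined H (f ∘ Sym2.map φ.symm) a b := by
  have hf : (f ∘ Sym2.map φ.symm) ∘ Sym2.map φ = f := by
    ext e
    induction e with | h x y => simp
  have hJ := RainbowJoined.map (f := f ∘ Sym2.map φ.symm) φ.toEmbedding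
    (hf.symm ▸ h (φ.symm a) (φ.symm b))
  rwa [RelIso.coe_toRelEmbedding, φ.apply_symm_apply, φ.apply_symm_apply] at hJ

theorem RainbowColorable.of_iso (φ : G ≃g H) (h : RainbowColorable G r) : RainbowColorable H r :=
  let ⟨f, hf⟩ := h
  ⟨f ∘ Sym2.map φ.symm, RainbowJoined.of_iso φ hf⟩

theorem RainbowChoosable.of_iso (φ : G ≃g H) (h : RainbowChoosable G r) :
    RainbowChoosable H r := by
  intro L hL
  obtain ⟨f, hf, hJ⟩ := h (L ∘ Sym2.map φ) fun e he => hL _ (φ.toHom.map_mem_edgeSet he)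
  refine ⟨f ∘ Sym2.map φ.symm, fun e he => ?_, RainbowJoined.of_iso φ hJ⟩
  have hmem := hf _ (φ.symm.toHom.map_mem_edgeSet he)
  induction e with | h x y => simpa using hmem

theorem rc_congr (φ : G ≃g H) : rc G = rc H := by
  simp only [rc_eq_sInf,
    fun r => (⟨.of_iso φ, .of_iso φ.symm⟩ : RainbowColorable G r ↔ RainbowColorable H r)]

theorem rcList_congr (φ : G ≃g H) : rcList G = rcList H := by
  simp only [rcList_eq_sInf,
    fun r => (⟨.of_iso φ, .of_iso φ.symm⟩ : RainbowChoosable G r ↔ RainbowChoosable H r)]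

end Parameters

section GridCoefficient

open MvPolynomial Lagrange

theorem sum_pow_mul_nodalWeight {κ F : Type*} [Field F] [DecidableEq κ] {v : κ → F}
    (hv : Function.Injective v) {S : Finset κ} {k : ℕ} (hk : k < S.card) :
    ∑ t ∈ S, v t ^ k * nodalWeight S v t = if k = S.card - 1 then 1 else 0 := by
  have h := coeff_eq_sum (P := Polynomial.X ^ k) hv.injOn
    (by rwa [Polynomial.degree_X_pow, Nat.cast_lt])
  rw [Polynomial.coeff_X_pow] at h
  simp only [nodalWeight, Finset.prod_inv_distrib, ← div_eq_mul_inv]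
  simpa only [eq_comm, Polynomial.eval_pow, Polynomial.eval_X] using h.symm

variable {ι κ κ' F : Type*} [Fintype ι] [DecidableEq ι] [DecidableEq κ] [Field F]
  {v : κ → F} {v' : κ' → F} {P : MvPolynomial ι F}

theorem coeff_eq_sum_eval_mul_nodalWeight (hv : Function.Injective v) {S : ι → Finset κ}
    {m : ι →₀ ℕ} (hS : ∀ i, (S i).card = m i + 1) (hP : P.totalDegree ≤ m.degree) :
    P.coeff m = ∑ x ∈ Fintype.piFinset S, eval (v ∘ x) P * ∏ i, nodalWeight (S i) v (x i) := by
  have sum_monomial (k : ι →₀ ℕ) (hk : k ∈ P.support) :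
      ∑ x ∈ Fintype.piFinset S, (∏ i, v (x i) ^ k i) * ∏ i, nodalWeight (S i) v (x i) =
        if k = m then 1 else 0 := by
    simp only [← Finset.prod_mul_distrib]
    rw [← Finset.prod_univ_sum S fun i t => v t ^ k i * nodalWeight (S i) v t]
    split_ifs with hkm
    · exact Finset.prod_eq_one fun i _ => by
        rw [sum_pow_mul_nodalWeight hv (by simp [hS, hkm]), hS, hkm]; simp
    · obtain ⟨i, hi⟩ : ∃ i, k i < m i := by
        by_contra! hmk
        have hsum : ∑ i, m i = ∑ i, k i := le_antisymm (Finset.sum_le_sum fun i _ => hmk i) <| by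
          simpa only [← Finsupp.degree_eq_sum] using! (le_totalDegree hk).trans hP
        exact hkm <| Finsupp.ext fun i =>
          ((Finset.sum_eq_sum_iff_of_le fun i _ => hmk i).1 hsum i (Finset.mem_univ i)).symm
      refine Finset.prod_eq_zero (Finset.mem_univ i) ?_
      rw [sum_pow_mul_nodalWeight hv (by rw [hS]; omega), hS, if_neg (by omega)]
  simp only [eval_eq', Finset.sum_mul, mul_assoc, Function.comp_apply]
  rw [Finset.sum_comm]
  simp only [← Finset.mul_sum]
  rw [Finset.sum_congr rfl fun k hk => by rw [sum_monomial k hk]]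
  simp [eq_comm]

theorem exists_eval_ne_zero_of_sum_ne_zero (hv : Function.Injective v)
    (hv' : Function.Injective v') {S : ι → Finset κ} {S' : ι → Finset κ'} {m : ι →₀ ℕ}
    (hS : ∀ i, (S i).card = m i + 1) (hS' : ∀ i, (S' i).card = m i + 1)
    (hP : P.totalDegree ≤ m.degree)
    (hsum : ∑ x ∈ Fintype.piFinset S, eval (v ∘ x) P * ∏ i, nodalWeight (S i) v (x i) ≠ 0) :
    ∃ x ∈ Fintype.piFinset S', eval (v' ∘ x) P ≠ 0 := by
  classical
  rw [← coeff_eq_sum_eval_mul_nodalWeight hv hS hP,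
    coeff_eq_sum_eval_mul_nodalWeight hv' hS' hP] at hsum
  obtain ⟨x, hx, h⟩ := Finset.exists_ne_zero_of_sum_ne_zero hsum
  exact ⟨x, hx, left_ne_zero_of_mul h⟩

end GridCoefficient

section ForcedColoring

open MvPolynomial Lagrange

variable {n : ℕ} {α : Type*}

/-- The product of the differences `X i - X j` over the constraints `(i, j)` in `E`. Its nonzeros
are the assignments that satisfy every constraint. -/
noncomputable def graphPolynomial (E : List (α × α)) : MvPolynomial α ℚ :=
  (E.map fun e => X e.1 - X e.2).prod

theorem totalDegree_graphPolynomial_le (E : List (α × α)) :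
    (graphPolynomial E).totalDegree ≤ E.length := by
  refine (totalDegree_list_prod _).trans ?_
  rw [List.map_map]
  refine (List.sum_le_card_nsmul _ 1 ?_).trans (by simp)
  simp only [List.forall_mem_map, Function.comp_apply]
  exact fun e _ => (totalDegree_sub _ _).trans (by simp)

theorem eval_graphPolynomial (E : List (α × α)) (x : α → ℚ) :
    eval x (graphPolynomial E) = (E.map fun e => x e.1 - x e.2).prod := by
  simp [graphPolynomial, map_list_prod, List.map_map, Function.comp_def]

theorem eval_graphPolynomial_ne_zero_iff {E : List (α × α)} {x : α → ℚ} :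
    eval x (graphPolynomial E) ≠ 0 ↔ ∀ e ∈ E, x e.1 ≠ x e.2 := by
  simp [eval_graphPolynomial, List.prod_eq_zero_iff, sub_eq_zero]

/-- The pair of `i` and `j` occurs, in some order, among the constraints `E`. -/
def IsConstrained (E : List (α × α)) (i j : α) : Prop := (i, j) ∈ E ∨ (j, i) ∈ E

instance [DecidableEq α] (E : List (α × α)) : DecidableRel (IsConstrained E) :=
  fun _ _ => inferInstanceAs (Decidable (_ ∨ _))

theorem IsConstrained.ne {β : Type*} {E : List (α × α)} {i j : α} (h : IsConstrained E i j)
    {x : α → β} (hx : ∀ e ∈ E, x e.1 ≠ x e.2) : x i ≠ x j :=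
  h.elim (hx _) fun h => (hx _ h).symm

/-- The constraints `E` determine the colouring `c` by three colours up to their names, each vertex
after the first two being apart from two earlier ones of different colours. -/
structure IsForced (E : List (Fin (n + 2) × Fin (n + 2))) (c : Fin (n + 2) → Fin 3) : Prop where
  zero_one : IsConstrained E 0 1
  ne_zero_one : c 0 ≠ c 1
  forced : ∀ k : Fin (n + 2), 2 ≤ k.val → ∃ i < k, ∃ j < k, IsConstrained E i k ∧
    IsConstrained E j k ∧ c i ≠ c j ∧ c k ≠ c i ∧ c k ≠ c j

variable {E : List (Fin (n + 2) × Fin (n + 2))} {c x : Fin (n + 2) → Fin 3}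

theorem IsForced.exists_perm (h : IsForced E c) (hx : ∀ e ∈ E, x e.1 ≠ x e.2) :
    ∃ σ : Equiv.Perm (Fin 3), σ ∘ c = x := by
  have exists_perm_pair : ∀ a b a' b' : Fin 3, a ≠ b → a' ≠ b' →
      ∃ σ : Equiv.Perm (Fin 3), σ a = a' ∧ σ b = b' := by decide
  have eq_of_ne : ∀ a b s t : Fin 3, a ≠ b → s ≠ a → s ≠ b → t ≠ a → t ≠ b → s = t := by decide
  obtain ⟨σ, h₀, h₁⟩ := exists_perm_pair _ _ _ _ h.ne_zero_one (h.zero_one.ne hx)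
  refine ⟨σ, funext fun k => ?_⟩
  induction k using WellFoundedLT.induction with | ind k ih =>
  obtain rfl | rfl | hk : k = 0 ∨ k = 1 ∨ 2 ≤ k.val := by
    simp only [Fin.ext_iff, Fin.val_zero, Fin.val_one]
    omega
  · exact h₀
  · exact h₁
  · obtain ⟨i, hi, j, hj, hik, hjk, hij, hki, hkj⟩ := h.forced k hk
    refine eq_of_ne (x i) (x j) _ _ ?_ ?_ ?_ (hik.ne hx).symm (hjk.ne hx).symm <;>
      simpa [← ih i hi, ← ih j hj]

theorem IsForced.comp_injective (h : IsForced E c) :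
    Function.Injective fun σ : Equiv.Perm (Fin 3) => σ ∘ c := by
  have perm_ext : ∀ (σ τ : Equiv.Perm (Fin 3)) (a b : Fin 3), a ≠ b → σ a = τ a → σ b = τ b →
      σ = τ := by decide
  exact fun σ τ hστ => perm_ext σ τ _ _ h.ne_zero_one (congrFun hστ 0) (congrFun hστ 1)

/-- By the grid formula on `{0, 1, 2}`, the top coefficient of the graph polynomial is a sum over
the six proper colourings with the colours `0, 1, 2`. -/
theorem IsForced.exists_choice (h : IsForced E c) (hE : E.length = 2 * (n + 2))
    (hsum : ∑ σ : Equiv.Perm (Fin 3),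
      (E.map fun e => ((σ (c e.1) : ℕ) : ℚ) - (σ (c e.2) : ℕ)).prod *
        ∏ i, nodalWeight Finset.univ (fun k : Fin 3 => ((k : ℕ) : ℚ)) (σ (c i)) ≠ 0)
    {S : Fin (n + 2) → Finset ℕ} (hS : ∀ i, (S i).card = 3) :
    ∃ y : Fin (n + 2) → ℕ, (∀ i, y i ∈ S i) ∧ ∀ e ∈ E, y e.1 ≠ y e.2 := by
  have cast_injective : Function.Injective fun k : Fin 3 => ((k : ℕ) : ℚ) :=
    Nat.cast_injective.comp Fin.val_injective
  have sum_ne_zero : ∑ x ∈ Fintype.piFinset fun _ : Fin (n + 2) => (Finset.univ : Finset (Fin 3)),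
      eval ((fun k : Fin 3 => ((k : ℕ) : ℚ)) ∘ x) (graphPolynomial E) *
        ∏ i, nodalWeight Finset.univ (fun k : Fin 3 => ((k : ℕ) : ℚ)) (x i) ≠ 0 := by
    rw [Fintype.piFinset_univ, ← Finset.sum_subset (Finset.subset_univ
      (Finset.univ.image fun σ : Equiv.Perm (Fin 3) => σ ∘ c)),
      Finset.sum_image fun _ _ _ _ hστ => h.comp_injective hστ]
    · simpa only [eval_graphPolynomial, Function.comp_apply] using hsum
    · intro x _ hx
      refine mul_eq_zero_of_left (by_contra fun hne => hx ?_) _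
      obtain ⟨σ, hσ⟩ := h.exists_perm (x := x) fun e he =>
        cast_injective.ne_iff.1 (eval_graphPolynomial_ne_zero_iff.1 hne e he)
      exact Finset.mem_image.2 ⟨σ, Finset.mem_univ σ, hσ⟩
  obtain ⟨y, hy, hne⟩ := exists_eval_ne_zero_of_sum_ne_zero (P := graphPolynomial E)
    (S := fun _ => Finset.univ) (S' := S) (m := Finsupp.equivFunOnFinite.symm fun _ => 2)
    cast_injective (v' := ((↑) : ℕ → ℚ)) Nat.cast_injective (by simp) (by simpa using hS)
    ((totalDegree_graphPolynomial_le E).trans (by simp [hE, Finsupp.degree_eq_sum, mul_comm]))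
    sum_ne_zero
  exact ⟨y, by simpa using hy, fun e he =>
    Nat.cast_injective.ne_iff.1 (eval_graphPolynomial_ne_zero_iff.1 hne e he)⟩

end ForcedColoring

section Petersen

instance : DecidableRel petersen.Adj
  | .inl i, .inl j => inferInstanceAs (Decidable (_ ≠ _ ∧ (j = i + 1 ∨ i = j + 1)))
  | .inl i, .inr j => inferInstanceAs (Decidable (_ ≠ _ ∧ (i = j ∨ False)))
  | .inr i, .inl j => inferInstanceAs (Decidable (_ ≠ _ ∧ (False ∨ j = i)))
  | .inr i, .inr j => inferInstanceAs (Decidable (_ ≠ _ ∧ (j = i + 2 ∨ i = j + 2)))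

/-- The edges of the Petersen graph, in an order in which `petersenConstraints` force the colouring
`petersenColor`. -/
def petersenEdge : Fin 15 → Sym2 (ZMod 5 ⊕ ZMod 5) :=
  ![s(.inl 2, .inl 3), s(.inl 1, .inr 1), s(.inl 1, .inl 2), s(.inl 2, .inr 2), s(.inr 4, .inr 1),
    s(.inr 1, .inr 3), s(.inr 3, .inr 0), s(.inl 0, .inl 1), s(.inl 3, .inr 3), s(.inl 4, .inr 4),
    s(.inr 0, .inr 2), s(.inl 3, .inl 4), s(.inl 0, .inr 0), s(.inl 4, .inl 0), s(.inr 2, .inr 4)]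

/-- Pairs of indices of edges of the Petersen graph on which a colouring is required to differ.
They make a colouring rainbow connected, and with three colours they have just one solution up to
the names of the colours. -/
def petersenConstraints : List (Fin 15 × Fin 15) :=
  [(0, 1), (0, 2), (0, 8), (0, 11), (1, 2), (1, 3), (1, 4), (1, 5), (2, 3), (2, 4), (2, 7), (3, 7),
    (3, 10), (4, 5), (4, 6), (4, 9), (5, 6), (5, 9), (5, 12), (6, 8), (6, 10), (6, 12), (7, 12),
    (7, 13), (8, 12), (9, 11), (9, 13), (9, 14), (11, 14), (12, 13)]

theorem isForced_petersenConstraints :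
    IsForced (n := 13) petersenConstraints ![2, 1, 0, 2, 2, 0, 1, 1, 0, 1, 0, 0, 2, 0, 2] where
  zero_one := by decide
  ne_zero_one := by decide
  forced := by decide +kernel

theorem exists_petersenConstraints {S : Fin 15 → Finset ℕ} (hS : ∀ i, (S i).card = 3) :
    ∃ x : Fin 15 → ℕ, (∀ i, x i ∈ S i) ∧ ∀ e ∈ petersenConstraints, x e.1 ≠ x e.2 :=
  isForced_petersenConstraints.exists_choice rfl (by decide +kernel) hS

theorem petersenEdge_injective : Function.Injective petersenEdge := by decide +kernel

theorem petersen_edgeSet : petersen.edgeSet = Set.range petersenEdge := by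
  have adj_iff : ∀ a b, petersen.Adj a b ↔ ∃ k, petersenEdge k = s(a, b) := by decide +kernel
  ext e
  induction e with | h a b => exact adj_iff a b

/-- The edges `e` and `e'` of the Petersen graph are required to have different colours. -/
def PetersenApart (e e' : Sym2 (ZMod 5 ⊕ ZMod 5)) : Prop :=
  ∃ k l, petersenEdge k = e ∧ petersenEdge l = e' ∧ IsConstrained petersenConstraints k l

instance : DecidableRel PetersenApart := fun e e' =>
  decidable_of_iff (∃ p ∈ petersenConstraints, (petersenEdge p.1 = e ∧ petersenEdge p.2 = e') ∨
    (petersenEdge p.1 = e' ∧ petersenEdge p.2 = e)) <| by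
    constructor
    · rintro ⟨⟨k, l⟩, hkl, h | h⟩
      · exact ⟨k, l, h.1, h.2, .inl hkl⟩
      · exact ⟨l, k, h.2, h.1, .inr hkl⟩
    · rintro ⟨k, l, h, h', hkl | hkl⟩
      · exact ⟨(k, l), hkl, .inl ⟨h, h'⟩⟩
      · exact ⟨(l, k), hkl, .inr ⟨h', h⟩⟩

theorem petersen_exists_apart_path : ∀ a b, a = b ∨ petersen.Adj a b ∨
    (∃ m, petersen.Adj a m ∧ petersen.Adj m b ∧ a ≠ b ∧ PetersenApart s(a, m) s(m, b)) ∨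
    ∃ m, petersen.Adj a m ∧ ∃ n, petersen.Adj m n ∧ petersen.Adj n b ∧ [a, m, n, b].Nodup ∧
      PetersenApart s(a, m) s(m, n) ∧ PetersenApart s(a, m) s(n, b) ∧
        PetersenApart s(m, n) s(n, b) := by
  decide +kernel

theorem petersen_rainbowChoosable : RainbowChoosable petersen 3 := by
  intro L hL
  rw [petersen_edgeSet, Set.forall_mem_range] at hL
  obtain ⟨x, hx, hne⟩ := exists_petersenConstraints hL
  let f := Function.extend petersenEdge x fun _ => 0
  have f_edge (k : Fin 15) : f (petersenEdge k) = x k := petersenEdge_injective.extend_apply _ _ k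
  have f_ne {e e' : Sym2 (ZMod 5 ⊕ ZMod 5)} : PetersenApart e e' → f e ≠ f e' := by
    rintro ⟨k, l, rfl, rfl, hkl⟩
    simpa only [f_edge] using hkl.ne hne
  refine ⟨f, ?_, fun a b => ?_⟩
  · rw [petersen_edgeSet, Set.forall_mem_range]
    exact fun k => f_edge k ▸ hx k
  · obtain rfl | h | ⟨m, h₁, h₂, hab, h⟩ | ⟨m, h₁, n, h₂, h₃, hv, h₁₂, h₁₃, h₂₃⟩ :=
      petersen_exists_apart_path a b
    · exact .refl f a
    · exact .of_adj f h
    · exact .of_adj_two h₁ h₂ hab (f_ne h)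
    · exact .of_adj_three h₁ h₂ h₃ hv (by simp [f_ne h₁₂, f_ne h₁₃, f_ne h₂₃])

theorem petersen_unique_common_neighbor : ∀ a b, a ≠ b → ∀ m, petersen.Adj a m →
    petersen.Adj m b → ¬ petersen.Adj a b ∧ ∀ n, petersen.Adj a n → petersen.Adj n b → n = m := by
  decide +kernel

/-- The three edges at a vertex need different colours, as they form unique paths of length two. -/
theorem petersen_not_rainbowColorable : ¬ RainbowColorable petersen 2 := by
  rintro ⟨f, hf⟩
  have ne_of_adj (a b m) (ham : petersen.Adj a m) (hmb : petersen.Adj m b) (hab : a ≠ b) :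
      f s(a, m) ≠ f s(m, b) := by
    obtain h | h | ⟨n, h₁, h₂, hne⟩ := (hf a b).cases_of_card_le_two (by simp)
    · exact absurd h hab
    · exact absurd h (petersen_unique_common_neighbor a b hab m ham hmb).1
    · rwa [(petersen_unique_common_neighbor a b hab m ham hmb).2 n h₁ h₂] at hne
  have h₁ := ne_of_adj (.inl 1) (.inl 4) (.inl 0) (by decide) (by decide) (by decide)
  have h₂ := ne_of_adj (.inl 4) (.inr 0) (.inl 0) (by decide) (by decide) (by decide)
  have h₃ := ne_of_adj (.inr 0) (.inl 1) (.inl 0) (by decide) (by decide) (by decide)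
  rw [Sym2.eq_swap] at h₁ h₂ h₃
  omega

theorem petersen_values : rc petersen = 3 ∧ rcList petersen = 3 :=
  rc_eq_and_rcList_eq petersen_not_rainbowColorable petersen_rainbowChoosable

end Petersen

section HubGraph

/-- The vertices of a hub graph: a hub, a rim indexed by `P`, and middle vertices indexed by
`ι`. -/
inductive HubVertex (ι P : Type*) : Type _
  | mid (i : ι)
  | rim (p : P)
  | hub

open HubVertex

/-- The hub graph of `π : ι → P`: the rim is complete and the middle vertex `i` is joined to the hub
and to the rim vertex `π i`. The graphs `G_{p,q}` and `G_{p,q,r}` are the hub graphs with two and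
three rim vertices, the middle vertices at one rim vertex being the fibre of `π` there. -/
def hubGraph {ι P : Type*} (π : ι → P) : SimpleGraph (HubVertex ι P) :=
  SimpleGraph.fromRel fun
    | .mid _, .hub => True
    | .mid i, .rim p => π i = p
    | .rim _, .rim _ => True
    | _, _ => False

variable {ι P : Type*} {π : ι → P}

@[simp] theorem hubGraph_mid_hub (i : ι) : (hubGraph π).Adj (mid i) hub := by simp [hubGraph]

@[simp] theorem hubGraph_hub_mid (i : ι) : (hubGraph π).Adj hub (mid i) := by simp [hubGraph]

@[simp] theorem hubGraph_mid_rim (i : ι) (p : P) :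
    (hubGraph π).Adj (mid i) (rim p) ↔ π i = p := by simp [hubGraph]

@[simp] theorem hubGraph_rim_mid (i : ι) (p : P) :
    (hubGraph π).Adj (rim p) (mid i) ↔ π i = p := by simp [hubGraph]

@[simp] theorem hubGraph_rim_rim (p q : P) : (hubGraph π).Adj (rim p) (rim q) ↔ p ≠ q := by
  simp [hubGraph]

@[simp] theorem hubGraph_mid_mid (i j : ι) : ¬ (hubGraph π).Adj (mid i) (mid j) := by
  simp [hubGraph]

@[simp] theorem hubGraph_hub_rim (p : P) : ¬ (hubGraph π).Adj hub (rim p) := by simp [hubGraph]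

@[simp] theorem hubGraph_rim_hub (p : P) : ¬ (hubGraph π).Adj (rim p) hub := by simp [hubGraph]

theorem hubGraph_forall_rainbowJoined {K : Type*} {f : Sym2 (HubVertex ι P) → K}
    (hmm : ∀ i j, i ≠ j → RainbowJoined (hubGraph π) f (mid i) (mid j))
    (hmr : ∀ i p, π i ≠ p → RainbowJoined (hubGraph π) f (mid i) (rim p))
    (hhr : ∀ p, RainbowJoined (hubGraph π) f hub (rim p)) (a b : HubVertex ι P) :
    RainbowJoined (hubGraph π) f a b := by
  have mid_rim (i : ι) (p : P) : RainbowJoined (hubGraph π) f (mid i) (rim p) := by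
    by_cases hp : π i = p
    · exact .of_adj f (by simpa using hp)
    · exact hmr i p hp
  by_cases hab : a = b
  · exact hab ▸ .refl f a
  rcases a with i | p | _ <;> rcases b with j | q | _
  · exact hmm i j (by simpa using hab)
  · exact mid_rim i q
  · exact .of_adj f (hubGraph_mid_hub i)
  · exact (mid_rim j p).symm
  · exact .of_adj f (by simpa using hab)
  · exact (hhr p).symm
  · exact .of_adj f (hubGraph_hub_mid j)
  · exact hhr q
  · exact absurd rfl hab

/-- The colouring of the edges of a hub graph given by the colours `top i` and `bot i` of the edges
from the middle vertex `i` to the hub and to the rim, and the colours `e` of the edges of the rim.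
The remaining unordered pairs, which are not edges, get the colour `0`. -/
def hubColor (top bot : ι → ℕ) (e : Sym2 P → ℕ) : Sym2 (HubVertex ι P) → ℕ :=
  Sym2.lift ⟨fun
    | .mid i, .hub => top i
    | .hub, .mid i => top i
    | .mid i, .rim _ => bot i
    | .rim _, .mid i => bot i
    | .rim p, .rim q => e s(p, q)
    | _, _ => 0, by rintro (i | p | _) (j | q | _) <;> simp [Sym2.eq_swap]⟩

section HubColor

variable (top bot : ι → ℕ) (e : Sym2 P → ℕ) (i : ι) (p q : P)

@[simp] theorem hubColor_mid_hub : hubColor top bot e s(mid i, hub) = top i := rfl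

@[simp] theorem hubColor_hub_mid : hubColor top bot e s(hub, mid i) = top i := rfl

@[simp] theorem hubColor_mid_rim : hubColor top bot e s(mid i, rim p) = bot i := rfl

@[simp] theorem hubColor_rim_mid : hubColor top bot e s(rim p, mid i) = bot i := rfl

@[simp] theorem hubColor_rim_rim : hubColor top bot e s(rim p, rim q) = e s(p, q) := rfl

end HubColor

/-- The colours `top`, `bot` and `e` make the hub graph of `π` rainbow connected. -/
def IsHubRainbow (π : ι → P) (top bot : ι → ℕ) (e : Sym2 P → ℕ) : Prop :=
  ∀ a b, RainbowJoined (hubGraph π) (hubColor top bot e) a b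

theorem hubGraph_rainbowChoosable_of {r : ℕ}
    (h : ∀ (A B : ι → Finset ℕ) (E : Sym2 P → Finset ℕ), (∀ i, (A i).card = r) →
      (∀ i, (B i).card = r) → (∀ t, ¬ t.IsDiag → (E t).card = r) →
      ∃ (top bot : ι → ℕ) (e : Sym2 P → ℕ), (∀ i, top i ∈ A i) ∧ (∀ i, bot i ∈ B i) ∧
        (∀ t, ¬ t.IsDiag → e t ∈ E t) ∧ IsHubRainbow π top bot e) :
    RainbowChoosable (hubGraph π) r := by
  intro L hL
  obtain ⟨top, bot, e, htop, hbot, he, hJ⟩ := h (fun i => L s(mid i, hub))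
    (fun i => L s(mid i, rim (π i))) (fun t => L (t.map rim)) (fun i => hL _ (by simp))
    (fun i => hL _ (by simp)) fun t ht => hL _ <| by
      induction t with | h p q => simpa using ht
  refine ⟨hubColor top bot e, fun t => ?_, hJ⟩
  induction t with | h a b =>
  intro hab
  rcases a with i | p | _ <;> rcases b with j | q | _ <;>
    simp only [SimpleGraph.mem_edgeSet, hubGraph_mid_hub, hubGraph_hub_mid, hubGraph_mid_rim,
      hubGraph_rim_mid, hubGraph_rim_rim, hubGraph_mid_mid, hubGraph_hub_rim, hubGraph_rim_hub,
      SimpleGraph.irrefl] at hab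
  · exact hab ▸ hbot i
  · exact htop i
  · rw [Sym2.eq_swap]
    exact hab ▸ hbot j
  · exact he s(p, q) (by simpa using hab)
  · rw [Sym2.eq_swap]
    exact htop j

end HubGraph

section ShortPaths

open HubVertex

variable {ι P : Type*} {π : ι → P}

/-- The middle vertices `i` and `j`, with the colours `bot i` and `bot j` towards the rim, are
joined through the rim by a rainbow path of length two or three. -/
def RimCompatible {K : Type*} (π : ι → P) (e : Sym2 P → K) (bot : ι → K) (i j : ι) : Prop :=
  bot i ≠ bot j ∧ (π i ≠ π j → bot i ≠ e s(π i, π j) ∧ bot j ≠ e s(π i, π j))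

section Sufficient

variable {top bot : ι → ℕ} {e : Sym2 P → ℕ}

theorem joined_mid_mid_of_top_ne {i j : ι} (h : top i ≠ top j) :
    RainbowJoined (hubGraph π) (hubColor top bot e) (mid i) (mid j) :=
  .of_adj_two (m := hub) (by simp) (by simp)
    (fun hij => h (congrArg top (HubVertex.mid.inj hij))) (by simpa using h)

theorem RimCompatible.joined {i j : ι} (hij : i ≠ j) (h : RimCompatible π e bot i j) :
    RainbowJoined (hubGraph π) (hubColor top bot e) (mid i) (mid j) := by
  by_cases hp : π i = π j
  · exact .of_adj_two (m := rim (π i)) (by simp) (by simp [hp]) (by simpa using hij)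
      (by simpa using h.1)
  · exact .of_adj_three (m := rim (π i)) (n := rim (π j)) (by simp) (by simpa using hp) (by simp)
      (by simp [hij, hp]) (by simp [h.1, h.2 hp, (h.2 hp).2.symm])

theorem joined_mid_rim_of_bot_ne {i : ι} {p : P} (hp : π i ≠ p) (h : bot i ≠ e s(π i, p)) :
    RainbowJoined (hubGraph π) (hubColor top bot e) (mid i) (rim p) :=
  .of_adj_two (m := rim (π i)) (by simp) (by simpa using hp) (by simp) (by simpa using h)

theorem joined_hub_rim_of_ne {i : ι} (h : top i ≠ bot i) :
    RainbowJoined (hubGraph π) (hubColor top bot e) hub (rim (π i)) :=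
  .of_adj_two (m := mid i) (by simp) (by simp) (by simp) (by simpa using h)

theorem RimCompatible.joined_hub_rim {i j : ι} (hi : top i = bot i) (ht : top j = top i)
    (h : RimCompatible π e bot j i) :
    RainbowJoined (hubGraph π) (hubColor top bot e) hub (rim (π i)) := by
  by_cases hp : π j = π i
  · exact hp ▸ joined_hub_rim_of_ne (ht.trans hi ▸ h.1.symm)
  · exact .of_adj_three (m := mid j) (n := rim (π j)) (by simp) (by simp) (by simpa using hp)
      (by simp [hp]) (by simp [ht, hi, h.1.symm, h.2 hp])

theorem isHubRainbow_of_rimCompatible (hπ : Function.Surjective π)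
    (hmm : ∀ i j, i ≠ j → top i = top j → RimCompatible π e bot i j)
    (hmr : ∀ i p, π i ≠ p → bot i ≠ e s(π i, p) ∨
      (∃ q, q ≠ π i ∧ q ≠ p ∧ [bot i, e s(π i, q), e s(q, p)].Nodup) ∨
      ∃ j, π j = p ∧ [top i, top j, bot j].Nodup)
    (hhr : ∀ i, top i = bot i → ∃ j, j ≠ i ∧ top j = top i) : IsHubRainbow π top bot e := by
  refine hubGraph_forall_rainbowJoined (fun i j hij => ?_) (fun i p hp => ?_) fun p => ?_
  · by_cases ht : top i = top j
    · exact (hmm i j hij ht).joined hij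
    · exact joined_mid_mid_of_top_ne ht
  · obtain h | ⟨q, hqi, hqp, h⟩ | ⟨j, rfl, h⟩ := hmr i p hp
    · exact joined_mid_rim_of_bot_ne hp h
    · exact .of_adj_three (m := rim (π i)) (n := rim q) (by simp) (by simpa using hqi.symm)
        (by simpa using hqp) (by simp [hp, hqi.symm, hqp]) (by simpa using h)
    · have hij : i ≠ j := fun hij => hp (congrArg π hij)
      exact .of_adj_three (m := hub) (n := mid j) (by simp) (by simp) (by simp) (by simp [hij])
        (by simpa using h)
  · obtain ⟨i, rfl⟩ := hπ p
    by_cases hi : top i = bot i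
    · obtain ⟨j, hji, hjt⟩ := hhr i hi
      exact (hmm j i hji hjt).joined_hub_rim hi hjt
    · exact joined_hub_rim_of_ne hi

end Sufficient

section Necessary

variable {K : Type*} [Fintype K] {f : Sym2 (HubVertex ι P) → K}

theorem RainbowJoined.rimCompatible (hK : Fintype.card K ≤ 3) {i j : ι} (hij : i ≠ j)
    (ht : f s(mid i, hub) = f s(mid j, hub)) (h : RainbowJoined (hubGraph π) f (mid i) (mid j)) :
    RimCompatible π (f ∘ Sym2.map rim) (fun i => f s(mid i, rim (π i))) i j := by
  obtain h | h | ⟨m, h₁, h₂, h₃⟩ | ⟨m, n, h₁, h₂, h₃, -, -, f₁, f₂, f₃⟩ :=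
    h.cases_of_card_le_three hK
  · exact absurd (HubVertex.mid.inj h) hij
  · simp at h
  · rcases m with l | p | _
    · simp at h₁
    · obtain rfl := (hubGraph_mid_rim _ _).1 h₁
      have hp := (hubGraph_rim_mid _ _).1 h₂
      rw [← hp, Sym2.eq_swap (a := rim (π j))] at h₃
      exact ⟨by simpa only [hp] using h₃, fun hne => absurd hp.symm hne⟩
    · rw [Sym2.eq_swap (a := hub)] at h₃
      exact absurd ht h₃
  · rcases m with l | p | _ <;> rcases n with l | q | _ <;>
      simp only [hubGraph_mid_mid, hubGraph_mid_rim, hubGraph_rim_mid, hubGraph_hub_rim,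
        hubGraph_rim_hub, SimpleGraph.irrefl] at h₁ h₂ h₃
    subst h₁ h₃
    rw [Sym2.eq_swap (a := rim (π j)) (b := mid j)] at f₂ f₃
    exact ⟨f₂, fun _ => ⟨f₁, f₃.symm⟩⟩

theorem RainbowJoined.mid_rim_cases (hK : Fintype.card K ≤ 3) {i : ι} {p : P} (hp : π i ≠ p)
    (h : RainbowJoined (hubGraph π) f (mid i) (rim p)) :
    f s(mid i, rim (π i)) ≠ f s(rim (π i), rim p) ∨ (∃ q, q ≠ π i ∧ q ≠ p) ∨
      ∃ j, π j = p ∧ f s(mid i, hub) ≠ f s(mid j, hub) ∧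
        f s(mid i, hub) ≠ f s(mid j, rim p) ∧ f s(mid j, hub) ≠ f s(mid j, rim p) := by
  obtain h | h | ⟨m, h₁, h₂, h₃⟩ | ⟨m, n, h₁, h₂, h₃, -, -, f₁, f₂, f₃⟩ :=
    h.cases_of_card_le_three hK
  · simp at h
  · exact absurd (by simpa using h) hp
  · rcases m with l | q | _
    · simp at h₁
    · obtain rfl := (hubGraph_mid_rim _ _).1 h₁
      exact .inl h₃
    · simp at h₂
  · rcases m with l | q | _ <;> rcases n with j | r | _ <;>
      simp only [hubGraph_mid_mid, hubGraph_mid_rim, hubGraph_rim_mid, hubGraph_hub_rim,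
        hubGraph_rim_hub, hubGraph_rim_rim, SimpleGraph.irrefl] at h₁ h₂ h₃
    · exact absurd (h₁.trans (h₂.symm.trans h₃)) hp
    · exact .inr (.inl ⟨r, h₁ ▸ h₂.symm, h₃⟩)
    · rw [Sym2.eq_swap (a := hub)] at f₁ f₃
      exact .inr (.inr ⟨j, h₃, f₁, f₂, f₃⟩)

theorem RainbowJoined.ne_of_mid_rim (hK : Fintype.card K ≤ 2) {i : ι} {p : P} (hp : π i ≠ p)
    (h : RainbowJoined (hubGraph π) f (mid i) (rim p)) :
    f s(mid i, rim (π i)) ≠ f s(rim (π i), rim p) := by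
  obtain h | h | ⟨m, h₁, h₂, h₃⟩ := h.cases_of_card_le_two hK
  · simp at h
  · exact absurd (by simpa using h) hp
  · rcases m with l | q | _
    · simp at h₁
    · obtain rfl := (hubGraph_mid_rim _ _).1 h₁
      exact h₃
    · simp at h₂

theorem RainbowJoined.exists_of_hub_rim (hK : Fintype.card K ≤ 2) {p : P}
    (h : RainbowJoined (hubGraph π) f hub (rim p)) :
    ∃ i, π i = p ∧ f s(mid i, hub) ≠ f s(mid i, rim p) := by
  obtain h | h | ⟨m, h₁, h₂, h₃⟩ := h.cases_of_card_le_two hK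
  · simp at h
  · simp at h
  · rcases m with i | q | _
    · rw [Sym2.eq_swap (a := hub)] at h₃
      exact ⟨i, by simpa using h₂, h₃⟩
    · simp at h₁
    · simp at h₂

end Necessary

end ShortPaths

section FourColors

open HubVertex

variable {ι P : Type*} {π : ι → P}

/-- Every part `π ⁻¹' {p}` has a special middle vertex `s p`, whose two colours are avoided by the
other middle vertices of the part. -/
structure IsSpecial (π : ι → P) (top bot : ι → ℕ) (e : Sym2 P → ℕ) (s : P → ι) : Prop where
  rightInverse : Function.RightInverse s π
  top_ne : ∀ i, s (π i) ≠ i → top i ≠ top (s (π i)) ∧ top i ≠ bot (s (π i))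
  bot_ne : ∀ i, s (π i) ≠ i → bot i ≠ top (s (π i)) ∧ bot i ≠ bot (s (π i))
  top_ne_bot : ∀ i, top i ≠ bot i
  injective_top : Function.Injective (top ∘ s)
  bot_ne_rim : ∀ p q, p ≠ q → bot (s p) ≠ e s(p, q)

namespace IsSpecial

variable {top bot : ι → ℕ} {e : Sym2 P → ℕ} {s : P → ι}

/-- The path goes from `i` through the rim and the special vertex of its part to the hub. -/
theorem joined_of_top_eq (h : IsSpecial π top bot e s) {i j : ι} (hij : i ≠ j)
    (hi : s (π i) ≠ i) (ht : top i = top j) :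
    RainbowJoined (hubGraph π) (hubColor top bot e) (mid i) (mid j) := by
  have hj : s (π i) ≠ j := fun hj => (h.top_ne i hi).1 (hj ▸ ht)
  refine .of_adj_four (m := rim (π i)) (n := mid (s (π i))) (o := hub) (by simp)
    (by simp [h.rightInverse _]) (by simp) (by simp) (by simp [hij, hi.symm, hj]) ?_
  simp [h.bot_ne i hi, ← ht, (h.top_ne_bot i).symm, (h.top_ne_bot (s (π i))).symm,
    (h.top_ne i hi).1.symm, (h.top_ne i hi).2.symm]

theorem joined_mid_mid (h : IsSpecial π top bot e s) {i j : ι} (hij : i ≠ j) :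
    RainbowJoined (hubGraph π) (hubColor top bot e) (mid i) (mid j) := by
  by_cases ht : top i = top j
  · by_cases hi : s (π i) = i
    · refine (h.joined_of_top_eq hij.symm (fun hj => hij ?_) ht.symm).symm
      rw [← hi, ← hj] at ht ⊢
      exact congrArg s (h.injective_top ht)
    · exact h.joined_of_top_eq hij hi ht
  · exact joined_mid_mid_of_top_ne ht

theorem joined_mid_rim (h : IsSpecial π top bot e s) {i : ι} {p : P} (hp : π i ≠ p) :
    RainbowJoined (hubGraph π) (hubColor top bot e) (mid i) (rim p) := by
  by_cases hb : bot i = e s(π i, p)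
  · have hi : s (π i) ≠ i := fun hi => h.bot_ne_rim _ _ hp (by rwa [hi])
    refine .of_adj_four (m := hub) (n := mid (s (π i))) (o := rim (π i)) (by simp) (by simp)
      (by simp [h.rightInverse _]) (by simpa using hp) (by simp [hp, hi.symm]) ?_
    simp [← hb, h.top_ne i hi, h.top_ne_bot, (h.bot_ne i hi).1.symm, (h.bot_ne i hi).2.symm]
  · exact joined_mid_rim_of_bot_ne hp hb

theorem isHubRainbow (h : IsSpecial π top bot e s) : IsHubRainbow π top bot e :=
  hubGraph_forall_rainbowJoined (fun _ _ => h.joined_mid_mid) (fun _ _ => h.joined_mid_rim)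
    fun p => h.rightInverse p ▸ joined_hub_rim_of_ne (h.top_ne_bot (s p))

end IsSpecial

theorem exists_mem_notMem_of_length_lt {α : Type*} {S : Finset α} {l : List α}
    (h : l.length < S.card) : ∃ x ∈ S, x ∉ l := by
  classical
  obtain ⟨x, hx, hxl⟩ := Finset.exists_mem_notMem_of_card_lt_card
    ((List.toFinset_card_le l).trans_lt h)
  exact ⟨x, hx, by simpa using hxl⟩

theorem exists_injective_ne {κ α : Type*} [Fintype κ] {S : κ → Finset α}
    (hS : ∀ i, Fintype.card κ < (S i).card) (x : κ → α) :
    ∃ y : κ → α, Function.Injective y ∧ ∀ i, y i ∈ S i ∧ y i ≠ x i := by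
  classical
  have hall (s : Finset κ) : s.card ≤ (s.biUnion fun i => (S i).erase (x i)).card := by
    obtain rfl | ⟨i, hi⟩ := s.eq_empty_or_nonempty
    · simp
    · calc s.card ≤ Fintype.card κ := s.card_le_univ
        _ ≤ (S i).card - 1 := Nat.le_sub_one_of_lt (hS i)
        _ ≤ ((S i).erase (x i)).card := Finset.pred_card_le_card_erase
        _ ≤ _ := Finset.card_le_card (Finset.subset_biUnion_of_mem
          (fun i => (S i).erase (x i)) hi)
  obtain ⟨y, hy, hyS⟩ := (Finset.all_card_le_biUnion_card_iff_exists_injective _).1 hall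
  exact ⟨y, hy, fun i => (Finset.mem_erase.1 (hyS i)).symm⟩

theorem exists_isSpecial [Fintype P] {r : ℕ} (hr : 4 ≤ r) (hP : Fintype.card P < r)
    (hπ : Function.Surjective π) {A B : ι → Finset ℕ} (hA : ∀ i, (A i).card = r)
    (hB : ∀ i, (B i).card = r) (e : Sym2 P → ℕ) :
    ∃ (top bot : ι → ℕ) (s : P → ι), (∀ i, top i ∈ A i) ∧ (∀ i, bot i ∈ B i) ∧
      IsSpecial π top bot e s := by
  obtain ⟨s, hs⟩ := hπ.hasRightInverse
  have exists_bot (p : P) : ∃ c ∈ B (s p), c ∉ Finset.univ.toList.map fun q => e s(p, q) :=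
    exists_mem_notMem_of_length_lt (by simpa [hB] using hP)
  choose β hβB hβe using exists_bot
  obtain ⟨α, hα, hαA⟩ :=
    exists_injective_ne (S := fun p => A (s p)) (fun p => by simpa [hA] using hP) β
  have exists_pair (i : ι) : ∃ t ∈ A i, ∃ b ∈ B i, t ≠ b ∧
      (s (π i) = i → t = α (π i) ∧ b = β (π i)) ∧
      (s (π i) ≠ i → t ∉ [α (π i), β (π i)] ∧ b ∉ [α (π i), β (π i)]) := by
    by_cases hi : s (π i) = i
    · exact ⟨α (π i), by simpa [hi] using (hαA (π i)).1, β (π i), by simpa [hi] using hβB (π i),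
        (hαA (π i)).2, by simp [hi]⟩
    · obtain ⟨t, htA, ht⟩ := exists_mem_notMem_of_length_lt (S := A i) (l := [α (π i), β (π i)])
        (by simp [hA]; omega)
      obtain ⟨b, hbB, hb⟩ := exists_mem_notMem_of_length_lt (S := B i) (l := [t, α (π i), β (π i)])
        (by simp [hB]; omega)
      rw [List.mem_cons, not_or] at hb
      exact ⟨t, htA, b, hbB, Ne.symm hb.1, fun h => absurd h hi, fun _ => ⟨ht, hb.2⟩⟩
  choose top htop bot hbot hne hspecial hother using exists_pair
  have special (p : P) : top (s p) = α p ∧ bot (s p) = β p := by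
    simpa only [hs p] using hspecial (s p) (by rw [hs p])
  refine ⟨top, bot, s, htop, hbot, hs, fun i hi => ?_, fun i hi => ?_, hne, fun p q hpq => ?_,
    fun p q _ => ?_⟩
  · simpa [special] using (hother i hi).1
  · simpa [special] using (hother i hi).2
  · simp only [Function.comp_apply, special] at hpq
    exact hα hpq
  · rw [(special p).2]
    exact fun h => hβe p (List.mem_map.2 ⟨q, by simp, h.symm⟩)

theorem hubGraph_rainbowChoosable_of_four_le [Fintype P] {r : ℕ} (hr : 4 ≤ r)
    (hP : Fintype.card P < r) (hπ : Function.Surjective π) : RainbowChoosable (hubGraph π) r := by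
  refine hubGraph_rainbowChoosable_of fun A B E hA hB hE => ?_
  have exists_rim (t : Sym2 P) (ht : ¬ t.IsDiag) : ∃ c, c ∈ E t :=
    Finset.card_pos.1 (by rw [hE t ht]; omega)
  choose! e he using exists_rim
  obtain ⟨top, bot, s, htop, hbot, h⟩ := exists_isSpecial hr hP hπ hA hB e
  exact ⟨top, bot, e, htop, hbot, he, h.isHubRainbow⟩

end FourColors

section LowerBounds

open HubVertex

variable {ι P : Type*} {π : ι → P}

theorem hubGraph_not_rainbowColorable_two [Nontrivial P] :
    ¬ RainbowColorable (hubGraph π) 2 := by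
  rintro ⟨f, hf⟩
  obtain ⟨p, q, hpq⟩ := exists_pair_ne P
  obtain ⟨i, rfl, hi⟩ := (hf hub (rim p)).exists_of_hub_rim (by simp)
  obtain ⟨j, rfl, hj⟩ := (hf hub (rim q)).exists_of_hub_rim (by simp)
  have hib := (hf (mid i) (rim (π j))).ne_of_mid_rim (by simp) hpq
  have hjb := (hf (mid j) (rim (π i))).ne_of_mid_rim (by simp) hpq.symm
  rw [Sym2.eq_swap (a := rim (π j)) (b := rim (π i))] at hjb
  have hbot : f s(mid i, rim (π i)) = f s(mid j, rim (π j)) := by omega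
  have htop : f s(mid i, hub) = f s(mid j, hub) := by omega
  exact ((hf (mid i) (mid j)).rimCompatible (by simp) (fun h => hpq (congrArg π h)) htop).1 hbot

theorem injective_of_rainbowJoined {f : Sym2 (HubVertex ι P) → Fin 3}
    (h : ∀ a b, RainbowJoined (hubGraph π) f a b) :
    Function.Injective fun i => (f s(mid i, hub), f s(mid i, rim (π i))) := by
  intro i j hij
  by_contra hne
  rw [Prod.mk.injEq] at hij
  exact ((h (mid i) (mid j)).rimCompatible (by simp) hne hij.1).1 hij.2

variable [Fintype ι]

theorem card_le_nine_of_rainbowColorable (h : RainbowColorable (hubGraph π) 3) :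
    Fintype.card ι ≤ 9 := by
  obtain ⟨f, hf⟩ := h
  simpa using Fintype.card_le_of_injective _ (injective_of_rainbowJoined hf)

theorem card_fiber_eq_sum {κ : Type*} [Fintype κ] [DecidableEq P] (φ : κ × κ ≃ ι) (p : P) :
    (Finset.univ.filter fun i => π i = p).card =
      ∑ t, (Finset.univ.filter fun b => π (φ (t, b)) = p).card := by
  simp only [Finset.card_filter]
  rw [← Fintype.sum_prod_type' (f := fun t b => if π (φ (t, b)) = p then 1 else 0)]
  exact (Equiv.sum_comp φ fun i => if π i = p then 1 else 0).symm

/-- With nine middle vertices all nine pairs of colours occur, so for every colour `t` at the hub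
there are three middle vertices, whose colours `b` at the rim are distinct. -/
theorem exists_equiv_of_card_eq_nine (h : RainbowColorable (hubGraph π) 3)
    (hn : Fintype.card ι = 9) : ∃ (φ : Fin 3 × Fin 3 ≃ ι) (e : Sym2 P → Fin 3), ∀ t b b',
      π (φ (t, b)) ≠ π (φ (t, b')) → b ≠ e s(π (φ (t, b)), π (φ (t, b'))) := by
  obtain ⟨f, hf⟩ := h
  let ψ := Equiv.ofBijective _ ((Fintype.bijective_iff_injective_and_card _).2
    ⟨injective_of_rainbowJoined hf, by simpa using hn⟩)
  have hψ (t b) : f s(mid (ψ.symm (t, b)), hub) = t ∧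
      f s(mid (ψ.symm (t, b)), rim (π (ψ.symm (t, b)))) = b :=
    Prod.mk.injEq .. ▸ ψ.apply_symm_apply (t, b)
  refine ⟨ψ.symm, f ∘ Sym2.map rim, fun t b b' hne => ?_⟩
  have hcompat := (hf _ _).rimCompatible (by simp) (fun hij => hne (congrArg π hij))
    ((hψ t b).1.trans (hψ t b').1.symm)
  simpa only [(hψ t b).2] using (hcompat.2 hne).1

/-- Three middle vertices with the same colour at the hub either lie in one part or in three
different parts. -/
theorem card_fiber_modEq_of_card_eq_nine {π : ι → Fin 3} (h : RainbowColorable (hubGraph π) 3)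
    (hn : Fintype.card ι = 9) : (Finset.univ.filter fun i => π i = 0).card ≡
      (Finset.univ.filter fun i => π i = 1).card [MOD 3] := by
  obtain ⟨φ, e, hφ⟩ := exists_equiv_of_card_eq_nine h hn
  have three_vertices : ∀ (ρ : Fin 3 → Fin 3) (c : Fin 3 → Fin 3),
      (∀ b b', ρ b ≠ ρ b' → b ≠ c (ρ b + ρ b')) →
        (Finset.univ.filter fun b => ρ b = 0).card ≡
          (Finset.univ.filter fun b => ρ b = 1).card [MOD 3] := by decide +kernel
  let c : Fin 3 → Fin 3 := ![e s(1, 2), e s(0, 1), e s(0, 2)]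
  have rim_eq : ∀ p q, p ≠ q → e s(p, q) = c (p + q) := by
    intro p q hpq
    fin_cases p <;> fin_cases q <;>
      first | exact absurd rfl hpq | rfl | exact congrArg e Sym2.eq_swap
  rw [card_fiber_eq_sum φ, card_fiber_eq_sum φ]
  exact Nat.ModEq.sum fun t _ => three_vertices (fun b => π (φ (t, b))) c fun b b' hne =>
    rim_eq _ _ hne ▸ hφ t b b' hne

theorem three_dvd_card_fiber_of_card_eq_nine {π : ι → Fin 2}
    (h : RainbowColorable (hubGraph π) 3) (hn : Fintype.card ι = 9) :
    3 ∣ (Finset.univ.filter fun i => π i = 0).card := by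
  obtain ⟨φ, e, hφ⟩ := exists_equiv_of_card_eq_nine h hn
  have three_vertices : ∀ (ρ : Fin 3 → Fin 2) (c : Fin 3), (∀ b b', ρ b ≠ ρ b' → b ≠ c) →
      3 ∣ (Finset.univ.filter fun b => ρ b = 0).card := by decide +kernel
  have rim_eq : ∀ p q, p ≠ q → e s(p, q) = e s(0, 1) := by
    intro p q hpq
    fin_cases p <;> fin_cases q <;>
      first | exact absurd rfl hpq | rfl | exact congrArg e Sym2.eq_swap
  rw [card_fiber_eq_sum φ]
  exact Finset.dvd_sum fun t _ => three_vertices (fun b => π (φ (t, b))) (e s(0, 1))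
    fun b b' hne => rim_eq _ _ hne ▸ hφ t b b' hne

theorem card_fiber_le_six {π : ι → Fin 2} {j : ι} (hj : ∀ i, π i = 1 ↔ i = j)
    (h : RainbowColorable (hubGraph π) 3) : (Finset.univ.filter fun i => π i = 0).card ≤ 6 := by
  obtain ⟨f, hf⟩ := h
  have hπj : π j = 1 := (hj j).2 rfl
  have admissible_pairs : ∀ t d e : Fin 3, ((Finset.univ : Finset (Fin 3 × Fin 3)).filter fun x =>
      (x.1 = t → x.2 ≠ d ∧ x.2 ≠ e ∧ d ≠ e) ∧
      (x.2 = e → x.1 ≠ t ∧ x.1 ≠ d ∧ t ≠ d)).card ≤ 6 := by decide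
  refine le_trans ?_ (admissible_pairs (f s(mid j, hub)) (f s(mid j, rim 1)) (f s(rim 0, rim 1)))
  refine Finset.card_le_card_of_injOn _ (fun i hi => ?_) (injective_of_rainbowJoined hf).injOn
  have hi : π i = 0 := by simpa using hi
  have hp : π i ≠ π j := by simp [hi, hπj]
  simp only [Finset.mem_coe, Finset.mem_filter, Finset.mem_univ, true_and, hi]
  refine ⟨fun ht => ?_, fun hb => ?_⟩
  · have hcompat := (hf (mid i) (mid j)).rimCompatible (by simp) (fun h => hp (congrArg π h)) ht
    simpa [hi, hπj] using And.intro hcompat.1 (hcompat.2 hp)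
  · obtain h' | ⟨q, hq⟩ | ⟨l, hl, h'⟩ :=
      (hf (mid i) (rim 1)).mid_rim_cases (by simp) (by simp [hi])
    · rw [hi] at h'
      exact absurd hb h'
    · rw [hi] at hq
      omega
    · obtain rfl := (hj l).1 hl
      exact h'

end LowerBounds

section Isomorphisms

open HubVertex

variable {ι ι' P P' V W : Type*} {π : ι → P} {π' : ι' → P'} {G : SimpleGraph V}
  {H : SimpleGraph W}

/-- The isomorphism between the hub graphs of two maps that agree up to relabelling. -/
def hubGraphIso (σ : ι ≃ ι') (τ : P ≃ P') (h : ∀ i, π' (σ i) = τ (π i)) :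
    hubGraph π ≃g hubGraph π' where
  toFun
    | .mid i => .mid (σ i)
    | .rim p => .rim (τ p)
    | .hub => .hub
  invFun
    | .mid i => .mid (σ.symm i)
    | .rim p => .rim (τ.symm p)
    | .hub => .hub
  left_inv := by rintro (i | p | _) <;> simp
  right_inv := by rintro (i | p | _) <;> simp
  map_rel_iff' := by rintro (i | p | _) (j | q | _) <;> simp [h]

/-- The isomorphism between the duplications of two isomorphic graphs at corresponding vertices. -/
def duplicateIso (φ : G ≃g H) (v : V) : duplicate G v ≃g duplicate H (φ v) where
  toEquiv := φ.toEquiv.optionCongr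
  map_rel_iff' := by
    rintro (_ | a) (_ | b) <;>
      first | exact φ.map_rel_iff | simp [duplicate]

/-- The duplication of a middle vertex of a hub graph, as a hub graph with one more middle
vertex. -/
def duplicateMidIso (π : ι → P) (i : ι) :
    duplicate (hubGraph π) (mid i) ≃g hubGraph (fun o : Option ι => o.elim (π i) π) where
  toFun
    | none => .mid none
    | some (.mid j) => .mid (some j)
    | some (.rim p) => .rim p
    | some .hub => .hub
  invFun
    | .mid none => none
    | .mid (some j) => some (.mid j)
    | .rim p => some (.rim p)
    | .hub => some .hub
  left_inv := by rintro (_ | (i | p | _)) <;> rfl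
  right_inv := by rintro ((_ | i) | p | _) <;> rfl
  map_rel_iff' := by
    rintro (_ | (j | p | _)) (_ | (l | q | _)) <;> simp [duplicate]

open Classical in
/-- In a hub graph with two parts, exchanges the hub with the rim vertex other than `rim p`, and
`rim p` with the middle vertex `i₀`. If `i₀` is the only middle vertex of the part `p`, this is a
reflection of the graph. -/
noncomputable def hubSwapFun (p : Fin 2) (i₀ : ι) : HubVertex ι (Fin 2) → HubVertex ι (Fin 2)
  | .mid i => if i = i₀ then .rim p else .mid i
  | .rim q => if q = p then .mid i₀ else .hub
  | .hub => .rim (p + 1)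

theorem hubSwapFun_involutive (p : Fin 2) (i₀ : ι) : Function.Involutive (hubSwapFun p i₀) := by
  have hp : p + 1 ≠ p := by omega
  rintro (i | q | _)
  · by_cases hi : i = i₀ <;> simp [hubSwapFun, hi]
  · by_cases hq : q = p
    · simp [hubSwapFun, hq]
    · simp [hubSwapFun, hq, show p + 1 = q by omega]
  · simp [hubSwapFun, hp]

theorem hubSwapFun_adj {π : ι → Fin 2} {p : Fin 2} {i₀ : ι} (h : ∀ i, π i = p ↔ i = i₀)
    (a b : HubVertex ι (Fin 2)) (hab : (hubGraph π).Adj a b) :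
    (hubGraph π).Adj (hubSwapFun p i₀ a) (hubSwapFun p i₀ b) := by
  have hi₀ : π i₀ = p := (h i₀).2 rfl
  have other_part (i : ι) (hi : i ≠ i₀) : π i = p + 1 := by
    have := (h i).not.2 hi
    omega
  rcases a with i | q | _ <;> rcases b with j | r | _ <;> simp only [hubSwapFun] <;>
    grind -ring [hubGraph_mid_mid, hubGraph_mid_rim, hubGraph_mid_hub, hubGraph_rim_mid,
      hubGraph_rim_rim, hubGraph_rim_hub, hubGraph_hub_mid, hubGraph_hub_rim,
      SimpleGraph.irrefl]

/-- The automorphism `hubSwapFun` of a hub graph with two parts, one of which is a single middle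
vertex. -/
noncomputable def hubSwap {π : ι → Fin 2} {p : Fin 2} {i₀ : ι} (h : ∀ i, π i = p ↔ i = i₀) :
    hubGraph π ≃g hubGraph π where
  toEquiv := (hubSwapFun_involutive p i₀).toPerm
  map_rel_iff' := by
    intro a b
    refine ⟨fun hab => ?_, hubSwapFun_adj h a b⟩
    simpa only [Function.Involutive.coe_toPerm, (hubSwapFun_involutive p i₀) _] using
      hubSwapFun_adj h _ _ hab

/-- The five-cycle as a hub graph. -/
def cycleGraphFiveIso : SimpleGraph.cycleGraph 5 ≃g hubGraph (id : Fin 2 → Fin 2) where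
  toFun := ![hub, mid 0, rim 0, rim 1, mid 1]
  invFun
    | .hub => 0
    | .mid i => ![1, 4] i
    | .rim i => ![2, 3] i
  left_inv := by intro a; fin_cases a <;> rfl
  right_inv := by rintro (i | i | _) <;> first | rfl | (fin_cases i <;> rfl)
  map_rel_iff' := by
    intro a b
    rw [SimpleGraph.cycleGraph_adj]
    fin_cases a <;> fin_cases b <;> simp [-zero_sub, Fin.ext_iff, Fin.sub_def]

/-- The graph `G7` as a hub graph. -/
def G7Iso : G7 ≃g hubGraph (id : Fin 3 → Fin 3) where
  toFun
    | .inl a => Fin.cases hub rim a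
    | .inr i => mid i
  invFun
    | .hub => .inl 0
    | .mid i => .inr i
    | .rim i => .inl i.succ
  left_inv := by
    rintro (a | i)
    · induction a using Fin.cases <;> rfl
    · rfl
  right_inv := by rintro (i | i | _) <;> rfl
  map_rel_iff' := by
    rintro (a | i) (b | j)
    · induction a using Fin.cases <;> induction b using Fin.cases <;> simp [G7]
    · induction a using Fin.cases <;> simp [G7, eq_comm]
    · induction b using Fin.cases <;> simp [G7, eq_comm]
    · simp [G7]

theorem encard_neighborSet_iso (φ : G ≃g H) (v : V) :
    (G.neighborSet v).encard = (H.neighborSet (φ v)).encard :=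
  Set.encard_congr (φ.mapNeighborSet v)

theorem encard_neighborSet_mid (π : ι → P) (i : ι) :
    ((hubGraph π).neighborSet (mid i)).encard = 2 := by
  have : (hubGraph π).neighborSet (mid i) = {hub, rim (π i)} := by
    ext a
    rcases a with j | q | _ <;> simp [eq_comm]
  rw [this, Set.encard_pair (by simp)]

theorem eq_of_encard_eq_two {α : Type*} {s : Set α} (hs : s.encard = 2) {a b c : α} (ha : a ∈ s)
    (hb : b ∈ s) (hc : c ∈ s) (hac : a ≠ c) (hbc : b ≠ c) : a = b := by
  obtain ⟨x, y, -, rfl⟩ := Set.encard_eq_two.1 hs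
  grind

theorem petersen_encard_neighborSet_ne_two (v : ZMod 5 ⊕ ZMod 5) :
    (petersen.neighborSet v).encard ≠ 2 := by
  have neighbors : ∀ i : ZMod 5, petersen.Adj (.inl i) (.inl (i + 1)) ∧
      petersen.Adj (.inl i) (.inl (i - 1)) ∧ petersen.Adj (.inr i) (.inr (i + 2)) ∧
      petersen.Adj (.inr i) (.inr (i - 2)) ∧ petersen.Adj (.inl i) (.inr i) ∧
      i + 1 ≠ i - 1 ∧ i + 2 ≠ i - 2 := by decide
  intro hv
  rcases v with i | i <;> obtain ⟨h₁, h₂, h₃, h₄, h₅, hne₁, hne₂⟩ := neighbors i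
  · exact hne₁ (Sum.inl.inj (eq_of_encard_eq_two hv h₁ h₂ h₅ (by simp) (by simp)))
  · exact hne₂ (Sum.inr.inj (eq_of_encard_eq_two hv h₃ h₄ h₅.symm (by simp) (by simp)))

end Isomorphisms

section Family

open HubVertex

/-- `G` is the hub graph of a surjection from a finite type onto `Fin k`. -/
def IsHubGraph (k : ℕ) {V : Type*} (G : SimpleGraph V) : Prop :=
  ∃ (ι : Type) (_ : Finite ι) (π : ι → Fin k), Function.Surjective π ∧ Nonempty (G ≃g hubGraph π)

theorem IsHubGraph.congr {k : ℕ} {V W : Type*} {G : SimpleGraph V} {H : SimpleGraph W}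
    (φ : G ≃g H) : IsHubGraph k H → IsHubGraph k G := by
  rintro ⟨ι, hι, π, hπ, ⟨ψ⟩⟩
  exact ⟨ι, hι, π, hπ, ⟨φ.trans ψ⟩⟩

variable {k : ℕ} {ι : Type} [Finite ι]

theorem isHubGraph_duplicate_mid {π : ι → Fin k} (hπ : Function.Surjective π) (i : ι) :
    IsHubGraph k (duplicate (hubGraph π) (mid i)) :=
  ⟨Option ι, inferInstance, _, fun p => (hπ p).elim fun j hj => ⟨some j, hj⟩,
    ⟨duplicateMidIso π i⟩⟩

theorem isHubGraph_duplicate_rim {π : ι → Fin 2} (hπ : Function.Surjective π) {p : Fin 2}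
    (hp : ((hubGraph π).neighborSet (rim p)).encard = 2) :
    IsHubGraph 2 (duplicate (hubGraph π) (rim p)) := by
  obtain ⟨i, hi⟩ := hπ p
  have hunique (j : ι) : π j = p ↔ j = i := by
    refine ⟨fun hj => HubVertex.mid.inj (eq_of_encard_eq_two hp (c := rim (p + 1)) ?_ ?_ ?_ ?_ ?_),
      fun h => h ▸ hi⟩ <;> simp [hi, hj]
  have hswap : hubSwap hunique (rim p) = mid i := by simp [hubSwap, hubSwapFun]
  exact (hswap ▸ isHubGraph_duplicate_mid hπ i).congr (duplicateIso (hubSwap hunique) (rim p))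

theorem isHubGraph_duplicate_hub {π : ι → Fin 2} (hπ : Function.Surjective π)
    (hhub : ((hubGraph π).neighborSet hub).encard = 2) :
    IsHubGraph 2 (duplicate (hubGraph π) hub) := by
  obtain ⟨s, hs⟩ := hπ.hasRightInverse
  have hunique (j : ι) : π j = 0 ↔ j = s 0 := by
    refine ⟨fun hj => HubVertex.mid.inj
      (eq_of_encard_eq_two hhub (c := mid (s 1)) (by simp) (by simp) (by simp) ?_ ?_),
      fun h => h ▸ hs 0⟩
    · rw [Ne, HubVertex.mid.injEq]
      rintro rfl
      simp [hs 1] at hj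
    · simp [hs.injective.eq_iff]
  have hswap : hubSwap hunique hub = rim 1 := by simp [hubSwap, hubSwapFun]
  rw [encard_neighborSet_iso (hubSwap hunique), hswap] at hhub
  exact (hswap ▸ isHubGraph_duplicate_rim hπ hhub).congr (duplicateIso (hubSwap hunique) hub)

theorem isHubGraph_two_duplicate {π : ι → Fin 2} (hπ : Function.Surjective π)
    {v : HubVertex ι (Fin 2)} (hv : ((hubGraph π).neighborSet v).encard = 2) :
    IsHubGraph 2 (duplicate (hubGraph π) v) := by
  rcases v with i | p | _
  · exact isHubGraph_duplicate_mid hπ i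
  · exact isHubGraph_duplicate_rim hπ hv
  · exact isHubGraph_duplicate_hub hπ hv

theorem isHubGraph_three_duplicate {π : ι → Fin 3} (hπ : Function.Surjective π)
    {v : HubVertex ι (Fin 3)} (hv : ((hubGraph π).neighborSet v).encard = 2) :
    IsHubGraph 3 (duplicate (hubGraph π) v) := by
  rcases v with i | p | _
  · exact isHubGraph_duplicate_mid hπ i
  · obtain ⟨i, hi⟩ := hπ p
    have := eq_of_encard_eq_two hv (a := rim (p + 1)) (b := rim (p + 2)) (c := mid i)
      (by simp) (by simp) (by simpa using hi) (by simp) (by simp)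
    simp at this
  · obtain ⟨s, hs⟩ := hπ.hasRightInverse
    have := eq_of_encard_eq_two hv (a := mid (s 0)) (b := mid (s 1)) (c := mid (s 2))
      (by simp) (by simp) (by simp) (by simp [hs.injective.eq_iff]) (by simp [hs.injective.eq_iff])
    simp [hs.injective.eq_iff] at this

theorem Family.isHubGraph {V : Type u} {G : SimpleGraph V} (h : Family G) :
    Nonempty (G ≃g petersen) ∨ IsHubGraph 2 G ∨ IsHubGraph 3 G := by
  induction h with
  | base_C5 e =>
    exact .inr (.inl ⟨Fin 2, inferInstance, id, Function.surjective_id,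
      ⟨e.trans cycleGraphFiveIso⟩⟩)
  | base_G7 e =>
    exact .inr (.inr ⟨Fin 3, inferInstance, id, Function.surjective_id, ⟨e.trans G7Iso⟩⟩)
  | base_petersen e => exact .inl ⟨e⟩
  | dup v _ hv e ih =>
    obtain ⟨⟨φ⟩⟩ | ⟨ι, hι, π, hπ, ⟨φ⟩⟩ | ⟨ι, hι, π, hπ, ⟨φ⟩⟩ := ih <;>
      rw [encard_neighborSet_iso φ] at hv
    · exact absurd hv (petersen_encard_neighborSet_ne_two _)
    · exact .inr (.inl ((isHubGraph_two_duplicate hπ hv).congr (e.trans (duplicateIso φ v))))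
    · exact .inr (.inr ((isHubGraph_three_duplicate hπ hv).congr (e.trans (duplicateIso φ v))))

theorem family_of_sumElim
    (hbase : ∀ {V : Type u} (G : SimpleGraph V), G ≃g hubGraph (id : Fin k → Fin k) → Family G)
    (κ : Type) [Finite κ] : ∀ (ρ : κ → Fin k) {V : Type u} (G : SimpleGraph V),
      G ≃g hubGraph (Sum.elim id ρ : Fin k ⊕ κ → Fin k) → Family G := by
  induction κ using Finite.induction_empty_option with
  | @of_equiv α β e ih =>
    intro ρ V G φ
    refine ih (ρ ∘ e) G (φ.trans (hubGraphIso ((Equiv.refl _).sumCongr e) (Equiv.refl _) ?_).symm)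
    rintro (i | i) <;> rfl
  | h_empty =>
    intro ρ V G φ
    refine hbase G (φ.trans (hubGraphIso (Equiv.sumEmpty _ _) (Equiv.refl _) ?_))
    rintro (i | i)
    · rfl
    · exact i.elim
  | @h_option α _ ih =>
    intro ρ V G φ
    let π : Fin k ⊕ α → Fin k := Sum.elim id fun a => ρ (some a)
    let v : HubVertex (Fin k ⊕ α) (Fin k) := mid (.inl (ρ none))
    let H : SimpleGraph (ULift.{u} (HubVertex (Fin k ⊕ α) (Fin k))) :=
      (hubGraph π).comap Equiv.ulift
    let ψ : H ≃g hubGraph π := SimpleGraph.Iso.comap Equiv.ulift _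
    have hH : Family H := ih (fun a => ρ (some a)) H ψ
    have hv : (H.neighborSet (ULift.up v)).encard = 2 :=
      (encard_neighborSet_iso ψ _).trans (encard_neighborSet_mid π _)
    let σ : Option (Fin k ⊕ α) ≃ Fin k ⊕ Option α :=
      (Equiv.optionEquivSumPUnit.{0} _).trans <| (Equiv.sumAssoc _ _ _).trans <|
        (Equiv.refl _).sumCongr (Equiv.optionEquivSumPUnit.{0} α).symm
    have hσ : ∀ o, Sum.elim id ρ (σ o) = o.elim (π (.inl (ρ none))) π := by
      rintro (_ | (i | i)) <;> rfl
    exact Family.dup (ULift.up v) hH hv <| φ.trans <|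
      (hubGraphIso σ (Equiv.refl _) hσ).symm.trans <|
        (duplicateMidIso π _).symm.trans (duplicateIso ψ.symm v)

theorem exists_sumElim {π : ι → Fin k} (hπ : Function.Surjective π) :
    ∃ (κ : Type) (_ : Finite κ) (ρ : κ → Fin k),
      Nonempty (hubGraph π ≃g hubGraph (Sum.elim id ρ : Fin k ⊕ κ → Fin k)) := by
  classical
  obtain ⟨s, hs⟩ := hπ.hasRightInverse
  let σ : Fin k ⊕ ((Set.range s)ᶜ : Set ι) ≃ ι :=
    ((Equiv.ofInjective s hs.injective).sumCongr (Equiv.refl _)).trans (Equiv.Set.sumCompl _)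
  refine ⟨((Set.range s)ᶜ : Set ι), inferInstance, fun i => π i,
    ⟨(hubGraphIso σ (Equiv.refl _) ?_).symm⟩⟩
  rintro (p | i)
  · exact hs p
  · rfl

theorem IsHubGraph.family
    (hbase : ∀ {V : Type u} (G : SimpleGraph V), G ≃g hubGraph (id : Fin k → Fin k) → Family G)
    {V : Type u} {G : SimpleGraph V} (h : IsHubGraph k G) : Family G := by
  obtain ⟨ι, hι, π, hπ, ⟨φ⟩⟩ := h
  obtain ⟨κ, hκ, ρ, ⟨ψ⟩⟩ := exists_sumElim hπ
  exact family_of_sumElim hbase κ ρ G (φ.trans ψ)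

/-- The hub graph with `n p` middle vertices in the part `p`. -/
def hubGraphOfSizes (n : Fin k → ℕ) :
    SimpleGraph (HubVertex (Σ p : Fin k, Fin (n p)) (Fin k)) :=
  hubGraph Sigma.fst

theorem isHubGraph_hubGraphOfSizes {n : Fin k → ℕ} (hn : ∀ p, 1 ≤ n p) :
    IsHubGraph k (hubGraphOfSizes n) :=
  ⟨_, inferInstance, Sigma.fst, fun p => ⟨⟨p, ⟨0, hn p⟩⟩, rfl⟩, ⟨RelIso.refl _⟩⟩

theorem IsHubGraph.exists_sizes {V : Type*} {G : SimpleGraph V} (h : IsHubGraph k G) :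
    ∃ n : Fin k → ℕ, Antitone n ∧ (∀ p, 1 ≤ n p) ∧ Nonempty (G ≃g hubGraphOfSizes n) := by
  obtain ⟨ι, hι, π, hπ, ⟨φ⟩⟩ := h
  let c : Fin k → ℕ := fun p => Nat.card {i // π i = p}
  let τ : Equiv.Perm (Fin k) := Tuple.sort fun p => OrderDual.toDual (c p)
  let ε (p : Fin k) : Fin (c (τ p)) ≃ {i // π i = τ p} := (Finite.equivFin _).symm
  have card_pos (p : Fin k) : 1 ≤ c (τ p) := by
    obtain ⟨i, hi⟩ := hπ (τ p)
    have : Nonempty {i // π i = τ p} := ⟨⟨i, hi⟩⟩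
    exact Nat.card_pos
  exact ⟨c ∘ τ, Tuple.monotone_sort fun p => OrderDual.toDual (c p), card_pos,
    ⟨φ.trans (hubGraphIso ((Equiv.sigmaCongr τ ε).trans (Equiv.sigmaFiberEquiv π)) τ
      fun x => (ε x.1 x.2).2).symm⟩⟩

/-- The graph `G_{p,q}` as a hub graph. -/
def G₂Iso (p q : ℕ) : G₂ p q ≃g hubGraphOfSizes ![p, q] where
  toFun
    | .u i => .mid ⟨0, i⟩
    | .v i => .mid ⟨1, i⟩
    | .x₁ => .rim 0
    | .x₂ => .rim 1
    | .y => .hub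
  invFun
    | .mid ⟨0, i⟩ => .u i
    | .mid ⟨1, i⟩ => .v i
    | .rim 0 => .x₁
    | .rim 1 => .x₂
    | .hub => .y
  left_inv := by rintro (i | i | _) <;> rfl
  right_inv := by rintro (⟨a, i⟩ | a | _) <;> first | rfl | (fin_cases a <;> rfl)
  map_rel_iff' := by rintro (i | i | _) (j | j | _) <;> simp [hubGraphOfSizes, G₂]

/-- The graph `G_{p,q,r}` as a hub graph. -/
def G₃Iso (p q r : ℕ) : G₃ p q r ≃g hubGraphOfSizes ![p, q, r] where
  toFun
    | .u i => .mid ⟨0, i⟩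
    | .v i => .mid ⟨1, i⟩
    | .w i => .mid ⟨2, i⟩
    | .x₁ => .rim 0
    | .x₂ => .rim 1
    | .x₃ => .rim 2
    | .y => .hub
  invFun
    | .mid ⟨0, i⟩ => .u i
    | .mid ⟨1, i⟩ => .v i
    | .mid ⟨2, i⟩ => .w i
    | .rim 0 => .x₁
    | .rim 1 => .x₂
    | .rim 2 => .x₃
    | .hub => .y
  left_inv := by rintro (i | i | i | _) <;> rfl
  right_inv := by rintro (⟨a, i⟩ | a | _) <;> first | rfl | (fin_cases a <;> rfl)
  map_rel_iff' := by rintro (i | i | i | _) (j | j | j | _) <;> simp [hubGraphOfSizes, G₃]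

theorem isHubGraph_two_iff {V : Type*} (G : SimpleGraph V) :
    IsHubGraph 2 G ↔ ∃ p q : ℕ, p ≥ q ∧ q ≥ 1 ∧ Nonempty (G ≃g G₂ p q) := by
  constructor
  · intro h
    obtain ⟨n, hn, hpos, ⟨φ⟩⟩ := h.exists_sizes
    rw [show n = ![n 0, n 1] by ext i; fin_cases i <;> rfl] at φ
    exact ⟨n 0, n 1, hn (by decide), hpos 1, ⟨φ.trans (G₂Iso _ _).symm⟩⟩
  · rintro ⟨p, q, hpq, hq, ⟨φ⟩⟩
    refine (isHubGraph_hubGraphOfSizes fun i => ?_).congr (φ.trans (G₂Iso p q))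
    fin_cases i
    exacts [hq.trans hpq, hq]

theorem isHubGraph_three_iff {V : Type*} (G : SimpleGraph V) :
    IsHubGraph 3 G ↔ ∃ p q r : ℕ, p ≥ q ∧ q ≥ r ∧ r ≥ 1 ∧ Nonempty (G ≃g G₃ p q r) := by
  constructor
  · intro h
    obtain ⟨n, hn, hpos, ⟨φ⟩⟩ := h.exists_sizes
    rw [show n = ![n 0, n 1, n 2] by ext i; fin_cases i <;> rfl] at φ
    exact ⟨n 0, n 1, n 2, hn (by decide), hn (by decide), hpos 2, ⟨φ.trans (G₃Iso _ _ _).symm⟩⟩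
  · rintro ⟨p, q, r, hpq, hqr, hr, ⟨φ⟩⟩
    refine (isHubGraph_hubGraphOfSizes fun i => ?_).congr (φ.trans (G₃Iso p q r))
    fin_cases i
    exacts [(hr.trans hqr).trans hpq, hr.trans hqr, hr]

theorem family_iff {V : Type u} (G : SimpleGraph V) :
    Family G ↔ Nonempty (G ≃g petersen) ∨
      (∃ p q : ℕ, p ≥ q ∧ q ≥ 1 ∧ Nonempty (G ≃g G₂ p q)) ∨
      (∃ p q r : ℕ, p ≥ q ∧ q ≥ r ∧ r ≥ 1 ∧ Nonempty (G ≃g G₃ p q r)) := by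
  rw [← isHubGraph_two_iff, ← isHubGraph_three_iff]
  refine ⟨Family.isHubGraph, ?_⟩
  rintro (⟨⟨φ⟩⟩ | h | h)
  · exact .base_petersen φ
  · exact h.family fun _ χ => .base_C5 (χ.trans cycleGraphFiveIso.symm)
  · exact h.family fun _ χ => .base_G7 (χ.trans G7Iso.symm)

end Family

section Hall

variable {ι β : Type*} [DecidableEq β]

theorem exists_injOn_of_forall_card_le [Nonempty β] (R : Finset ι) (S : ι → Finset β)
    (h : ∀ s ⊆ R, s.card ≤ (s.biUnion S).card) :
    ∃ x : ι → β, (∀ i ∈ R, x i ∈ S i) ∧ Set.InjOn x R := by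
  classical
  obtain ⟨x, hx, hxS⟩ :=
    (Finset.all_card_le_biUnion_card_iff_exists_injective fun i : R => S i).1 fun s => by
      have hs := h (s.map (Function.Embedding.subtype _)) fun i hi => by
        obtain ⟨j, -, rfl⟩ := Finset.mem_map.1 hi
        exact j.2
      rwa [Finset.card_map, Finset.map_eq_image, Finset.image_biUnion] at hs
  let y : ι → β := Function.extend Subtype.val x fun _ => Classical.arbitrary β
  have hy (i : R) : y i = x i := Subtype.val_injective.extend_apply x _ i
  refine ⟨y, fun i hi => ?_, fun i hi j hj hij => ?_⟩
  · rw [hy ⟨i, hi⟩]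
    exact hxS ⟨i, hi⟩
  · rw [hy ⟨i, hi⟩, hy ⟨j, hj⟩] at hij
    exact congrArg Subtype.val (hx hij)

/-- Hall's theorem for the lists `S i × Fin k`. -/
theorem exists_card_filter_eq_le [Nonempty β] (k : ℕ) [NeZero k] (R : Finset ι)
    (S : ι → Finset β) (h : ∀ s ⊆ R, s.card ≤ k * (s.biUnion S).card) :
    ∃ x : ι → β, (∀ i ∈ R, x i ∈ S i) ∧ ∀ c, (R.filter fun i => x i = c).card ≤ k := by
  obtain ⟨x, hx, hinj⟩ := exists_injOn_of_forall_card_le R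
    (fun i => S i ×ˢ (Finset.univ : Finset (Fin k))) fun s hs => by
      have hprod : (s.biUnion fun i => S i ×ˢ (Finset.univ : Finset (Fin k))) =
          s.biUnion S ×ˢ Finset.univ := by
        ext ⟨c, l⟩
        simp
      rw [hprod, Finset.card_product, Finset.card_fin, mul_comm]
      exact h s hs
  refine ⟨fun i => (x i).1, fun i hi => (Finset.mem_product.1 (hx i hi)).1, fun c => ?_⟩
  refine (Finset.card_le_card_of_injOn (t := Finset.univ) (fun i => (x i).2)
    (fun i _ => by simp) ?_).trans_eq (Finset.card_fin k)
  intro i hi j hj hij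
  obtain ⟨hi, hic⟩ := Finset.mem_filter.1 hi
  obtain ⟨hj, hjc⟩ := Finset.mem_filter.1 hj
  exact hinj hi hj (Prod.ext (hic.trans hjc.symm) hij)

theorem card_le_card_biUnion {S : ι → Finset β} {k : ℕ} {s : Finset ι} (hs : s.Nonempty)
    (hS : ∀ i, k ≤ (S i).card) : k ≤ (s.biUnion S).card := by
  obtain ⟨i, hi⟩ := hs
  exact (hS i).trans (Finset.card_le_card (Finset.subset_biUnion_of_mem S hi))

theorem eq_insert_biUnion_erase {A : ι → Finset β} {k : ℕ} {a : β} {s : Finset ι}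
    (hA : ∀ i ∈ s, (A i).card = k + 1) (h : (s.biUnion fun i => (A i).erase a).card ≤ k) :
    ∀ i ∈ s, A i = insert a (s.biUnion fun i => (A i).erase a) := fun i hi =>
  Finset.eq_of_subset_of_card_le
    ((Finset.insert_erase_subset a (A i)).trans
      (Finset.insert_subset_insert a (Finset.subset_biUnion_of_mem (fun i => (A i).erase a) hi)))
    ((Finset.card_insert_le _ _).trans (by rw [hA i hi]; omega))

theorem two_le_card_erase {B : Finset β} (hB : B.card = 3) (c : β) : 2 ≤ (B.erase c).card := by
  have := Finset.pred_card_le_card_erase (s := B) (a := c)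
  omega

theorem exists_injOn_erase [Nonempty β] {B : ι → Finset β} (hB : ∀ i, (B i).card = 3) (c : β)
    {K : Finset ι} (hK : K.card ≤ 3)
    (hconst : K.card = 3 → ¬ ∃ S : Finset β, c ∈ S ∧ ∀ i ∈ K, B i = S) :
    ∃ x : ι → β, (∀ i ∈ K, x i ∈ (B i).erase c) ∧ Set.InjOn x K := by
  refine exists_injOn_of_forall_card_le K (fun i => (B i).erase c) fun s hs => ?_
  rcases s.eq_empty_or_nonempty with rfl | hne
  · simp
  have h2 := card_le_card_biUnion hne fun i => two_le_card_erase (hB i) c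
  have hsK := Finset.card_le_card hs
  by_contra hlt
  obtain rfl : s = K := Finset.eq_of_subset_of_card_le hs (by omega)
  exact hconst (by omega) ⟨_, Finset.mem_insert_self _ _,
    eq_insert_biUnion_erase (fun i _ => hB i) (by omega)⟩

end Hall

section RimColorable

variable {ι P : Type*} {π : ι → P} {B : ι → Finset ℕ} {e : Sym2 P → ℕ} {K K' : Finset ι}

/-- The middle vertices in `K`, if they have a common colour at the hub, can be given colours at
the rim from the lists `B` that make them rim compatible. -/
def IsRimColorable (π : ι → P) (B : ι → Finset ℕ) (e : Sym2 P → ℕ) (K : Finset ι) : Prop :=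
  ∃ bot : ι → ℕ, (∀ i ∈ K, bot i ∈ B i) ∧ ∀ i ∈ K, ∀ j ∈ K, i ≠ j → RimCompatible π e bot i j

theorem IsRimColorable.mono (h : IsRimColorable π B e K') (hK : K ⊆ K') :
    IsRimColorable π B e K := by
  obtain ⟨bot, hbot, hcompat⟩ := h
  exact ⟨bot, fun i hi => hbot i (hK hi), fun i hi j hj => hcompat i (hK hi) j (hK hj)⟩

theorem isRimColorable_of_erase (hB : ∀ i, (B i).card = 3) (c : ℕ) (hK : K.card ≤ 3)
    (hconst : K.card = 3 → ¬ ∃ S : Finset ℕ, c ∈ S ∧ ∀ i ∈ K, B i = S)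
    (hc : ∀ i ∈ K, ∀ j ∈ K, π i ≠ π j → e s(π i, π j) = c) : IsRimColorable π B e K := by
  obtain ⟨x, hx, hinj⟩ := exists_injOn_erase hB c hK hconst
  refine ⟨x, fun i hi => Finset.mem_of_mem_erase (hx i hi), fun i hi j hj hij =>
    ⟨hinj.ne hi hj hij, fun hp => ?_⟩⟩
  rw [hc i hi j hj hp]
  exact ⟨Finset.ne_of_mem_erase (hx i hi), Finset.ne_of_mem_erase (hx j hj)⟩

theorem isRimColorable_of_card_le_two (hB : ∀ i, (B i).card = 3) (hK : K.card ≤ 2) :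
    IsRimColorable π B e K := by
  classical
  rcases (show K.card ≤ 1 ∨ K.card = 2 by omega) with h1 | h2
  · exact isRimColorable_of_erase hB 0 (by omega) (by omega) fun i hi j hj h =>
      absurd (congrArg π (Finset.card_le_one.1 h1 i hi j hj)) h
  · obtain ⟨i, j, -, rfl⟩ := Finset.card_eq_two.1 h2
    refine isRimColorable_of_erase hB (e s(π i, π j)) (by omega) (by omega) ?_
    simp only [Finset.mem_insert, Finset.mem_singleton]
    rintro a (rfl | rfl) b (rfl | rfl) hab
    exacts [absurd rfl hab, rfl, congrArg e Sym2.eq_swap, absurd rfl hab]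

theorem isRimColorable_of_same_part (hB : ∀ i, (B i).card = 3) (hK : K.card ≤ 3)
    (hp : ∀ i ∈ K, ∀ j ∈ K, π i = π j) : IsRimColorable π B e K := by
  obtain ⟨x, hx, hinj⟩ := exists_injOn_of_forall_card_le K B fun s hs => by
    rcases s.eq_empty_or_nonempty with rfl | hne
    · simp
    · exact ((Finset.card_le_card hs).trans hK).trans
        (card_le_card_biUnion hne fun i => (hB i).ge)
  exact ⟨x, hx, fun i hi j hj hij => ⟨hinj.ne hi hj hij, fun h => absurd (hp i hi j hj) h⟩⟩

theorem isRimColorable_two_one [DecidableEq ι] (hB : ∀ i, (B i).card = 3) {i j l : ι}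
    (hij : π i = π j) (h : ¬ (B i = B j ∧ B j = B l ∧ e s(π i, π l) ∈ B l)) :
    IsRimColorable π B e {i, j, l} := by
  refine isRimColorable_of_erase hB (e s(π i, π l)) Finset.card_le_three ?_ ?_
  · rintro - ⟨S, hS, hall⟩
    simp only [Finset.mem_insert, Finset.mem_singleton, forall_eq_or_imp, forall_eq] at hall
    obtain ⟨hi, hj, hl⟩ := hall
    exact h ⟨hi.trans hj.symm, hj.trans hl.symm, hl ▸ hS⟩
  · simp only [Finset.mem_insert, Finset.mem_singleton]
    rintro a (rfl | rfl | rfl) b (rfl | rfl | rfl) hab <;>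
      first
      | exact absurd rfl hab
      | exact absurd hij hab
      | exact absurd hij.symm hab
      | rfl
      | exact congrArg e Sym2.eq_swap
      | exact hij ▸ rfl
      | exact congrArg e (Sym2.eq_swap.trans (hij ▸ rfl))

end RimColorable

section Tops

variable {ι P : Type*} [Fintype ι] {π : ι → P} {A B : ι → Finset ℕ} {e : Sym2 P → ℕ}

theorem exists_bot_of_isRimColorable {top : ι → ℕ} (hB : ∀ i, ∃ c ∈ B i, c ≠ top i)
    (h : ∀ c, IsRimColorable π B e (Finset.univ.filter fun i => top i = c)) :
    ∃ bot : ι → ℕ, (∀ i, bot i ∈ B i) ∧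
      (∀ i j, i ≠ j → top i = top j → RimCompatible π e bot i j) ∧
      ∀ i, top i = bot i → ∃ j, j ≠ i ∧ top j = top i := by
  classical
  choose b hbB hb using h
  choose s hsB hs using hB
  let bot i := if ∃ j, j ≠ i ∧ top j = top i then b (top i) i else s i
  have bot_eq {i j} (hji : j ≠ i) (ht : top j = top i) : bot i = b (top i) i :=
    if_pos ⟨j, hji, ht⟩
  refine ⟨bot, fun i => ?_, fun i j hij ht => ?_, fun i hi => ?_⟩
  · unfold bot
    split_ifs
    exacts [hbB _ i (by simp), hsB i]
  · have hcompat := hb (top i) i (by simp) j (by simp [ht]) hij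
    unfold RimCompatible at hcompat ⊢
    rwa [bot_eq hij.symm ht.symm, bot_eq hij ht, ← ht]
  · by_contra hne
    rw [show bot i = s i from if_neg hne] at hi
    exact hs i hi.symm

/-- At most two lists differ from `T`, so only the colours in `T` can have more than two middle
vertices, and `g` distributes the colours of `T`. -/
theorem exists_top_of_many_equal (hA : ∀ i, (A i).card = 3) (hn : Fintype.card ι ≤ 9)
    (h2 : ∀ K : Finset ι, K.card ≤ 2 → IsRimColorable π B e K) (T : Finset ℕ)
    (hT : 7 ≤ (Finset.univ.filter fun i => A i = T).card) (g : ι → Fin 3)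
    (hg : ∀ c, IsRimColorable π B e (Finset.univ.filter fun i => A i = T ∧ g i = c)) :
    ∃ top : ι → ℕ, (∀ i, top i ∈ A i) ∧
      ∀ c, IsRimColorable π B e (Finset.univ.filter fun i => top i = c) := by
  classical
  have hT3 : T.card = 3 := by
    obtain ⟨i, hi⟩ : (Finset.univ.filter fun i => A i = T).Nonempty :=
      Finset.card_pos.1 (by omega)
    rw [← (Finset.mem_filter.1 hi).2, hA]
  let τ := T.orderIsoOfFin hT3
  have hout (i) : ∃ c, A i ≠ T → c ∈ A i ∧ c ∉ T := by
    by_cases hi : A i = T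
    · exact ⟨0, absurd hi⟩
    · obtain ⟨c, hc, hcT⟩ := Finset.not_subset.1 fun hs =>
        hi (Finset.eq_of_subset_of_card_le hs (by rw [hA, hT3]))
      exact ⟨c, fun _ => ⟨hc, hcT⟩⟩
  choose o ho using hout
  let top i := if A i = T then (τ (g i) : ℕ) else o i
  have top_mem_iff (i) : top i ∈ T ↔ A i = T := by
    by_cases hi : A i = T
    · simp [top, hi]
    · simp [top, hi, ho i hi]
  refine ⟨top, fun i => ?_, fun c => ?_⟩
  · unfold top
    split_ifs with hi
    exacts [hi ▸ (τ (g i)).2, (ho i hi).1]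
  by_cases hc : c ∈ T
  · refine (hg (τ.symm ⟨c, hc⟩)).mono fun i hi => ?_
    obtain rfl : top i = c := by simpa using hi
    have hAi := (top_mem_iff i).1 hc
    simp [hAi, top]
  · refine h2 _ ?_
    have hsub : (Finset.univ.filter fun i => top i = c) ⊆
        Finset.univ.filter fun i => ¬ A i = T := fun i hi => by
      obtain rfl : top i = c := by simpa using hi
      simpa [top_mem_iff] using hc
    have hcard := Finset.card_filter_add_card_filter_not (s := (Finset.univ : Finset ι))
      (fun i => A i = T)
    rw [Finset.card_univ] at hcard
    exact (Finset.card_le_card hsub).trans (by omega)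

theorem exists_top_card_le_two (hA : ∀ i, (A i).card = 3) (hn : Fintype.card ι ≤ 9)
    (h6 : ∀ T : Finset ℕ, (Finset.univ.filter fun i => A i = T).card ≤ 6)
    (h9 : Fintype.card ι = 9 → (Finset.univ.biUnion A).card ≠ 4) :
    ∃ top : ι → ℕ, (∀ i, top i ∈ A i) ∧
      ∀ c, (Finset.univ.filter fun i => top i = c).card ≤ 2 := by
  obtain ⟨x, hx, hc⟩ := exists_card_filter_eq_le 2 Finset.univ A fun s _ => by
    rcases s.eq_empty_or_nonempty with rfl | hne
    · simp
    have h3 := card_le_card_biUnion hne fun i => (hA i).ge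
    have hs := s.card_le_univ
    by_contra! hlt
    rcases h3.eq_or_lt with h3 | h4
    · have hsub : s ⊆ Finset.univ.filter fun i => A i = s.biUnion A := fun j hj => by
        simpa using Finset.eq_of_subset_of_card_le (Finset.subset_biUnion_of_mem A hj)
          (by rw [hA, h3])
      have := Finset.card_le_card hsub
      have := h6 (s.biUnion A)
      omega
    · obtain rfl : s = Finset.univ := Finset.eq_univ_of_card s (by omega)
      exact h9 (by omega) (by omega)
  exact ⟨x, fun i => hx i (Finset.mem_univ i), hc⟩

theorem exists_mem_of_card_biUnion_eq_four (hA : ∀ i, (A i).card = 3)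
    (h4 : (Finset.univ.biUnion A).card = 4) {K : Finset ι} (hK : K.card = 3) :
    ∃ a, ∀ i ∈ K, a ∈ A i := by
  by_contra! hne
  have hsub : Finset.univ.biUnion A ⊆ K.biUnion fun i => Finset.univ.biUnion A \ A i := by
    intro c hc
    obtain ⟨i, hi, hci⟩ := hne c
    exact Finset.mem_biUnion.2 ⟨i, hi, Finset.mem_sdiff.2 ⟨hc, hci⟩⟩
  have hle : (K.biUnion fun i => Finset.univ.biUnion A \ A i).card ≤ K.card * 1 :=
    Finset.card_biUnion_le_card_mul _ _ _ fun i _ => by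
      rw [Finset.card_sdiff_of_subset (Finset.subset_biUnion_of_mem A (Finset.mem_univ i)), hA, h4]
  have := Finset.card_le_card hsub
  omega

theorem exists_top_of_triple [DecidableEq ι] (hA : ∀ i, (A i).card = 3) (hn : Fintype.card ι = 9)
    (h4 : (Finset.univ.biUnion A).card = 4) {K : Finset ι} (hK : K.card = 3)
    (hout : ∀ T : Finset ℕ, (Finset.univ.filter fun i => i ∉ K ∧ A i = T).card ≤ 4) :
    ∃ (top : ι → ℕ) (a : ℕ), (∀ i, top i ∈ A i) ∧ (∀ i, top i = a ↔ i ∈ K) ∧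
      ∀ c, c ≠ a → (Finset.univ.filter fun i => top i = c).card ≤ 2 := by
  obtain ⟨a, ha⟩ := exists_mem_of_card_biUnion_eq_four hA h4 hK
  obtain ⟨x, hx, hc⟩ := exists_card_filter_eq_le 2 Kᶜ (fun i => (A i).erase a) fun s hs => by
    rcases s.eq_empty_or_nonempty with rfl | hne
    · simp
    have h2 := card_le_card_biUnion hne fun i => two_le_card_erase (hA i) a
    have hs6 := Finset.card_le_card hs
    rw [Finset.card_compl, hn, hK] at hs6
    by_contra! hlt
    have hall := eq_insert_biUnion_erase (a := a) (fun i (_ : i ∈ s) => hA i) (by omega)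
    have hsub : s ⊆ Finset.univ.filter fun i => i ∉ K ∧
        A i = insert a (s.biUnion fun i => (A i).erase a) := fun j hj => by
      simpa using ⟨Finset.mem_compl.1 (hs hj), hall j hj⟩
    have := Finset.card_le_card hsub
    have := hout (insert a (s.biUnion fun i => (A i).erase a))
    omega
  have hxA {i} (hi : i ∉ K) := Finset.mem_erase.1 (hx i (Finset.mem_compl.2 hi))
  refine ⟨fun i => if i ∈ K then a else x i, a, fun i => ?_, fun i => ?_, fun c hca => ?_⟩
  · beta_reduce
    split_ifs with hi
    exacts [ha i hi, (hxA hi).2]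
  · by_cases hi : i ∈ K
    · simp [hi]
    · simpa [hi] using (hxA hi).1
  · refine (Finset.card_le_card fun i hi => ?_).trans (hc c)
    simp only [Finset.mem_filter, Finset.mem_univ, true_and] at hi
    split_ifs at hi with hiK
    · exact absurd hi.symm hca
    · exact Finset.mem_filter.2 ⟨Finset.mem_compl.2 hiK, hi⟩

/-- By Hall's theorem the colours at the hub can be chosen with every colour used at most twice,
except when seven lists coincide or nine lists share only four colours. -/
theorem exists_top [DecidableEq ι] (hA : ∀ i, (A i).card = 3) (hn : Fintype.card ι ≤ 9)
    (h2 : ∀ K : Finset ι, K.card ≤ 2 → IsRimColorable π B e K)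
    (h7 : ∀ T : Finset ℕ, 7 ≤ (Finset.univ.filter fun i => A i = T).card → ∃ g : ι → Fin 3,
      ∀ c, IsRimColorable π B e (Finset.univ.filter fun i => A i = T ∧ g i = c))
    (h9 : Fintype.card ι = 9 → (Finset.univ.biUnion A).card = 4 →
      (∀ T : Finset ℕ, (Finset.univ.filter fun i => A i = T).card ≤ 6) →
      ∃ K : Finset ι, K.card = 3 ∧ IsRimColorable π B e K ∧
        ∀ T : Finset ℕ, (Finset.univ.filter fun i => i ∉ K ∧ A i = T).card ≤ 4) :
    ∃ top : ι → ℕ, (∀ i, top i ∈ A i) ∧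
      ∀ c, IsRimColorable π B e (Finset.univ.filter fun i => top i = c) := by
  by_cases! hT : ∃ T : Finset ℕ, 7 ≤ (Finset.univ.filter fun i => A i = T).card
  · obtain ⟨T, hT⟩ := hT
    obtain ⟨g, hg⟩ := h7 T hT
    exact exists_top_of_many_equal hA hn h2 T hT g hg
  have h6 (T : Finset ℕ) := Nat.le_of_lt_succ (hT T)
  by_cases h94 : Fintype.card ι = 9 ∧ (Finset.univ.biUnion A).card = 4
  · obtain ⟨K, hK, hKc, hout⟩ := h9 h94.1 h94.2 h6
    obtain ⟨top, a, htop, ha, hc⟩ := exists_top_of_triple hA h94.1 h94.2 hK hout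
    refine ⟨top, htop, fun c => ?_⟩
    rcases eq_or_ne c a with rfl | hca
    · exact hKc.mono fun i hi => (ha i).1 (by simpa using hi)
    · exact h2 _ (hc c hca)
  · obtain ⟨top, htop, hc⟩ := exists_top_card_le_two hA hn h6 fun h h' => h94 ⟨h, h'⟩
    exact ⟨top, htop, fun c => h2 _ (hc c)⟩

end Tops

section ThreeParts

variable {ι : Type*} {π : ι → Fin 3} {B : ι → Finset ℕ} {X : Fin 3 → Finset ℕ} {x : Fin 3 → ℕ}

/-- The colouring of the edges of a triangle on `Fin 3` that gives each edge the colour `x r` of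
the opposite vertex `r`. -/
def rimColor (x : Fin 3 → ℕ) : Sym2 (Fin 3) → ℕ :=
  Sym2.lift ⟨fun p q => x (-(p + q)), fun p q => congrArg (fun r => x (-r)) (add_comm p q)⟩

theorem rimColor_eq (x : Fin 3 → ℕ) {p q r : Fin 3} (hpq : p ≠ q) (hpr : p ≠ r) (hqr : q ≠ r) :
    rimColor x s(p, q) = x r := by
  have hr : -(p + q) = r := by revert p q r; decide
  exact congrArg x hr

/-- A choice of pairwise distinct colours for the edges of a triangle, where `X r` is the list of
the edge opposite to the vertex `r`. -/
structure IsRimChoice (X : Fin 3 → Finset ℕ) (x : Fin 3 → ℕ) : Prop where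
  injective : Function.Injective x
  mem : ∀ r, x r ∈ X r

theorem exists_isRimChoice_eq (hX : ∀ r, (X r).card = 3) (r : Fin 3) {y : ℕ} (hy : y ∈ X r) :
    ∃ x, IsRimChoice X x ∧ x r = y := by
  obtain ⟨z, hz, hzy⟩ := exists_mem_notMem_of_length_lt (S := X (r + 1)) (l := [y]) (by simp [hX])
  obtain ⟨t, ht, hty⟩ :=
    exists_mem_notMem_of_length_lt (S := X (r + 2)) (l := [y, z]) (by simp [hX])
  simp only [List.mem_cons, List.not_mem_nil, or_false, not_or] at hzy hty
  have eq_or (s : Fin 3) : s = r ∨ s = r + 1 ∨ s = r + 2 := by omega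
  have h₁ : r + 1 ≠ r := by omega
  have h₂ : r + 2 ≠ r := by omega
  have h₃ : r + 2 ≠ r + 1 := by omega
  refine ⟨fun s => if s = r then y else if s = r + 1 then z else t, ⟨?_, fun s => ?_⟩, if_pos rfl⟩
  · intro s s' h
    rcases eq_or s with rfl | rfl | rfl <;> rcases eq_or s' with h' | h' | h' <;> subst h' <;>
      simp_all [eq_comm]
  · rcases eq_or s with rfl | rfl | rfl
    · simpa using hy
    · simpa [h₁] using hz
    · simpa [h₂, h₃] using ht

theorem exists_isRimChoice (hX : ∀ r, (X r).card = 3) : ∃ x, IsRimChoice X x := by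
  obtain ⟨y, hy⟩ := Finset.card_pos.1 (by rw [hX 0]; decide : 0 < (X 0).card)
  exact (exists_isRimChoice_eq hX 0 hy).imp fun _ h => h.1

theorem exists_isRimChoice_notMem (hX : ∀ r, (X r).card = 3) {S : Finset ℕ} (hS : S.card = 3)
    {r : Fin 3} (hr : X r ≠ S) : ∃ x, IsRimChoice X x ∧ x r ∉ S := by
  obtain ⟨y, hy, hyS⟩ := Finset.not_subset.1 fun h =>
    hr (Finset.eq_of_subset_of_card_le h (by rw [hX, hS]))
  obtain ⟨x, hx, rfl⟩ := exists_isRimChoice_eq hX r hy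
  exact ⟨x, hx, hyS⟩

/-- The edges of the octahedron, whose pairs of opposite vertices are `r` and `r + 3`. -/
def octahedronEdges : List (Fin 6 × Fin 6) :=
  [(0, 1), (0, 2), (1, 2), (1, 3), (2, 3), (0, 4), (2, 4), (3, 4), (0, 5), (1, 5), (3, 5), (4, 5)]

theorem isForced_octahedronEdges : IsForced (n := 4) octahedronEdges ![0, 1, 2, 0, 1, 2] :=
  ⟨by decide, by decide, by decide +kernel⟩

/-- Here `B r` and `X r` are the lists of two opposite vertices of an octahedron. -/
theorem exists_octahedron_choice {B X : Fin 3 → Finset ℕ} (hB : ∀ r, (B r).card = 3)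
    (hX : ∀ r, (X r).card = 3) :
    ∃ b x : Fin 3 → ℕ, (∀ r, b r ∈ B r) ∧ IsRimChoice X x ∧
      ∀ r s, r ≠ s → b r ≠ b s ∧ b r ≠ x s := by
  obtain ⟨y, hy, hne⟩ := isForced_octahedronEdges.exists_choice rfl (by decide +kernel)
    (S := (Fin.append B X : Fin (3 + 3) → Finset ℕ)) fun i => by
      refine Fin.addCases (m := 3) (n := 3) (fun r => ?_) (fun r => ?_) i
      · rw [Fin.append_left, hB]
      · rw [Fin.append_right, hX]
  have edges : ∀ r s : Fin 3, r ≠ s →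
      IsConstrained octahedronEdges (Fin.castAdd 3 r) (Fin.castAdd 3 s) ∧
      IsConstrained octahedronEdges (Fin.castAdd 3 r) (Fin.natAdd 3 s) ∧
      IsConstrained octahedronEdges (Fin.natAdd 3 r) (Fin.natAdd 3 s) := by decide +kernel
  refine ⟨fun r => y (Fin.castAdd 3 r), fun r => y (Fin.natAdd 3 r), fun r => ?_,
    ⟨fun r s hrs => ?_, fun r => ?_⟩, fun r s hrs => ?_⟩
  · simpa only [Fin.append_left] using hy (Fin.castAdd 3 r)
  · by_contra h
    exact (edges r s h).2.2.ne hne hrs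
  · simpa only [Fin.append_right] using hy (Fin.natAdd 3 r)
  · exact ⟨(edges r s hrs).1.ne hne, (edges r s hrs).2.1.ne hne⟩

theorem isRimColorable_of_injOn {b : Fin 3 → ℕ} (hb : ∀ r s, r ≠ s → b r ≠ b s ∧ b r ≠ x s)
    {K : Finset ι} (hK : Set.InjOn π K) (hbB : ∀ i ∈ K, b (π i) ∈ B i) :
    IsRimColorable π B (rimColor x) K := by
  refine ⟨fun i => b (π i), hbB, fun i hi j hj hij => ?_⟩
  have hp : π i ≠ π j := fun h => hij (hK hi hj h)
  obtain ⟨r, hir, hjr⟩ : ∃ r, π i ≠ r ∧ π j ≠ r :=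
    (by decide : ∀ p q : Fin 3, ∃ r, p ≠ r ∧ q ≠ r) _ _
  refine ⟨(hb _ _ hp).1, fun _ => ?_⟩
  rw [rimColor_eq x hp hir hjr]
  exact ⟨(hb _ _ hir).2, (hb _ _ hjr).2⟩

/-- `ι` is covered by three rim-colourable classes. They are used as the colour classes of the top
edges among vertices with the same top list. -/
def HasRimCover (π : ι → Fin 3) (B : ι → Finset ℕ) (e : Sym2 (Fin 3) → ℕ) : Prop :=
  ∃ K : Fin 3 → Finset ι, (∀ c, IsRimColorable π B e (K c)) ∧ ∀ i, ∃ c, i ∈ K c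

theorem HasRimCover.of_three_classes {e : Sym2 (Fin 3) → ℕ} {K₀ K₁ K₂ : Finset ι}
    (h₀ : IsRimColorable π B e K₀) (h₁ : IsRimColorable π B e K₁) (h₂ : IsRimColorable π B e K₂)
    (hK : ∀ i, i ∈ K₀ ∨ i ∈ K₁ ∨ i ∈ K₂) : HasRimCover π B e := by
  refine ⟨![K₀, K₁, K₂], fun c => ?_, fun i => ?_⟩
  · fin_cases c
    exacts [h₀, h₁, h₂]
  · rcases hK i with h | h | h
    exacts [⟨0, h⟩, ⟨1, h⟩, ⟨2, h⟩]

theorem exists_hasRimCover_of_card_fiber_le_three [Fintype ι] (hB : ∀ i, (B i).card = 3)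
    (hX : ∀ r, (X r).card = 3) (h : ∀ p, (Finset.univ.filter fun i => π i = p).card ≤ 3) :
    ∃ x, IsRimChoice X x ∧ HasRimCover π B (rimColor x) := by
  obtain ⟨x, hx⟩ := exists_isRimChoice hX
  refine ⟨x, hx, fun p => Finset.univ.filter fun i => π i = p, fun p => ?_,
    fun i => ⟨π i, by simp⟩⟩
  refine isRimColorable_of_same_part hB (h p) fun i hi j hj => ?_
  rw [(Finset.mem_filter.1 hi).2, (Finset.mem_filter.1 hj).2]

theorem exists_hasRimCover_of_transversal (hB : ∀ i, (B i).card = 3)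
    (hX : ∀ r, (X r).card = 3) {t : Fin 3 → ι} (ht : Function.RightInverse t π) {K K' : Finset ι}
    (hK : K.card ≤ 3) (hK' : K'.card ≤ 3) (hπK : ∀ i ∈ K, ∀ j ∈ K, π i = π j)
    (hπK' : ∀ i ∈ K', ∀ j ∈ K', π i = π j) (hcover : ∀ i, i ∈ K ∨ i ∈ K' ∨ i = t (π i)) :
    ∃ x, IsRimChoice X x ∧ HasRimCover π B (rimColor x) := by
  classical
  obtain ⟨b, x, hb, hx, hbx⟩ := exists_octahedron_choice (fun r => hB (t r)) hX
  have hinj : Set.InjOn π (Finset.univ.image t) := by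
    simp only [Finset.coe_image, Finset.coe_univ, Set.image_univ]
    refine Function.Injective.injOn_range ?_
    rw [ht.comp_eq_id]
    exact Function.injective_id
  refine ⟨x, hx, .of_three_classes (isRimColorable_of_same_part hB hK hπK)
    (isRimColorable_of_same_part hB hK' hπK') (isRimColorable_of_injOn hbx hinj ?_)
    fun i => (hcover i).imp_right (Or.imp_right fun h => ?_)⟩
  · intro i hi
    obtain ⟨r, -, rfl⟩ := Finset.mem_image.1 hi
    rw [ht r]
    exact hb r
  · rw [h]
    exact Finset.mem_image_of_mem t (Finset.mem_univ _)

theorem exists_hasRimCover_of_seven_one_one [Fintype ι] (hπ : Function.Surjective π)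
    (hB : ∀ i, (B i).card = 3) (hX : ∀ r, (X r).card = 3)
    (h₀ : (Finset.univ.filter fun i => π i = 0).card ≤ 7)
    (h₁ : ∀ r, r ≠ 0 → (Finset.univ.filter fun i => π i = r).card ≤ 1) :
    ∃ x, IsRimChoice X x ∧ HasRimCover π B (rimColor x) := by
  classical
  obtain ⟨t, ht⟩ := hπ.hasRightInverse
  set U := (Finset.univ.filter fun i => π i = 0).erase (t 0) with hU
  have hUcard : U.card ≤ 6 := by
    rw [hU, Finset.card_erase_of_mem (by simp [ht 0])]
    omega
  have hπU : ∀ i ∈ U, π i = 0 := fun i hi => (Finset.mem_filter.1 (Finset.mem_of_mem_erase hi)).2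
  obtain ⟨K, hKU, hKcard⟩ := Finset.exists_subset_card_eq (min_le_right 3 U.card)
  refine exists_hasRimCover_of_transversal hB hX ht (K := K) (K' := U \ K) (by omega)
    (by rw [Finset.card_sdiff_of_subset hKU]; omega)
    (fun i hi j hj => (hπU i (hKU hi)).trans (hπU j (hKU hj)).symm)
    (fun i hi j hj => (hπU i (Finset.sdiff_subset hi)).trans (hπU j (Finset.sdiff_subset hj)).symm)
    fun i => ?_
  by_cases hi : π i = 0
  · by_cases hit : i = t (π i)
    · exact .inr (.inr hit)
    · have hiU : i ∈ U := Finset.mem_erase.2 ⟨hi ▸ hit, by simpa using hi⟩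
      by_cases hiK : i ∈ K
      · exact .inl hiK
      · exact .inr (.inl (Finset.mem_sdiff.2 ⟨hiU, hiK⟩))
  · exact .inr (.inr (Finset.card_le_one.1 (h₁ _ hi) _ (by simp) _ (by simp [ht (π i)])))

theorem exists_hasRimCover_of_four_four_one [Fintype ι] (hπ : Function.Surjective π)
    (hB : ∀ i, (B i).card = 3) (hX : ∀ r, (X r).card = 3)
    (h₀ : (Finset.univ.filter fun i => π i = 0).card ≤ 4)
    (h₁ : (Finset.univ.filter fun i => π i = 1).card ≤ 4)
    (h₂ : (Finset.univ.filter fun i => π i = 2).card ≤ 1) :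
    ∃ x, IsRimChoice X x ∧ HasRimCover π B (rimColor x) := by
  classical
  obtain ⟨t, ht⟩ := hπ.hasRightInverse
  let U (r : Fin 3) := (Finset.univ.filter fun i => π i = r).erase (t r)
  have mem_U (i : ι) (r : Fin 3) : i ∈ U r ↔ i ≠ t r ∧ π i = r := by simp [U]
  have hU : ∀ r, (Finset.univ.filter fun i => π i = r).card ≤ 4 → (U r).card ≤ 3 := fun r h => by
    rw [Finset.card_erase_of_mem (by simp [ht r])]
    omega
  have hπU (r : Fin 3) : ∀ i ∈ U r, ∀ j ∈ U r, π i = π j := fun i hi j hj =>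
    ((mem_U i r).1 hi).2.trans ((mem_U j r).1 hj).2.symm
  refine exists_hasRimCover_of_transversal hB hX ht (hU 0 h₀) (hU 1 h₁) (hπU 0) (hπU 1)
    fun i => ?_
  by_cases hit : i = t (π i)
  · exact .inr (.inr hit)
  obtain h | h | h : π i = 0 ∨ π i = 1 ∨ π i = 2 := by omega
  · exact .inl ((mem_U i 0).2 ⟨h ▸ hit, h⟩)
  · exact .inr (.inl ((mem_U i 1).2 ⟨h ▸ hit, h⟩))
  · exact absurd (Finset.card_le_one.1 h₂ _ (by simpa using h) _ (by simp [ht 2])) (h ▸ hit)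

section FiveTwoTwo

variable [Fintype ι] {v v' w w' a b : ι}

/-- The parts of `π` have sizes `(5, 2, 2)`, or the first one is smaller but has at least three
elements; the other parts are `{v, v'}` and `{w, w'}`. -/
structure IsFiveTwoTwo (π : ι → Fin 3) (v v' w w' : ι) : Prop where
  eq_left : π v = π v'
  eq_right : π w = π w'
  left_ne : π v ≠ 0
  right_ne : π w ≠ 0
  ne : π v ≠ π w
  cover : ∀ i, π i = 0 ∨ i = v ∨ i = v' ∨ i = w ∨ i = w'
  three_le : 3 ≤ (Finset.univ.filter fun i => π i = 0).card
  le_five : (Finset.univ.filter fun i => π i = 0).card ≤ 5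

namespace IsFiveTwoTwo

theorem swap_right (h : IsFiveTwoTwo π v v' w w') : IsFiveTwoTwo π v v' w' w where
  __ := h
  eq_right := h.eq_right.symm
  right_ne := h.eq_right ▸ h.right_ne
  ne := h.eq_right ▸ h.ne
  cover i := by have := h.cover i; tauto

theorem symm (h : IsFiveTwoTwo π v v' w w') : IsFiveTwoTwo π w w' v v' where
  __ := h
  eq_left := h.eq_right
  eq_right := h.eq_left
  left_ne := h.right_ne
  right_ne := h.left_ne
  ne := h.ne.symm
  cover i := by have := h.cover i; tauto

theorem exists_ne_ne (h : IsFiveTwoTwo π v v' w w') (a b : ι) : ∃ c, π c = 0 ∧ a ≠ c ∧ b ≠ c := by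
  classical
  have hcard : ({a, b} : Finset ι).card < (Finset.univ.filter fun i => π i = 0).card :=
    Finset.card_le_two.trans_lt h.three_le
  obtain ⟨c, hc, hab⟩ := Finset.exists_mem_notMem_of_card_lt_card hcard
  simp only [Finset.mem_insert, Finset.mem_singleton, not_or] at hab
  exact ⟨c, (Finset.mem_filter.1 hc).2, Ne.symm hab.1, Ne.symm hab.2⟩

theorem exists_ne (h : IsFiveTwoTwo π v v' w w') (a : ι) : ∃ b, π b = 0 ∧ a ≠ b :=
  (h.exists_ne_ne a a).imp fun _ hb => ⟨hb.1, hb.2.1⟩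

theorem hasRimCover_of_two_classes (h : IsFiveTwoTwo π v v' w w') (hB : ∀ i, (B i).card = 3)
    (ha : π a = 0) (hb : π b = 0) (hab : a ≠ b) {e : Sym2 (Fin 3) → ℕ} {K K' : Finset ι}
    (hK : IsRimColorable π B e K) (hK' : IsRimColorable π B e K')
    (hcover : ∀ i ∈ [a, b, v, v', w, w'], i ∈ K ∨ i ∈ K') : HasRimCover π B e := by
  classical
  refine .of_three_classes (K₀ := ((Finset.univ.filter fun i => π i = 0).erase a).erase b)
    (isRimColorable_of_same_part hB ?_ fun i hi j hj => ?_) hK hK' fun i => ?_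
  · rw [Finset.card_erase_of_mem (by simp [hb, hab.symm]),
      Finset.card_erase_of_mem (by simp [ha])]
    have := h.le_five
    omega
  · simp only [Finset.mem_erase, Finset.mem_filter, Finset.mem_univ, true_and] at hi hj
    exact hi.2.2.trans hj.2.2.symm
  · by_cases hmem : i ∈ [a, b, v, v', w, w']
    · exact .inr (hcover i hmem)
    · simp only [List.mem_cons, List.not_mem_nil, or_false, not_or] at hmem
      have hi : π i = 0 := (h.cover i).resolve_right (by tauto)
      simp [hi, hmem.1, hmem.2.1]

/-- The classes are `{v, v', a}`, `{w, w', b}` and the rest of the first part. -/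
theorem hasRimCover_of_separate (h : IsFiveTwoTwo π v v' w w') (hB : ∀ i, (B i).card = 3)
    (ha : π a = 0) (hb : π b = 0) (hab : a ≠ b)
    (hva : ¬ (B v = B v' ∧ B v' = B a ∧ x (π w) ∈ B a))
    (hwb : ¬ (B w = B w' ∧ B w' = B b ∧ x (π v) ∈ B b)) : HasRimCover π B (rimColor x) := by
  classical
  refine h.hasRimCover_of_two_classes hB ha hb hab (K := {v, v', a}) (K' := {w, w', b})
    (isRimColorable_two_one hB h.eq_left ?_) (isRimColorable_two_one hB h.eq_right ?_) (by simp)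
  · rwa [ha, rimColor_eq x h.left_ne h.ne h.right_ne.symm]
  · rwa [hb, rimColor_eq x h.right_ne h.ne.symm h.left_ne.symm]

/-- The classes are `{a, b, w}`, `{v, v', w'}` and the rest of the first part. -/
theorem hasRimCover_of_mixed (h : IsFiveTwoTwo π v v' w w') (hB : ∀ i, (B i).card = 3)
    (ha : π a = 0) (hb : π b = 0) (hab : a ≠ b)
    (haw : ¬ (B a = B b ∧ B b = B w ∧ x (π v) ∈ B w))
    (hvw : ¬ (B v = B v' ∧ B v' = B w' ∧ x 0 ∈ B w')) : HasRimCover π B (rimColor x) := by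
  classical
  refine h.hasRimCover_of_two_classes hB ha hb hab (K := {a, b, w}) (K' := {v, v', w'})
    (isRimColorable_two_one hB (ha.trans hb.symm) ?_) (isRimColorable_two_one hB h.eq_left ?_)
    (by simp)
  · rwa [ha, rimColor_eq x h.right_ne.symm h.left_ne.symm h.ne.symm]
  · rwa [← h.eq_right, rimColor_eq x h.ne h.left_ne h.right_ne]

theorem isRimColorable_transversal [DecidableEq ι] (h : IsFiveTwoTwo π v v' w w') (ha : π a = 0)
    {b : Fin 3 → ℕ} (hb : ∀ r s, r ≠ s → b r ≠ b s ∧ b r ≠ x s) (hba : b 0 ∈ B a)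
    (hbv : b (π v) ∈ B v) (hbw : b (π w) ∈ B w) :
    IsRimColorable π B (rimColor x) {a, v, w} := by
  refine isRimColorable_of_injOn hb (fun i hi j hj hij => ?_) ?_
  · have h₁ := h.left_ne
    have h₂ := h.right_ne
    have h₃ := h.ne
    simp only [Finset.coe_insert, Finset.coe_singleton, Set.mem_insert_iff,
      Set.mem_singleton_iff] at hi hj
    grind
  · simp [ha, hba, hbv, hbw]

/-- The classes are `{a, v, w}`, `{b, v', w'}` and the rest of the first part. -/
theorem hasRimCover_of_transversals (h : IsFiveTwoTwo π v v' w w') (hB : ∀ i, (B i).card = 3)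
    (ha : π a = 0) (hb : π b = 0) (hab : a ≠ b) {c c' : Fin 3 → ℕ}
    (hc : ∀ r s, r ≠ s → c r ≠ c s ∧ c r ≠ x s) (hca : c 0 ∈ B a) (hcv : c (π v) ∈ B v)
    (hcw : c (π w) ∈ B w) (hc' : ∀ r s, r ≠ s → c' r ≠ c' s ∧ c' r ≠ x s) (hcb : c' 0 ∈ B b)
    (hcv' : c' (π v) ∈ B v') (hcw' : c' (π w) ∈ B w') : HasRimCover π B (rimColor x) := by
  classical
  have h' : IsFiveTwoTwo π v' v w' w := h.swap_right.symm.swap_right.symm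
  rw [h.eq_left] at hcv'
  rw [h.eq_right] at hcw'
  exact h.hasRimCover_of_two_classes hB ha hb hab (h.isRimColorable_transversal ha hc hca hcv hcw)
    (h'.isRimColorable_transversal hb hc' hcb hcv' hcw') (by simp)

theorem exists_hasRimCover_of_one_different (h : IsFiveTwoTwo π v v' w w')
    (hB : ∀ i, (B i).card = 3) (hX : ∀ r, (X r).card = 3) (ha : π a = 0) (hb : π b = 0)
    (hab : a ≠ b) (hBa : B a = B v) (hBb : B b = B v) (hBv' : B v' = B v) (hBw : B w = B v)
    (hBw' : B w' ≠ B v) (hXw : X (π w) = B v) :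
    ∃ x, IsRimChoice X x ∧ HasRimCover π B (rimColor x) := by
  by_cases hX0 : X 0 = B v
  swap
  · obtain ⟨x, hx, hxv⟩ := exists_isRimChoice_notMem hX (hB v) hX0
    exact ⟨x, hx, h.swap_right.hasRimCover_of_mixed hB ha hb hab
      (fun H => hBw' (H.2.1.symm.trans hBb)) fun H => hxv (hBw ▸ H.2.2)⟩
  by_cases hXv : X (π v) = B v
  swap
  · obtain ⟨x, hx, hxv⟩ := exists_isRimChoice_notMem hX (hB v) hXv
    exact ⟨x, hx, h.hasRimCover_of_mixed hB ha hb hab (fun H => hxv (hBw ▸ H.2.2))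
      fun H => hBw' (H.2.1.symm.trans hBv')⟩
  have h₁ := h.left_ne
  have h₂ := h.right_ne
  have h₃ := h.ne
  have hXr (r : Fin 3) : X r = B v := by
    obtain rfl | rfl | rfl : r = 0 ∨ r = π v ∨ r = π w := by omega
    all_goals assumption
  obtain ⟨x, hx⟩ := exists_isRimChoice hX
  have hxv (r : Fin 3) : x r ∈ B v := hXr r ▸ hx.mem r
  have x_ne : ∀ r s, r ≠ s → x r ≠ x s ∧ x r ≠ x s := fun r s hrs =>
    ⟨hx.injective.ne hrs, hx.injective.ne hrs⟩
  obtain ⟨z, hz, hzx⟩ := exists_mem_notMem_of_length_lt (S := B w') (l := [x 0, x (π v)])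
    (by simp [hB])
  simp only [List.mem_cons, List.not_mem_nil, or_false, not_or] at hzx
  have update_ne : ∀ r s, r ≠ s → Function.update x (π w) z r ≠ Function.update x (π w) z s ∧
      Function.update x (π w) z r ≠ x s := by
    have hzr (r : Fin 3) (hr : r ≠ π w) : z ≠ x r := by
      obtain rfl | rfl : r = 0 ∨ r = π v := by omega
      exacts [hzx.1, hzx.2]
    intro r s hrs
    simp only [Function.update_apply]
    have := hx.injective.ne hrs
    grind
  refine ⟨x, hx, h.hasRimCover_of_transversals hB ha hb hab x_ne ?_ ?_ ?_ update_ne ?_ ?_ ?_⟩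
  · exact hBa ▸ hxv 0
  · exact hxv _
  · exact hBw ▸ hxv _
  · exact Function.update_of_ne h₂.symm z x ▸ hBb ▸ hxv 0
  · exact Function.update_of_ne h₃ z x ▸ hBv' ▸ hxv _
  · exact (Function.update_self (π w) z x).symm ▸ hz

theorem exists_hasRimCover_of_eq_of_ne (h : IsFiveTwoTwo π v v' w w')
    (hB : ∀ i, (B i).card = 3) (hX : ∀ r, (X r).card = 3) (hv : B v = B v') (hw : B w ≠ B w') :
    ∃ x, IsRimChoice X x ∧ HasRimCover π B (rimColor x) := by
  by_cases hU : ∃ a, π a = 0 ∧ B a ≠ B v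
  · obtain ⟨a, ha, hav⟩ := hU
    obtain ⟨b, hb, hab⟩ := h.exists_ne a
    obtain ⟨x, hx⟩ := exists_isRimChoice hX
    exact ⟨x, hx, h.hasRimCover_of_separate hB ha hb hab
      (fun H => hav (hv.trans H.2.1).symm) fun H => hw H.1⟩
  push Not at hU
  obtain ⟨a, ha, -⟩ := h.exists_ne v
  obtain ⟨b, hb, hab⟩ := h.exists_ne a
  by_cases hXw : X (π w) = B v
  swap
  · obtain ⟨x, hx, hxv⟩ := exists_isRimChoice_notMem hX (hB v) hXw
    exact ⟨x, hx, h.hasRimCover_of_separate hB ha hb hab (fun H => hxv (hU a ha ▸ H.2.2))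
      fun H => hw H.1⟩
  by_cases hwv : B w = B v
  · exact h.exists_hasRimCover_of_one_different hB hX ha hb hab (hU a ha) (hU b hb) hv.symm hwv
      (fun H => hw (hwv.trans H.symm)) hXw
  by_cases hwv' : B w' = B v
  · exact h.swap_right.exists_hasRimCover_of_one_different hB hX ha hb hab (hU a ha) (hU b hb)
      hv.symm hwv' hwv (h.eq_right ▸ hXw)
  obtain ⟨x, hx⟩ := exists_isRimChoice hX
  exact ⟨x, hx, h.hasRimCover_of_mixed hB ha hb hab (fun H => hwv (H.2.1.symm.trans (hU b hb)))
    fun H => hwv' (H.2.1.symm.trans hv.symm)⟩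

theorem exists_hasRimCover_of_three_eq (h : IsFiveTwoTwo π v v' w w') (hB : ∀ i, (B i).card = 3)
    (hX : ∀ r, (X r).card = 3) (hv : B v = B v') (hw : B w = B w') (ha : π a = 0) (hb : π b = 0)
    (hab : a ≠ b) (hBab : B a = B b) : ∃ x, IsRimChoice X x ∧ HasRimCover π B (rimColor x) := by
  obtain ⟨c, x, hc, hx, hcx⟩ := exists_octahedron_choice
    (B := fun r => if r = 0 then B a else if r = π v then B v else B w) (X := X)
    (fun r => by split_ifs <;> exact hB _) hX
  have hca : c 0 ∈ B a := by simpa using hc 0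
  have hcv : c (π v) ∈ B v := by simpa [h.left_ne] using hc (π v)
  have hcw : c (π w) ∈ B w := by simpa [h.right_ne, h.ne.symm] using hc (π w)
  exact ⟨x, hx, h.hasRimCover_of_transversals hB ha hb hab hcx hca hcv hcw hcx (hBab ▸ hca)
    (hv ▸ hcv) (hw ▸ hcw)⟩

theorem exists_hasRimCover_of_injOn (h : IsFiveTwoTwo π v v' w w') (hB : ∀ i, (B i).card = 3)
    (hX : ∀ r, (X r).card = 3) (hv : B v = B v') (hw : B w = B w')
    (hinj : ∀ a b, π a = 0 → π b = 0 → a ≠ b → B a ≠ B b) :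
    ∃ x, IsRimChoice X x ∧ HasRimCover π B (rimColor x) := by
  have exists_list_ne (S : Finset ℕ) (c : ι) : ∃ a, π a = 0 ∧ c ≠ a ∧ B a ≠ S := by
    obtain ⟨a, ha, hca⟩ := h.exists_ne c
    obtain ⟨b, hb, hcb, hab⟩ := h.exists_ne_ne c a
    by_cases haS : B a = S
    · exact ⟨b, hb, hcb, fun hbS => hinj a b ha hb hab (haS.trans hbS.symm)⟩
    · exact ⟨a, ha, hca, haS⟩
  obtain ⟨a, ha, -, hav⟩ := exists_list_ne (B v) v
  obtain ⟨b, hb, hab, hbw⟩ := exists_list_ne (B w) a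
  obtain ⟨x, hx⟩ := exists_isRimChoice hX
  exact ⟨x, hx, h.hasRimCover_of_separate hB ha hb hab
    (fun H => hav (hv.trans H.2.1).symm) fun H => hbw (hw.trans H.2.1).symm⟩

theorem exists_hasRimCover (h : IsFiveTwoTwo π v v' w w') (hB : ∀ i, (B i).card = 3)
    (hX : ∀ r, (X r).card = 3) : ∃ x, IsRimChoice X x ∧ HasRimCover π B (rimColor x) := by
  by_cases hv : B v = B v' <;> by_cases hw : B w = B w'
  · by_cases hinj : ∀ a b, π a = 0 → π b = 0 → a ≠ b → B a ≠ B b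
    · exact h.exists_hasRimCover_of_injOn hB hX hv hw hinj
    · push Not at hinj
      obtain ⟨a, b, ha, hb, hab, hBab⟩ := hinj
      exact h.exists_hasRimCover_of_three_eq hB hX hv hw ha hb hab hBab
  · exact h.exists_hasRimCover_of_eq_of_ne hB hX hv hw
  · exact h.symm.exists_hasRimCover_of_eq_of_ne hB hX hw hv
  · obtain ⟨a, ha, -⟩ := h.exists_ne v
    obtain ⟨b, hb, hab⟩ := h.exists_ne a
    obtain ⟨x, hx⟩ := exists_isRimChoice hX
    exact ⟨x, hx, h.hasRimCover_of_separate hB ha hb hab (fun H => hv H.1) fun H => hw H.1⟩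

end IsFiveTwoTwo

end FiveTwoTwo

end ThreeParts

section Fibers

variable {ι P : Type*} [Fintype ι] [DecidableEq P] {π : ι → P} {A : ι → Finset ℕ}

theorem card_filter_and_fiber_le (π : ι → P) (q : ι → Prop) [DecidablePred q] (p : P) :
    (Finset.univ.filter fun i => q i ∧ π i = p).card ≤
      (Finset.univ.filter fun i => π i = p).card :=
  Finset.card_le_card (Finset.monotone_filter_right _ fun _ _ h => h.2)

theorem card_filter_eq_sum_card_fiber [Fintype P] (π : ι → P) (q : ι → Prop) [DecidablePred q] :
    (Finset.univ.filter q).card = ∑ p, (Finset.univ.filter fun i => q i ∧ π i = p).card := by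
  rw [Finset.card_eq_sum_card_fiberwise (f := π) (t := Finset.univ) fun i _ => by simp]
  simp only [Finset.filter_filter]

theorem card_eq_sum_card_fiber [Fintype P] (π : ι → P) :
    Fintype.card ι = ∑ p, (Finset.univ.filter fun i => π i = p).card :=
  Finset.card_eq_sum_card_fiberwise fun i _ => by simp

theorem card_filter_and_eq_add_card_filter_eq_le {α : Type*} [DecidableEq α] {f : ι → α}
    (q : ι → Prop) [DecidablePred q] {y z : α} (h : y ≠ z) :
    (Finset.univ.filter fun i => q i ∧ f i = y).card +
      (Finset.univ.filter fun i => f i = z).card ≤ Fintype.card ι := by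
  classical
  rw [← Finset.card_union_of_disjoint]
  · exact Finset.card_le_univ _
  · exact Finset.disjoint_filter.2 fun i _ hy hz => h (hy.2.symm.trans hz)

theorem exists_triple_of_card_filter_le_add_four [DecidableEq ι] {T : Finset ℕ} {p : P}
    (hn : Fintype.card ι = 9) (hT5 : 5 ≤ (Finset.univ.filter fun i => A i = T).card)
    (hT7 : (Finset.univ.filter fun i => A i = T).card ≤ 7)
    (hp : 3 ≤ (Finset.univ.filter fun i => π i = p).card)
    (hTp : (Finset.univ.filter fun i => A i = T).card ≤
      (Finset.univ.filter fun i => A i = T ∧ π i = p).card + 4) :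
    ∃ K : Finset ι, K.card = 3 ∧ (∀ i ∈ K, π i = p) ∧
      ∀ S : Finset ℕ, (Finset.univ.filter fun i => i ∉ K ∧ A i = S).card ≤ 4 := by
  obtain ⟨K₀, hK₀, hK₀card⟩ := Finset.exists_subset_card_eq (Nat.sub_le_iff_le_add.2 hTp)
  obtain ⟨K, hK₀K, hKp, hK⟩ := Finset.exists_subsuperset_card_eq (s := K₀)
    (fun i hi => by simpa using (Finset.mem_filter.1 (hK₀ hi)).2.2) (by omega) hp
  refine ⟨K, hK, fun i hi => (Finset.mem_filter.1 (hKp hi)).2, fun S => ?_⟩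
  by_cases hS : S = T
  · subst hS
    have hsub : (Finset.univ.filter fun i => i ∉ K ∧ A i = S) ⊆
        (Finset.univ.filter fun i => A i = S) \ K₀ := fun i hi => by
      simp only [Finset.mem_filter, Finset.mem_univ, true_and, Finset.mem_sdiff] at hi ⊢
      exact ⟨hi.2, fun h => hi.1 (hK₀K h)⟩
    have hle := Finset.card_le_card hsub
    rw [Finset.card_sdiff_of_subset fun i hi => by
      simpa using (Finset.mem_filter.1 (hK₀ hi)).2.1] at hle
    omega
  · have := card_filter_and_eq_add_card_filter_eq_le (f := A) (fun i => i ∉ K) hS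
    omega

theorem exists_triple_in_fiber [DecidableEq ι] (hn : Fintype.card ι = 9)
    (h6 : ∀ T : Finset ℕ, (Finset.univ.filter fun i => A i = T).card ≤ 6)
    (hP : ∃ p, 3 ≤ (Finset.univ.filter fun i => π i = p).card)
    (hT : ∀ T : Finset ℕ, 5 ≤ (Finset.univ.filter fun i => A i = T).card →
      ∃ p, 3 ≤ (Finset.univ.filter fun i => π i = p).card ∧
        (Finset.univ.filter fun i => A i = T).card ≤
          (Finset.univ.filter fun i => A i = T ∧ π i = p).card + 4) :
    ∃ (K : Finset ι) (p : P), K.card = 3 ∧ (∀ i ∈ K, π i = p) ∧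
      ∀ S : Finset ℕ, (Finset.univ.filter fun i => i ∉ K ∧ A i = S).card ≤ 4 := by
  by_cases! h5 : ∃ T : Finset ℕ, 5 ≤ (Finset.univ.filter fun i => A i = T).card
  · obtain ⟨T, h5⟩ := h5
    obtain ⟨p, hp, hTp⟩ := hT T h5
    obtain ⟨K, hK⟩ := exists_triple_of_card_filter_le_add_four hn h5 ((h6 T).trans (by decide)) hp
      hTp
    exact ⟨K, p, hK⟩
  · obtain ⟨p, hp⟩ := hP
    obtain ⟨K, hKp, hK⟩ := Finset.exists_subset_card_eq hp
    refine ⟨K, p, hK, fun i hi => (Finset.mem_filter.1 (hKp hi)).2, fun S => ?_⟩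
    exact (Finset.card_le_card (Finset.monotone_filter_right _ fun _ _ h => h.2)).trans
      (Nat.le_of_lt_succ (h5 S))

theorem exists_pair_of_card_le_two {ι : Type*} {s : Finset ι} (hs : s.Nonempty)
    (h : s.card ≤ 2) : ∃ v v', ∀ i, i ∈ s ↔ i = v ∨ i = v' := by
  classical
  obtain h | h : s.card = 1 ∨ s.card = 2 := by
    have := hs.card_pos
    omega
  · obtain ⟨v, rfl⟩ := Finset.card_eq_one.1 h
    exact ⟨v, v, by simp⟩
  · obtain ⟨v, v', -, rfl⟩ := Finset.card_eq_two.1 h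
    exact ⟨v, v', by simp⟩

end Fibers

section ThreePartsChoosable

variable {ι : Type*} {π : ι → Fin 3}

theorem isHubRainbow_rimColor (hπ : Function.Surjective π) {top bot : ι → ℕ} {x : Fin 3 → ℕ}
    (hx : Function.Injective x)
    (hmm : ∀ i j, i ≠ j → top i = top j → RimCompatible π (rimColor x) bot i j)
    (hhr : ∀ i, top i = bot i → ∃ j, j ≠ i ∧ top j = top i) :
    IsHubRainbow π top bot (rimColor x) := by
  refine isHubRainbow_of_rimCompatible hπ hmm (fun i p hp => ?_) hhr
  by_cases hb : bot i = rimColor x s(π i, p)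
  · obtain ⟨q, hqi, hqp⟩ : ∃ q, q ≠ π i ∧ q ≠ p :=
      (by decide : ∀ r p : Fin 3, ∃ q, q ≠ r ∧ q ≠ p) _ _
    refine .inr (.inl ⟨q, hqi, hqp, ?_⟩)
    rw [hb, rimColor_eq x hp hqi.symm hqp.symm, rimColor_eq x hqi.symm hp hqp,
      rimColor_eq x hqp hqi hp.symm]
    simp [hx.ne hqp, hx.ne hqi, hx.ne hp.symm]
  · exact .inl hb

variable [Fintype ι]

theorem exists_isFiveTwoTwo (hπ : Function.Surjective π)
    (h3 : 3 ≤ (Finset.univ.filter fun i => π i = 0).card)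
    (h5 : (Finset.univ.filter fun i => π i = 0).card ≤ 5)
    (h₁ : (Finset.univ.filter fun i => π i = 1).card ≤ 2)
    (h₂ : (Finset.univ.filter fun i => π i = 2).card ≤ 2) :
    ∃ v v' w w', IsFiveTwoTwo π v v' w w' := by
  have fiber_nonempty (p : Fin 3) : (Finset.univ.filter fun i => π i = p).Nonempty :=
    (hπ p).imp fun i hi => by simpa using hi
  obtain ⟨v, v', hv⟩ := exists_pair_of_card_le_two (fiber_nonempty 1) h₁
  obtain ⟨w, w', hw⟩ := exists_pair_of_card_le_two (fiber_nonempty 2) h₂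
  simp only [Finset.mem_filter, Finset.mem_univ, true_and] at hv hw
  have hv1 : π v = 1 := (hv v).2 (.inl rfl)
  have hv1' : π v' = 1 := (hv v').2 (.inr rfl)
  have hw2 : π w = 2 := (hw w).2 (.inl rfl)
  have hw2' : π w' = 2 := (hw w').2 (.inr rfl)
  refine ⟨v, v', w, w', by rw [hv1, hv1'], by rw [hw2, hw2'], by rw [hv1]; decide,
    by rw [hw2]; decide, by rw [hv1, hw2]; decide, fun i => ?_, h3, h5⟩
  have := hv i
  have := hw i
  obtain h | h | h : π i = 0 ∨ π i = 1 ∨ π i = 2 := by omega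
  all_goals tauto

/-- The sizes of three parts for which lists of three colours suffice: up to the order, the triples
dominated by `(7, 1, 1)`, `(4, 4, 1)`, `(3, 3, 3)` or `(5, 2, 2)`. -/
def IsSmallTriple (p q r : ℕ) : Prop :=
  (p ≤ 7 ∧ q ≤ 1 ∧ r ≤ 1) ∨ (p ≤ 4 ∧ q ≤ 4 ∧ r ≤ 1) ∨ (p ≤ 3 ∧ q ≤ 3 ∧ r ≤ 3) ∨
    (3 ≤ p ∧ p ≤ 5 ∧ q ≤ 2 ∧ r ≤ 2)

variable {p q r : ℕ}

theorem exists_hasRimCover (hπ : Function.Surjective π)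
    (hp : (Finset.univ.filter fun i => π i = 0).card = p)
    (hq : (Finset.univ.filter fun i => π i = 1).card = q)
    (hr : (Finset.univ.filter fun i => π i = 2).card = r) (h : IsSmallTriple p q r)
    {B : ι → Finset ℕ} {X : Fin 3 → Finset ℕ} (hB : ∀ i, (B i).card = 3)
    (hX : ∀ r, (X r).card = 3) : ∃ x, IsRimChoice X x ∧ HasRimCover π B (rimColor x) := by
  rcases h with h | h | h | h
  · refine exists_hasRimCover_of_seven_one_one hπ hB hX (by omega) fun s hs => ?_
    obtain rfl | rfl : s = 1 ∨ s = 2 := by omega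
    all_goals omega
  · exact exists_hasRimCover_of_four_four_one hπ hB hX (by omega) (by omega) (by omega)
  · refine exists_hasRimCover_of_card_fiber_le_three hB hX fun s => ?_
    obtain rfl | rfl | rfl : s = 0 ∨ s = 1 ∨ s = 2 := by omega
    all_goals omega
  · obtain ⟨v, v', w, w', hvw⟩ :=
      exists_isFiveTwoTwo hπ (by omega) (by omega) (by omega) (by omega)
    exact hvw.exists_hasRimCover hB hX

theorem exists_triple_in_fiber_of_isSmallTriple [DecidableEq ι] {A : ι → Finset ℕ}
    (hn : Fintype.card ι = 9)
    (hp : (Finset.univ.filter fun i => π i = 0).card = p)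
    (hq : (Finset.univ.filter fun i => π i = 1).card = q)
    (hr : (Finset.univ.filter fun i => π i = 2).card = r) (h : IsSmallTriple p q r)
    (h6 : ∀ T : Finset ℕ, (Finset.univ.filter fun i => A i = T).card ≤ 6) :
    ∃ (K : Finset ι) (s : Fin 3), K.card = 3 ∧ (∀ i ∈ K, π i = s) ∧
      ∀ S : Finset ℕ, (Finset.univ.filter fun i => i ∉ K ∧ A i = S).card ≤ 4 := by
  have hsum := card_eq_sum_card_fiber π
  rw [Fin.sum_univ_three, hp, hq, hr] at hsum
  unfold IsSmallTriple at h
  refine exists_triple_in_fiber hn h6 ⟨0, by omega⟩ fun T hT => ?_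
  have hTsum := card_filter_eq_sum_card_fiber π fun i => A i = T
  rw [Fin.sum_univ_three] at hTsum
  have hTle := card_filter_and_fiber_le π fun i => A i = T
  have := hTle 0
  have := hTle 1
  have := hTle 2
  have := h6 T
  by_contra! hno
  have := hno 0
  have := hno 1
  have := hno 2
  omega

theorem hubGraph_rainbowChoosable_of_isSmallTriple (hπ : Function.Surjective π)
    (hp : (Finset.univ.filter fun i => π i = 0).card = p)
    (hq : (Finset.univ.filter fun i => π i = 1).card = q)
    (hr : (Finset.univ.filter fun i => π i = 2).card = r) (h : IsSmallTriple p q r) :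
    RainbowChoosable (hubGraph π) 3 := by
  classical
  refine hubGraph_rainbowChoosable_of fun A B E hA hB hE => ?_
  have hX (s : Fin 3) : (E s(s + 1, s + 2)).card = 3 := hE _ (by
    rw [Sym2.mk_isDiag_iff]
    omega)
  obtain ⟨x, hx, K, hK, hcover⟩ := exists_hasRimCover hπ hp hq hr h hB hX
  choose g hg using hcover
  have hn : Fintype.card ι ≤ 9 := by
    have hsum := card_eq_sum_card_fiber π
    rw [Fin.sum_univ_three, hp, hq, hr] at hsum
    unfold IsSmallTriple at h
    omega
  obtain ⟨top, htop, hc⟩ := exists_top (π := π) (B := B) (e := rimColor x) hA hn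
    (fun _ => isRimColorable_of_card_le_two hB)
    (fun T _ => ⟨g, fun c => (hK c).mono fun i hi => (Finset.mem_filter.1 hi).2.2 ▸ hg i⟩)
    fun hn _ h6 => by
      obtain ⟨L, s, hL, hLs, hout⟩ :=
        exists_triple_in_fiber_of_isSmallTriple hn hp hq hr h h6
      exact ⟨L, hL, isRimColorable_of_same_part hB hL.le fun i hi j hj =>
        (hLs i hi).trans (hLs j hj).symm, hout⟩
  obtain ⟨bot, hbot, hmm, hhr⟩ := exists_bot_of_isRimColorable
    (fun i => Finset.exists_mem_ne (by rw [hB]; decide) _) hc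
  refine ⟨top, bot, rimColor x, htop, hbot, fun t ht => ?_,
    isHubRainbow_rimColor hπ hx.injective hmm hhr⟩
  induction t with | h s t =>
  rw [Sym2.mk_isDiag_iff] at ht
  obtain ⟨y, hsy, hty, hy⟩ : ∃ y, s ≠ y ∧ t ≠ y ∧ s(s, t) = s(y + 1, y + 2) := by
    revert s t
    decide
  rw [rimColor_eq x ht hsy hty, hy]
  exact hx.mem y

end ThreePartsChoosable

section RoundRobin

variable {α : Type*} [LinearOrder α]

theorem add_one_sub_le_card_filter_eq_of_monotone {n : ℕ} {f : Fin n → α} (hf : Monotone f)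
    {a b : Fin n} {y : α} (ha : f a = y) (hb : f b = y) :
    (b : ℕ) + 1 - a ≤ (Finset.univ.filter fun c => f c = y).card := by
  rw [← Fin.card_Icc]
  refine Finset.card_le_card fun c hc => ?_
  obtain ⟨hac, hcb⟩ := Finset.mem_Icc.1 hc
  exact Finset.mem_filter.2
    ⟨Finset.mem_univ _, le_antisymm ((hf hcb).trans_eq hb) (ha.symm.trans_le (hf hac))⟩

/-- Sort the elements by their values and deal them out in turn to three classes: three elements of
one class are then at distance at least six from the first to the last. -/
theorem exists_round_robin {ι : Type*} [Fintype ι] (hn : Fintype.card ι ≤ 9) (f : ι → α) :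
    ∃ g : ι → Fin 3, (∀ c, (Finset.univ.filter fun i => g i = c).card ≤ 3) ∧
      ∀ c y, 3 ≤ (Finset.univ.filter fun i => f i = y ∧ g i = c).card →
        7 ≤ (Finset.univ.filter fun i => f i = y).card := by
  obtain ⟨σ, hmono⟩ : ∃ σ : Fin (Fintype.card ι) ≃ ι, Monotone (f ∘ σ) :=
    ⟨(Tuple.sort (f ∘ (Fintype.equivFin ι).symm)).trans (Fintype.equivFin ι).symm,
      Tuple.monotone_sort (f ∘ (Fintype.equivFin ι).symm)⟩
  have pos_inj {i j : ι} (h : (σ.symm i : ℕ) = σ.symm j) : i = j := σ.symm.injective (Fin.ext h)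
  refine ⟨fun i => Fin.ofNat 3 (σ.symm i), fun c => ?_, fun c y h3 => ?_⟩
  · refine (Finset.card_le_card_of_injOn (t := Finset.range 3) (fun i => (σ.symm i : ℕ) / 3)
      (fun i _ => ?_) ?_).trans_eq (Finset.card_range 3)
    · have := (σ.symm i).2
      simp only [Finset.coe_range, Set.mem_Iio]
      omega
    · intro i hi j hj hij
      simp only [Finset.coe_filter, Finset.mem_univ, true_and, Set.mem_ofPred_eq, Fin.ext_iff,
        Fin.val_ofNat] at hi hj hij
      exact pos_inj (by omega)
  · have span_le {i j : ι} (hi : f i = y) (hj : f j = y) :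
        (σ.symm j : ℕ) + 1 - σ.symm i ≤ (Finset.univ.filter fun i => f i = y).card := by
      rw [← Finset.card_equiv (s := Finset.univ.filter fun a => (f ∘ σ) a = y) σ (by simp)]
      exact add_one_sub_le_card_filter_eq_of_monotone hmono (by simpa) (by simpa)
    obtain ⟨i, j, l, hi, hj, hl, hij, hil, hjl⟩ := Finset.two_lt_card_iff.1 h3
    simp only [Finset.mem_filter, Finset.mem_univ, true_and, Fin.ext_iff, Fin.val_ofNat]
      at hi hj hl
    have := mt pos_inj hij
    have := mt pos_inj hil
    have := mt pos_inj hjl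
    have := span_le hi.1 hj.1
    have := span_le hi.1 hl.1
    have := span_le hj.1 hi.1
    have := span_le hj.1 hl.1
    have := span_le hl.1 hi.1
    have := span_le hl.1 hj.1
    omega

end RoundRobin

section TwoPartsAvoiding

variable {ι : Type*} {π : ι → Fin 2} {A B : ι → Finset ℕ} {e : ℕ}

theorem isHubRainbow_const (hπ : Function.Surjective π) {top bot : ι → ℕ}
    (hmm : ∀ i j, i ≠ j → top i = top j → RimCompatible π (fun _ => e) bot i j)
    (hmr : ∀ i, bot i ≠ e ∨ ∃ j, π j ≠ π i ∧ [top i, top j, bot j].Nodup)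
    (hhr : ∀ i, top i = bot i → ∃ j, j ≠ i ∧ top j = top i) :
    IsHubRainbow π top bot fun _ => e := by
  refine isHubRainbow_of_rimCompatible hπ hmm (fun i p hp => ?_) hhr
  rcases hmr i with h | ⟨j, hj, h⟩
  · exact .inl h
  · exact .inr (.inr ⟨j, by omega, h⟩)

theorem isRimColorable_erase (hB : ∀ i, (B i).card = 3) (e : ℕ) {K : Finset ι} (hK : K.card ≤ 3)
    (hconst : K.card = 3 → ¬ ∃ S, e ∈ S ∧ ∀ i ∈ K, B i = S) :
    IsRimColorable π (fun i => (B i).erase e) (fun _ => e) K := by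
  obtain ⟨x, hx, hinj⟩ := exists_injOn_erase hB e hK hconst
  exact ⟨x, hx, fun i hi j hj hij => ⟨hinj.ne hi hj hij, fun _ =>
    ⟨Finset.ne_of_mem_erase (hx i hi), Finset.ne_of_mem_erase (hx j hj)⟩⟩⟩

theorem exists_mem_erase_ne (hB : ∀ i, (B i).card = 3) (e c : ℕ) (i : ι) :
    ∃ d ∈ (B i).erase e, d ≠ c :=
  Finset.exists_mem_ne (two_le_card_erase (hB i) e) c

variable [Fintype ι]

theorem exists_forall_isRimColorable_erase (hB : ∀ i, (B i).card = 3)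
    (hn : Fintype.card ι ≤ 9)
    (h6 : ∀ T S : Finset ℕ, e ∈ S → (Finset.univ.filter fun i => A i = T ∧ B i = S).card ≤ 6)
    (T : Finset ℕ) : ∃ g : ι → Fin 3, ∀ c, IsRimColorable π (fun i => (B i).erase e)
      (fun _ => e) (Finset.univ.filter fun i => A i = T ∧ g i = c) := by
  obtain ⟨g, hg3, hg⟩ := exists_round_robin hn fun i => Encodable.encode (A i, B i)
  refine ⟨g, fun c => isRimColorable_erase hB e
    ((Finset.card_le_card (Finset.monotone_filter_right _ fun _ _ h => h.2)).trans (hg3 c)) ?_⟩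
  rintro h3 ⟨S, heS, hS⟩
  have h7 := hg c (Encodable.encode (T, S)) (h3.symm.trans_le (Finset.card_le_card fun i hi => by
    simp_all [hS i hi]))
  simp only [Encodable.encode_inj, Prod.mk.injEq] at h7
  have := h6 T S heS
  omega

theorem exists_pair_forall_card_filter_notMem_le_four [DecidableEq ι]
    (hn : Fintype.card ι = 9)
    (h6 : ∀ T : Finset ℕ, (Finset.univ.filter fun i => A i = T).card ≤ 6) :
    ∃ i j, i ≠ j ∧ ∀ K : Finset ι, i ∈ K → j ∈ K →
      ∀ T : Finset ℕ, (Finset.univ.filter fun a => a ∉ K ∧ A a = T).card ≤ 4 := by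
  by_cases! h5 : ∃ T : Finset ℕ, 5 ≤ (Finset.univ.filter fun i => A i = T).card
  · obtain ⟨T, h5⟩ := h5
    obtain ⟨i, hi, j, hj, hij⟩ := Finset.one_lt_card.1 (by omega :
      1 < (Finset.univ.filter fun i => A i = T).card)
    refine ⟨i, j, hij, fun K hiK hjK S => ?_⟩
    by_cases hS : S = T
    · subst hS
      have hsub : (Finset.univ.filter fun a => a ∉ K ∧ A a = S) ⊆
          ((Finset.univ.filter fun a => A a = S).erase i).erase j := by
        grind
      have hle := Finset.card_le_card hsub
      rw [Finset.card_erase_of_mem (Finset.mem_erase.2 ⟨hij.symm, hj⟩),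
        Finset.card_erase_of_mem hi] at hle
      have := h6 S
      omega
    · have := card_filter_and_eq_add_card_filter_eq_le (f := A) (fun a => a ∉ K) hS
      omega
  · obtain ⟨i, j, hij⟩ := Fintype.exists_pair_of_one_lt_card (by omega : 1 < Fintype.card ι)
    exact ⟨i, j, hij, fun K _ _ T => (Finset.card_le_card
      (Finset.monotone_filter_right _ fun _ _ h => h.2)).trans (Nat.le_of_lt_succ (h5 T))⟩

theorem exists_triple_not_const [DecidableEq ι] (hn : Fintype.card ι = 9)
    (h6 : ∀ T : Finset ℕ, (Finset.univ.filter fun i => A i = T).card ≤ 6)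
    (hconst : ¬ ∃ S, e ∈ S ∧ ∀ i, B i = S) :
    ∃ K : Finset ι, K.card = 3 ∧ (¬ ∃ S, e ∈ S ∧ ∀ i ∈ K, B i = S) ∧
      ∀ T : Finset ℕ, (Finset.univ.filter fun i => i ∉ K ∧ A i = T).card ≤ 4 := by
  obtain ⟨i, j, hij, h4⟩ := exists_pair_forall_card_filter_notMem_le_four hn h6
  obtain ⟨l, hli, hlj, hl⟩ : ∃ l, l ≠ i ∧ l ≠ j ∧ ¬ (e ∈ B i ∧ B j = B i ∧ B l = B i) := by
    by_contra! hall
    obtain ⟨l, -, hl⟩ := Finset.exists_mem_notMem_of_card_lt_card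
      (s := ({i, j} : Finset ι)) (t := Finset.univ)
      (by rw [Finset.card_univ]; exact Finset.card_le_two.trans_lt (by omega))
    simp only [Finset.mem_insert, Finset.mem_singleton, not_or] at hl
    refine hconst ⟨B i, (hall l hl.1 hl.2).1, fun a => ?_⟩
    by_cases hai : a = i
    · rw [hai]
    by_cases haj : a = j
    · rw [haj, (hall l hl.1 hl.2).2.1]
    · exact (hall a hai haj).2.2
  refine ⟨{i, j, l}, Finset.card_eq_three.2 ⟨i, j, l, hij, hli.symm, hlj.symm, rfl⟩, ?_,
    h4 _ (by simp) (by simp)⟩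
  rintro ⟨S, heS, hS⟩
  obtain ⟨rfl, hj, hl'⟩ : B i = S ∧ B j = S ∧ B l = S := by simpa using hS
  exact hl ⟨heS, hj, hl'⟩

theorem exists_isHubRainbow_of_avoiding (hπ : Function.Surjective π)
    (hA : ∀ i, (A i).card = 3) (hB : ∀ i, (B i).card = 3) (hn : Fintype.card ι ≤ 9)
    (h6 : ∀ T S : Finset ℕ, e ∈ S → (Finset.univ.filter fun i => A i = T ∧ B i = S).card ≤ 6)
    (h9 : Fintype.card ι = 9 → (Finset.univ.biUnion A).card = 4 →
      (∀ T : Finset ℕ, (Finset.univ.filter fun i => A i = T).card ≤ 6) →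
      ¬ ∃ S, e ∈ S ∧ ∀ i, B i = S) :
    ∃ top bot : ι → ℕ, (∀ i, top i ∈ A i) ∧ (∀ i, bot i ∈ B i) ∧
      IsHubRainbow π top bot fun _ => e := by
  classical
  obtain ⟨top, htop, hc⟩ := exists_top (π := π) (B := fun i => (B i).erase e) (e := fun _ => e) hA
    hn (fun K hK => isRimColorable_erase hB e (by omega) (by omega))
    (fun T _ => exists_forall_isRimColorable_erase hB hn h6 T)
    (fun hn9 hA4 hA6 => by
      obtain ⟨K, hK, hKB, hKA⟩ := exists_triple_not_const hn9 hA6 (h9 hn9 hA4 hA6)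
      exact ⟨K, hK, isRimColorable_erase hB e hK.le fun _ => hKB, hKA⟩)
  obtain ⟨bot, hbot, hmm, hhr⟩ := exists_bot_of_isRimColorable
    (fun i => exists_mem_erase_ne hB e (top i) i) hc
  exact ⟨top, bot, htop, fun i => Finset.mem_of_mem_erase (hbot i), isHubRainbow_const hπ hmm
    (fun i => .inl (Finset.ne_of_mem_erase (hbot i))) hhr⟩

end TwoPartsAvoiding

section PlainColorings

variable {ι : Type*} {π : ι → Fin 2} {A B : ι → Finset ℕ} {Q : ι → Prop} {T S : Finset ℕ} {e : ℕ}

/-- A colouring of the edges at the middle vertices that satisfy `Q`, from the lists `T` at the hub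
and `S` at the rim, where `e` is the colour of the rim edge. It comes with colours from `T` for the
edges at the hub of the other middle vertices, to be used if these have the list `T` as well. -/
structure PlainColoring (π : ι → Fin 2) (Q : ι → Prop) (T S : Finset ℕ) (e : ℕ)
    (top bot : ι → ℕ) : Prop where
  top_mem : ∀ i, top i ∈ T
  bot_mem : ∀ i, Q i → bot i ∈ S
  compat : ∀ i j, Q i → Q j → i ≠ j → top i = top j → RimCompatible π (fun _ => e) bot i j
  rim : ∀ i, Q i → bot i ≠ e ∨ ∃ j, Q j ∧ π j ≠ π i ∧ [top i, top j, bot j].Nodup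
  shared : ∀ i, ∃ j, Q j ∧ j ≠ i ∧ top j = top i
  rest_inj : ∀ i j, ¬ Q i → ¬ Q j → top i = top j → i = j
  rest_compat : ∀ i j, ¬ Q i → Q j → top i = top j → π i ≠ π j → bot j ≠ e

theorem exists_choice_notMem_of_ne (hA : ∀ i, (A i).card = 3) (hT : T.card = 3) :
    ∃ o : ι → ℕ, ∀ i, o i ∈ A i ∧ (A i ≠ T → o i ∉ T) := by
  choose o ho using fun i => show ∃ c, c ∈ A i ∧ (A i ≠ T → c ∉ T) by
    by_cases hAT : A i = T
    · obtain ⟨c, hc⟩ := Finset.card_pos.1 (by rw [hA]; decide : 0 < (A i).card)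
      exact ⟨c, hc, fun h => absurd hAT h⟩
    · obtain ⟨c, hc, hcT⟩ := Finset.not_subset.1 fun hs =>
        hAT (Finset.eq_of_subset_of_card_le hs (by rw [hA, hT]))
      exact ⟨c, hc, fun _ => hcT⟩
  exact ⟨o, ho⟩

theorem exists_bot_of_card_le_two (hB : ∀ i, (B i).card = 3) (e : ℕ) (top : ι → ℕ)
    {K : Finset ι} (hK : K.card ≤ 2) :
    ∃ bot : ι → ℕ, (∀ i ∈ K, bot i ∈ (B i).erase e) ∧
      (∀ i ∈ K, ∀ j ∈ K, i ≠ j → top i = top j → bot i ≠ bot j) ∧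
      ∀ i ∈ K, top i = bot i → ∃ j ∈ K, j ≠ i ∧ top j = top i := by
  by_cases htop : Set.InjOn top K
  · choose bot hbot hne using fun i => exists_mem_erase_ne hB e (top i) i
    exact ⟨bot, fun i _ => hbot i, fun i hi j hj hij ht => absurd (htop hi hj ht) hij,
      fun i _ h => absurd h.symm (hne i)⟩
  · obtain ⟨bot, hbot, hinj⟩ := exists_injOn_erase hB e (hK.trans (by decide)) (by omega)
    refine ⟨bot, hbot, fun i hi j hj hij _ => hinj.ne hi hj hij, fun i hi _ => ?_⟩
    obtain ⟨a, ha, b, hb, hab, hne⟩ : ∃ a ∈ K, ∃ b ∈ K, top a = top b ∧ a ≠ b := by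
      simpa [Set.InjOn] using htop
    obtain rfl | hia := eq_or_ne i a
    · exact ⟨b, hb, hne.symm, hab.symm⟩
    · obtain rfl : i = b := by
        by_contra hib
        exact absurd (Finset.two_lt_card.2 ⟨i, hi, a, ha, b, hb, hia, hib, hne⟩) (by omega)
      exact ⟨a, ha, hne, hab⟩

theorem PlainColoring.exists_isHubRainbow [Fintype ι] (hπ : Function.Surjective π)
    (hA : ∀ i, (A i).card = 3) (hB : ∀ i, (B i).card = 3) (heS : e ∈ S) (hT : T.card = 3)
    (hS : S.card = 3) (h2 : (Finset.univ.filter fun i => A i ≠ T).card ≤ 2) {top bot : ι → ℕ}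
    (h : PlainColoring π (fun i => A i = T ∧ B i = S) T S e top bot) :
    ∃ top bot : ι → ℕ, (∀ i, top i ∈ A i) ∧ (∀ i, bot i ∈ B i) ∧
      IsHubRainbow π top bot fun _ => e := by
  obtain ⟨o, ho⟩ := exists_choice_notMem_of_ne hA hT
  obtain ⟨y, hy⟩ := exists_choice_notMem_of_ne hB hS
  obtain ⟨x, hx, hxne, hxs⟩ := exists_bot_of_card_le_two hB e o h2
  simp only [Finset.mem_filter, Finset.mem_univ, true_and, Finset.mem_erase] at hx hxne hxs
  obtain ⟨top_mem, bot_mem, compat, rim, shared, rest_inj, rest_compat⟩ := h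
  refine ⟨fun i => if A i = T then top i else o i,
    fun i => if A i = T then (if B i = S then bot i else y i) else x i,
    fun i => ?_, fun i => ?_, isHubRainbow_const hπ (fun i j hij ht => ?_) (fun i => ?_)
    fun i hi => ?_⟩
  · grind
  · grind
  · simp only [RimCompatible] at compat ⊢
    grind
  · grind
  · by_cases hAi : A i = T
    · obtain ⟨j, hj, hji, ht⟩ := shared i
      exact ⟨j, hji, by simp [hAi, hj.1, ht]⟩
    · obtain ⟨j, hj, hji, ht⟩ := hxs i hAi (by simpa [hAi] using hi)
      exact ⟨j, hji, by simp [hAi, hj, ht]⟩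

/-- A numbering `k` of the middle vertices that satisfy `Q` in each part, where `N p` is their
number in the part `p`, and separately of the other middle vertices, at most `M p` in the part
`p`. -/
structure IsNumbering (π : ι → Fin 2) (Q : ι → Prop) (N M : Fin 2 → ℕ) (k : ι → ℕ) : Prop where
  inj : ∀ i j, (Q i ↔ Q j) → π i = π j → k i = k j → i = j
  lt : ∀ i, Q i → k i < N (π i)
  rest_lt : ∀ i, ¬ Q i → k i < M (π i)
  exists_eq : ∀ p, ∀ m < N p, ∃ i, Q i ∧ π i = p ∧ k i = m

theorem exists_isNumbering [Fintype ι] (π : ι → Fin 2) (Q : ι → Prop) [DecidablePred Q] :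
    ∃ k, IsNumbering π Q (fun p => (Finset.univ.filter fun i => Q i ∧ π i = p).card)
      (fun p => (Finset.univ.filter fun i => ¬ Q i ∧ π i = p).card) k := by
  have exists_bijOn (s : Finset ι) : ∃ k : ι → ℕ, Set.BijOn k s (Set.Iio s.card) :=
    s.finite_toSet.exists_bijOn_of_encard_eq (by
      rw [Set.encard_coe_eq_coe_finsetCard, ← Finset.coe_range, Set.encard_coe_eq_coe_finsetCard,
        Finset.card_range])
  choose k hk using fun p => exists_bijOn (Finset.univ.filter fun i => Q i ∧ π i = p)
  choose l hl using fun p => exists_bijOn (Finset.univ.filter fun i => ¬ Q i ∧ π i = p)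
  refine ⟨fun i => if Q i then k (π i) i else l (π i) i, fun i j hQ hp h => ?_, fun i hi => ?_,
    fun i hi => ?_, fun p m hm => ?_⟩
  · by_cases hi : Q i
    · have hj := hQ.1 hi
      exact (hk (π j)).injOn (by simp [hi, hp]) (by simp [hj]) (by simpa [hi, hj, hp] using h)
    · have hj := mt hQ.2 hi
      exact (hl (π j)).injOn (by simp [hi, hp]) (by simp [hj]) (by simpa [hi, hj, hp] using h)
  · simpa [hi] using (hk (π i)).mapsTo (x := i) (by simp [hi])
  · simpa [hi] using (hl (π i)).mapsTo (x := i) (by simp [hi])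
  · obtain ⟨i, hi, him⟩ := (hk p).surjOn hm
    obtain ⟨hQ, rfl⟩ : Q i ∧ π i = p := by simpa using hi
    exact ⟨i, hQ, rfl, by rw [if_pos hQ, him]⟩

theorem exists_mem_notMem_erase (hS : S.Nonempty) (a : ℕ) : ∃ e ∈ S, a ∉ S.erase e := by
  by_cases ha : a ∈ S
  · exact ⟨a, ha, Finset.notMem_erase a S⟩
  · obtain ⟨e, he⟩ := hS
    exact ⟨e, he, fun h => ha (Finset.mem_of_mem_erase h)⟩

theorem exists_special_colors (hT : T.card = 3) (hS : S.card = 3) :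
    ∃ t₁ t₂ t₃ β γ e, T = {t₁, t₂, t₃} ∧ S = {β, γ, e} ∧ [t₁, t₂, t₃].Nodup ∧
      [β, γ, e].Nodup ∧ [t₃, β, γ].Nodup := by
  obtain ⟨t₁, t₂, t₃, h12, h13, h23, rfl⟩ := Finset.card_eq_three.1 hT
  obtain ⟨e, he, h3⟩ := exists_mem_notMem_erase (Finset.card_pos.1 (by omega : 0 < S.card)) t₃
  obtain ⟨β, γ, hβγ, hS'⟩ := Finset.card_eq_two.1
    (by rw [Finset.card_erase_of_mem he, hS] : (S.erase e).card = 2)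
  have hne := Finset.notMem_erase e S
  rw [hS'] at h3 hne
  exact ⟨t₁, t₂, t₃, β, γ, e, rfl, by rw [← Finset.insert_erase he, hS']; grind, by simp [*],
    by grind, by grind⟩

variable {N M : Fin 2 → ℕ} {k : ι → ℕ} {a b : Fin 2} {t₁ t₂ t₃ β γ : ℕ}

theorem IsNumbering.exists_plainColoring_of_two_le (hk : IsNumbering π Q N M k) (hab : a ≠ b)
    (ha4 : 4 ≤ N a) (ha6 : N a ≤ 6) (hb2 : 2 ≤ N b) (hb3 : N b ≤ 3) (ha : M a ≤ 2) (hb : M b ≤ 1)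
    (hT : [t₁, t₂, t₃].Nodup) (hS : [β, γ, e].Nodup) (h3 : [t₃, β, γ].Nodup) :
    ∃ top bot, PlainColoring π Q {t₁, t₂, t₃} {β, γ, e} e top bot := by
  obtain ⟨u₀, hu₀, ha₀, hk₀⟩ := hk.exists_eq a 0 (by omega)
  obtain ⟨u₁, hu₁, ha₁, hk₁⟩ := hk.exists_eq a 1 (by omega)
  obtain ⟨u₂, hu₂, ha₂, hk₂⟩ := hk.exists_eq a 2 (by omega)
  obtain ⟨u₃, hu₃, ha₃, hk₃⟩ := hk.exists_eq a 3 (by omega)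
  obtain ⟨v₀, hv₀, hb₀, hl₀⟩ := hk.exists_eq b 0 (by omega)
  obtain ⟨v₁, hv₁, hb₁, hl₁⟩ := hk.exists_eq b 1 (by omega)
  obtain ⟨inj, lt, rest_lt, -⟩ := hk
  have hπ (i) : π i = a ∨ π i = b := by omega
  simp only [List.nodup_cons, List.mem_cons, List.not_mem_nil, or_false, not_or, List.nodup_nil,
    and_true, not_false_eq_true] at hT hS h3
  refine ⟨fun i => if π i = a then (if k i % 2 = 0 then t₁ else t₂) else t₃,
      fun i => if (if π i = a then k i / 2 else k i) = 0 then β else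
        if (if π i = a then k i / 2 else k i) = 1 then γ else e, ?_, ?_, ?_, ?_, ?_, ?_, ?_⟩
  · grind
  · grind
  · simp only [RimCompatible]
    grind
  · intro i _
    refine .inr ?_
    by_cases hia : π i = a
    · by_cases hc : (if k i % 2 = 0 then t₁ else t₂) = β
      · exact ⟨v₁, hv₁, by grind, by grind⟩
      · exact ⟨v₀, hv₀, by grind, by grind⟩
    · by_cases hc : t₁ = β
      · exact ⟨u₂, hu₂, by grind, by grind⟩
      · exact ⟨u₀, hu₀, by grind, by grind⟩
  · intro i
    by_cases hia : π i = a
    · by_cases h0 : k i % 2 = 0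
      · exact if hi : k i = 0 then ⟨u₂, hu₂, by grind⟩ else ⟨u₀, hu₀, by grind⟩
      · exact if hi : k i = 1 then ⟨u₃, hu₃, by grind⟩ else ⟨u₁, hu₁, by grind⟩
    · exact if hi : k i = 0 then ⟨v₁, hv₁, by grind⟩ else ⟨v₀, hv₀, by grind⟩
  · grind
  · grind

theorem IsNumbering.exists_plainColoring_of_six_one (hk : IsNumbering π Q N M k) (hab : a ≠ b)
    (hNa : N a = 6) (hNb : N b = 1) (hMa : M a = 0) (hMb : M b ≤ 2) (hT : [t₁, t₂, t₃].Nodup)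
    (hS : [β, γ, e].Nodup) (h1 : t₁ ≠ γ) (h3 : t₃ ≠ γ) :
    ∃ top bot, PlainColoring π Q {t₁, t₂, t₃} {β, γ, e} e top bot := by
  classical
  choose u hu hua huk using fun m : Fin 6 => hk.exists_eq a m (by omega)
  obtain ⟨v, hv, hvb, -⟩ := hk.exists_eq b 0 (by omega)
  obtain ⟨inj, lt, rest_lt, -⟩ := hk
  have hπ (i) : π i = a ∨ π i = b := by omega
  simp only [List.nodup_cons, List.mem_cons, List.not_mem_nil, or_false, not_or, List.nodup_nil,
    and_true, not_false_eq_true] at hT hS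
  refine ⟨fun i => if π i = a then (if k i < 3 then t₁ else if k i < 5 then t₂ else t₃) else
      if k i = 0 ∧ ¬ Q i then t₂ else t₃,
    fun i => if π i = a then (if k i = 2 then e else if k i = 1 ∨ k i = 4 then γ else β) else γ,
    ?_, ?_, ?_, ?_, ?_, ?_, ?_⟩
  · grind
  · grind
  · simp only [RimCompatible]
    grind
  · intro i _
    by_cases h2 : π i = a ∧ k i = 2
    · exact .inr ⟨v, hv, by grind, by grind⟩
    · exact .inl (by grind)
  · intro i
    simp only [Fin.forall_fin_succ] at huk
    by_cases hia : π i = a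
    · by_cases h3 : k i < 3
      · exact if h0 : k i = 0 then ⟨u 1, hu 1, by grind⟩ else ⟨u 0, hu 0, by grind⟩
      by_cases h5 : k i < 5
      · exact if h0 : k i = 3 then ⟨u 4, hu 4, by grind⟩ else ⟨u 3, hu 3, by grind⟩
      · exact ⟨v, hv, by grind⟩
    · exact if h0 : k i = 0 ∧ ¬ Q i then ⟨u 3, hu 3, by grind⟩ else ⟨u 5, hu 5, by grind⟩
  · grind
  · grind

theorem IsNumbering.exists_plainColoring_of_four_four (hk : IsNumbering π Q N M k) (hab : a ≠ b)
    (hNa : N a = 4) (hNb : N b = 4) (hMa : M a = 0) (hMb : M b = 0) (hT : [t₁, t₂, t₃].Nodup)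
    (hS : [β, γ, e].Nodup) (h3 : [t₃, β, γ].Nodup) (h1 : t₁ ≠ γ) (h2 : t₂ ≠ β) :
    ∃ top bot, PlainColoring π Q {t₁, t₂, t₃} {β, γ, e} e top bot := by
  obtain ⟨u₀, hu₀, ha₀, hk₀⟩ := hk.exists_eq a 0 (by omega)
  obtain ⟨u₁, hu₁, ha₁, hk₁⟩ := hk.exists_eq a 1 (by omega)
  obtain ⟨u₃, hu₃, ha₃, hk₃⟩ := hk.exists_eq a 3 (by omega)
  obtain ⟨v₀, hv₀, hb₀, hl₀⟩ := hk.exists_eq b 0 (by omega)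
  obtain ⟨v₁, hv₁, hb₁, hl₁⟩ := hk.exists_eq b 1 (by omega)
  obtain ⟨v₃, hv₃, hb₃, hl₃⟩ := hk.exists_eq b 3 (by omega)
  obtain ⟨inj, lt, rest_lt, -⟩ := hk
  have hπ (i) : π i = a ∨ π i = b := by omega
  have hQ (i) : Q i := by
    by_contra hi
    grind
  simp only [List.nodup_cons, List.mem_cons, List.not_mem_nil, or_false, not_or, List.nodup_nil,
    and_true, not_false_eq_true] at hT hS h3
  refine ⟨fun i => if k i = 3 then t₃ else if π i = a then t₁ else t₂,
    fun i => if k i = 2 then e else if k i = 0 ∨ (k i = 3 ∧ π i = a) then β else γ,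
    ?_, ?_, ?_, ?_, ?_, ?_, ?_⟩
  · grind
  · grind
  · simp only [RimCompatible]
    grind
  · intro i _
    by_cases hi : k i = 2
    · exact .inr <| if hia : π i = a then ⟨v₃, hv₃, by grind, by grind⟩
        else ⟨u₃, hu₃, by grind, by grind⟩
    · exact .inl (by grind)
  · intro i
    by_cases hia : π i = a
    · exact if h3 : k i = 3 then ⟨v₃, hv₃, by grind⟩ else
        if h0 : k i = 0 then ⟨u₁, hu₁, by grind⟩ else ⟨u₀, hu₀, by grind⟩
    · exact if h3 : k i = 3 then ⟨u₃, hu₃, by grind⟩ else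
        if h0 : k i = 0 then ⟨v₁, hv₁, by grind⟩ else ⟨v₀, hv₀, by grind⟩
  · grind
  · grind

end PlainColorings

section TwoPartsChoosable

/-- The part sizes of a hub graph with two parts that is shown to be rainbow 3-choosable: those
bounded by `(6, 3)` or `(4, 4)`. -/
def IsSmallPair (p q : ℕ) : Prop :=
  (p ≤ 6 ∧ q ≤ 3) ∨ (p ≤ 4 ∧ q ≤ 4)

variable {ι : Type*} {π : ι → Fin 2} {A B : ι → Finset ℕ} {T S : Finset ℕ}

theorem IsNumbering.exists_plainColoring {Q : ι → Prop} {N M : Fin 2 → ℕ} {k : ι → ℕ}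
    (hk : IsNumbering π Q N M k) (h : IsSmallPair (N 0 + M 0) (N 1 + M 1)) (h7 : 7 ≤ N 0 + N 1)
    (hT : T.card = 3) (hS : S.card = 3) :
    ∃ e ∈ S, ∃ top bot, PlainColoring π Q T S e top bot := by
  obtain ⟨t₁, t₂, t₃, β, γ, e, rfl, rfl, ht, hs, h3⟩ := exists_special_colors hT hS
  refine ⟨e, by simp, ?_⟩
  simp only [IsSmallPair] at h
  by_cases h2 : 2 ≤ N 1 ∧ N 1 ≤ 3
  · exact hk.exists_plainColoring_of_two_le zero_ne_one (by omega) (by omega) h2.1 h2.2 (by omega)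
      (by omega) ht hs h3
  by_cases h1 : N 1 ≤ 1
  · have six {β γ} := hk.exists_plainColoring_of_six_one (t₁ := t₁) (t₂ := t₂) (t₃ := t₃)
      (β := β) (γ := γ) (e := e) zero_ne_one (by omega) (by omega) (by omega) (by omega) ht
    by_cases h1γ : t₁ = γ
    · rw [Finset.insert_comm β]
      exact six (by grind) (by grind) (by grind)
    · exact six hs h1γ (by grind)
  by_cases h0 : N 0 ≤ 3
  · exact hk.exists_plainColoring_of_two_le one_ne_zero (by omega) (by omega) (by omega) h0
      (by omega) (by omega) ht hs h3
  have four {t₁ t₂} := hk.exists_plainColoring_of_four_four (t₁ := t₁) (t₂ := t₂) (t₃ := t₃)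
    (β := β) (γ := γ) (e := e) zero_ne_one (by omega) (by omega) (by omega) (by omega)
  by_cases h12 : t₁ = γ ∨ t₂ = β
  · rw [Finset.insert_comm t₁]
    exact four (by grind) hs h3 (by grind) (by grind)
  · exact four ht hs h3 (by grind) (by grind)

theorem exists_isHubRainbow_of_seven_le [Fintype ι] (hπ : Function.Surjective π)
    (h : IsSmallPair (Finset.univ.filter fun i => π i = 0).card
      (Finset.univ.filter fun i => π i = 1).card)
    (hA : ∀ i, (A i).card = 3) (hB : ∀ i, (B i).card = 3)
    (h7 : 7 ≤ (Finset.univ.filter fun i => A i = T ∧ B i = S).card) :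
    ∃ e ∈ S, ∃ top bot : ι → ℕ, (∀ i, top i ∈ A i) ∧ (∀ i, bot i ∈ B i) ∧
      IsHubRainbow π top bot fun _ => e := by
  obtain ⟨i₀, hi₀⟩ := Finset.card_pos.1 (by omega :
    0 < (Finset.univ.filter fun i => A i = T ∧ B i = S).card)
  obtain ⟨rfl, rfl⟩ : A i₀ = T ∧ B i₀ = S := by simpa using hi₀
  have hfiber (p) := Finset.card_filter_add_card_filter_not
    (s := Finset.univ.filter fun i => π i = p) fun i => A i = A i₀ ∧ B i = B i₀
  simp only [Finset.filter_filter, and_comm (a := π _ = _)] at hfiber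
  have hsum := card_filter_eq_sum_card_fiber π fun i => A i = A i₀ ∧ B i = B i₀
  rw [Fin.sum_univ_two] at hsum
  obtain ⟨k, hk⟩ := exists_isNumbering π fun i => A i = A i₀ ∧ B i = B i₀
  obtain ⟨e, he, top, bot, hplain⟩ := hk.exists_plainColoring (by rwa [hfiber, hfiber])
    (by omega) (hA i₀) (hB i₀)
  have hcard := card_eq_sum_card_fiber π
  rw [Fin.sum_univ_two] at hcard
  have h2 : (Finset.univ.filter fun i => A i ≠ A i₀).card ≤ 2 := by
    have hsplit := Finset.card_filter_add_card_filter_not (s := (Finset.univ : Finset ι))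
      fun i => A i = A i₀
    have hle : (Finset.univ.filter fun i => A i = A i₀ ∧ B i = B i₀).card ≤
        (Finset.univ.filter fun i => A i = A i₀).card :=
      Finset.card_le_card (Finset.monotone_filter_right _ fun _ _ h => h.1)
    rw [Finset.card_univ] at hsplit
    simp only [IsSmallPair] at h
    simp only [ne_eq]
    omega
  exact ⟨e, he, hplain.exists_isHubRainbow hπ hA hB he (hA i₀) (hB i₀) h2⟩

variable {K : Finset ι} {e α d : ℕ} {j₀ : ι} {top : ι → ℕ}

theorem isRimColorable_ite_singleton [DecidableEq ι] (hS : (S.erase e).card = 2)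
    (hd : d ∈ S.erase e) (hK : K.card ≤ 2) (j₀ : ι) :
    IsRimColorable π (fun i => if i = j₀ then {d} else S.erase e) (fun _ => e) K := by
  obtain ⟨d', hd', hdd'⟩ := Finset.exists_mem_ne (by omega : 1 < (S.erase e).card) d
  obtain ⟨j, hj, hjK⟩ : ∃ j, (j₀ ∈ K → j = j₀) ∧ ∀ i ∈ K, ∀ l ∈ K, i ≠ j → l ≠ j → i = l := by
    by_cases hj₀ : j₀ ∈ K
    · refine ⟨j₀, fun _ => rfl, fun i hi l hl hij hlj => ?_⟩
      by_contra hil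
      exact absurd (Finset.two_lt_card.2 ⟨i, hi, l, hl, j₀, hj₀, hil, hij, hlj⟩) (by omega)
    · rcases K.eq_empty_or_nonempty with rfl | ⟨j, hj⟩
      · exact ⟨j₀, by simp⟩
      · refine ⟨j, fun h => absurd h hj₀, fun i hi l hl hij hlj => ?_⟩
        by_contra hil
        exact absurd (Finset.two_lt_card.2 ⟨i, hi, l, hl, j, hj, hil, hij, hlj⟩) (by omega)
  refine ⟨fun i => if i = j then d else d', fun i hi => ?_, fun i hi l hl hil => ?_⟩
  · grind
  · simp only [RimCompatible]
    grind

variable [Fintype ι]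

theorem exists_bot_of_triple {p : Fin 2} (hS : S.card = 3) (heS : e ∈ S) (hK : K.card = 3)
    (hKp : ∀ i ∈ K, π i = p) (hα : ∀ i, top i = α ↔ i ∈ K)
    (htwo : ∀ c ≠ α, (Finset.univ.filter fun i => top i = c).card ≤ 2) (hj₀ : j₀ ∉ K)
    (hd : d ∈ S.erase e) (hdtop : d ≠ top j₀) :
    ∃ bot : ι → ℕ, (∀ i, bot i ∈ S) ∧ bot j₀ = d ∧ (∀ i ∉ K, bot i ≠ e) ∧
      (∀ i j, i ≠ j → top i = top j → RimCompatible π (fun _ => e) bot i j) ∧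
      ∀ i, top i = bot i → ∃ j, j ≠ i ∧ top j = top i := by
  classical
  have hSe : (S.erase e).card = 2 := by rw [Finset.card_erase_of_mem heS, hS]
  let B i := if i ∈ K then S else if i = j₀ then {d} else S.erase e
  have exists_ne_top i : ∃ c ∈ B i, c ≠ top i := by
    unfold B
    split_ifs with hi hij
    · exact Finset.exists_mem_ne (by omega) _
    · exact ⟨d, by simp, hij ▸ hdtop⟩
    · exact Finset.exists_mem_ne (by omega) _
  have colorable c : IsRimColorable π B (fun _ => e) (Finset.univ.filter fun i => top i = c) := by
    by_cases hc : c = α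
    · have hcK : (Finset.univ.filter fun i => top i = c) = K := by grind
      obtain ⟨x, hx, hxc⟩ := isRimColorable_of_same_part (π := π) (B := fun _ => S) (K := K)
        (e := fun _ => e) (fun _ => hS) hK.le fun i hi j hj => (hKp i hi).trans (hKp j hj).symm
      exact ⟨x, by grind, by rwa [hcK]⟩
    · obtain ⟨x, hx, hxc⟩ := isRimColorable_ite_singleton (π := π) hSe hd (htwo c hc) j₀
      exact ⟨x, by grind, hxc⟩
  obtain ⟨bot, hbot, hmm, hhr⟩ := exists_bot_of_isRimColorable exists_ne_top colorable
  exact ⟨bot, by grind, by grind, by grind, hmm, hhr⟩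

theorem exists_isHubRainbow_of_forall_eq (hπ : Function.Surjective π)
    (hp : (Finset.univ.filter fun i => π i = 0).card = 6)
    (hq : (Finset.univ.filter fun i => π i = 1).card = 3)
    (hA : ∀ i, (A i).card = 3) (hS : S.card = 3) (h4 : (Finset.univ.biUnion A).card = 4)
    (h6 : ∀ T : Finset ℕ, (Finset.univ.filter fun i => A i = T).card ≤ 6) :
    ∃ e ∈ S, ∃ top bot : ι → ℕ, (∀ i, top i ∈ A i) ∧ (∀ i, bot i ∈ S) ∧
      IsHubRainbow π top bot fun _ => e := by
  classical
  have hcard := card_eq_sum_card_fiber π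
  rw [Fin.sum_univ_two, hp, hq] at hcard
  obtain ⟨K, p, hK, hKp, hout⟩ := exists_triple_in_fiber (π := π) hcard h6 ⟨0, by omega⟩
    fun T _ => by
      have hsum := card_filter_eq_sum_card_fiber π fun i => A i = T
      rw [Fin.sum_univ_two] at hsum
      have hle := card_filter_and_fiber_le π (fun i => A i = T) 1
      exact ⟨0, by omega, by omega⟩
  obtain ⟨top, α, htop, hα, htwo⟩ := exists_top_of_triple hA hcard h4 hK hout
  obtain ⟨e, heS, he⟩ := exists_mem_notMem_erase (Finset.card_pos.1 (by omega : 0 < S.card)) α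
  obtain ⟨j₀, hj₀⟩ := hπ (p + 1)
  have hj₀p : π j₀ ≠ p := by omega
  have hj₀K : j₀ ∉ K := fun h => hj₀p (hKp j₀ h)
  obtain ⟨d, hd, hdtop⟩ := exists_mem_erase_ne (fun _ => hS) e (top j₀) j₀
  obtain ⟨bot, hbot, hbotd, hbote, hmm, hhr⟩ :=
    exists_bot_of_triple hS heS hK hKp hα htwo hj₀K hd hdtop
  refine ⟨e, heS, top, bot, htop, hbot, isHubRainbow_const hπ hmm (fun i => ?_) hhr⟩
  by_cases hi : i ∈ K
  · exact .inr ⟨j₀, by rwa [hKp i hi], by grind -ring⟩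
  · exact .inl (hbote i hi)

theorem exists_mem_forall_eq_of_seven_le (hn : Fintype.card ι ≤ 9) (hB : ∀ i, (B i).card = 3)
    (hS : S.card = 3) :
    ∃ e ∈ S, ∀ R : Finset ℕ, 7 ≤ (Finset.univ.filter fun i => B i = R).card → e ∈ R → R = S := by
  by_cases! h : ∃ R, R ≠ S ∧ 7 ≤ (Finset.univ.filter fun i => B i = R).card
  · obtain ⟨R, hRS, hR⟩ := h
    obtain ⟨i, hi⟩ := Finset.card_pos.1 (by omega :
      0 < (Finset.univ.filter fun i => B i = R).card)
    obtain rfl : B i = R := by simpa using hi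
    obtain ⟨e, he, heR⟩ := Finset.not_subset.1 fun hsub : S ⊆ B i =>
      hRS (Finset.eq_of_subset_of_card_le hsub (by rw [hS, hB])).symm
    refine ⟨e, he, fun R' hR' heR' => ?_⟩
    have := card_filter_and_eq_add_card_filter_eq_le (f := B) (fun _ => True)
      (fun h : R' = B i => heR (h ▸ heR'))
    simp only [true_and] at this
    omega
  · obtain ⟨e, he⟩ := Finset.card_pos.1 (by omega : 0 < S.card)
    refine ⟨e, he, fun R hR _ => ?_⟩
    by_contra hne
    have := h R hne
    omega

variable {p q : ℕ}

theorem hubGraph_rainbowChoosable_of_isSmallPair (hπ : Function.Surjective π)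
    (hp : (Finset.univ.filter fun i => π i = 0).card = p)
    (hq : (Finset.univ.filter fun i => π i = 1).card = q) (h : IsSmallPair p q) :
    RainbowChoosable (hubGraph π) 3 := by
  subst hp hq
  refine hubGraph_rainbowChoosable_of fun A B E hA hB hE => ?_
  suffices ∃ e ∈ E s(0, 1), ∃ top bot : ι → ℕ, (∀ i, top i ∈ A i) ∧ (∀ i, bot i ∈ B i) ∧
      IsHubRainbow π top bot fun _ => e by
    obtain ⟨e, he, top, bot, htop, hbot, hrainbow⟩ := this
    refine ⟨top, bot, fun _ => e, htop, hbot, fun t ht => ?_, hrainbow⟩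
    obtain rfl : t = s(0, 1) := by revert t; decide
    exact he
  have hE3 := hE s(0, 1) (by decide)
  have hcard := card_eq_sum_card_fiber π
  rw [Fin.sum_univ_two] at hcard
  have hn : Fintype.card ι ≤ 9 := by
    simp only [IsSmallPair] at h
    omega
  by_cases hlists : ∃ T, 7 ≤ (Finset.univ.filter fun i => A i = T ∧ B i = E s(0, 1)).card
  · obtain ⟨T, hT⟩ := hlists
    exact exists_isHubRainbow_of_seven_le hπ h hA hB hT
  by_cases hconst : Fintype.card ι = 9 ∧ (Finset.univ.biUnion A).card = 4 ∧
      (∀ T : Finset ℕ, (Finset.univ.filter fun i => A i = T).card ≤ 6) ∧ B = fun _ => E s(0, 1)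
  · obtain ⟨h9, h4, h6, rfl⟩ := hconst
    simp only [IsSmallPair] at h
    exact exists_isHubRainbow_of_forall_eq hπ (by omega) (by omega) hA hE3 h4 h6
  obtain ⟨e, heE, he⟩ := exists_mem_forall_eq_of_seven_le hn hB hE3
  refine ⟨e, heE, exists_isHubRainbow_of_avoiding hπ hA hB hn (fun T S heS => ?_) ?_⟩
  · by_contra! h7
    have hle : (Finset.univ.filter fun i => A i = T ∧ B i = S).card ≤
        (Finset.univ.filter fun i => B i = S).card :=
      Finset.card_le_card (Finset.monotone_filter_right _ fun _ _ h => h.2)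
    obtain rfl := he S (by omega) heS
    exact hlists ⟨T, h7⟩
  · rintro h9 h4 h6 ⟨S, heS, hS⟩
    have hall : (Finset.univ.filter fun i => B i = S).card = 9 := by
      rw [Finset.filter_true_of_mem fun i _ => hS i, Finset.card_univ, h9]
    exact hconst ⟨h9, h4, h6, funext fun i => (hS i).trans (he S (by omega) heS)⟩

end TwoPartsChoosable

section Values

theorem card_fiber_sigma {k : ℕ} (n : Fin k → ℕ) (p : Fin k) :
    (Finset.univ.filter fun i : Σ p, Fin (n p) => i.1 = p).card = n p := by
  have h : (Finset.univ.filter fun i : Σ p, Fin (n p) => i.1 = p) =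
      Finset.univ.map (Function.Embedding.sigmaMk p) := by
    ext ⟨q, i⟩
    simp only [Finset.mem_filter, Finset.mem_univ, true_and, Finset.mem_map,
      Function.Embedding.sigmaMk_apply]
    exact ⟨fun h => by cases h; exact ⟨i, rfl⟩, fun ⟨j, h⟩ => (congrArg Sigma.fst h).symm⟩
  rw [h, Finset.card_map, Finset.card_univ, Fintype.card_fin]

theorem sigma_fst_surjective {k : ℕ} {n : Fin k → ℕ} (hn : ∀ p, 1 ≤ n p) :
    Function.Surjective (Sigma.fst : (Σ p, Fin (n p)) → Fin k) :=
  fun p => ⟨⟨p, ⟨0, hn p⟩⟩, rfl⟩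

theorem hubGraphOfSizes_values_three {k : ℕ} [Nontrivial (Fin k)] {n : Fin k → ℕ}
    (h : RainbowChoosable (hubGraphOfSizes n) 3) :
    rc (hubGraphOfSizes n) = 3 ∧ rcList (hubGraphOfSizes n) = 3 :=
  rc_eq_and_rcList_eq hubGraph_not_rainbowColorable_two h

theorem hubGraphOfSizes_values_four {k : ℕ} (hk : k ≤ 3) {n : Fin k → ℕ} (hn : ∀ p, 1 ≤ n p)
    (h : ¬ RainbowColorable (hubGraphOfSizes n) 3) :
    rc (hubGraphOfSizes n) = 4 ∧ rcList (hubGraphOfSizes n) = 4 :=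
  rc_eq_and_rcList_eq h (hubGraph_rainbowChoosable_of_four_le le_rfl
    (by rw [Fintype.card_fin]; omega) (sigma_fst_surjective hn))

variable {p q r : ℕ}

theorem one_le_pair (hp : 1 ≤ p) (hq : 1 ≤ q) (i : Fin 2) : 1 ≤ ![p, q] i := by
  fin_cases i <;> assumption

theorem one_le_triple (hp : 1 ≤ p) (hq : 1 ≤ q) (hr : 1 ≤ r) (i : Fin 3) :
    1 ≤ ![p, q, r] i := by
  fin_cases i <;> assumption

theorem card_sigma_pair : Fintype.card (Σ i, Fin (![p, q] i)) = p + q := by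
  simp [Fin.sum_univ_two]

theorem card_sigma_triple : Fintype.card (Σ i, Fin (![p, q, r] i)) = p + q + r := by
  simp [Fin.sum_univ_three]

theorem not_rainbowColorable_three_seven_one :
    ¬ RainbowColorable (hubGraphOfSizes ![7, 1]) 3 := fun h => by
  have hj (i : Σ p, Fin (![7, 1] p)) : i.1 = 1 ↔ i = ⟨1, (0 : Fin 1)⟩ := by
    refine ⟨fun h => ?_, fun h => congrArg Sigma.fst h⟩
    obtain ⟨i, m⟩ := i
    obtain rfl : i = 1 := h
    exact congrArg (Sigma.mk 1) (Subsingleton.elim (α := Fin 1) _ _)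
  have hle := card_fiber_le_six hj h
  rw [card_fiber_sigma] at hle
  exact absurd hle (by decide)

theorem not_rainbowColorable_three_pair (h : 10 ≤ p + q ∨ p + q = 9 ∧ ¬ 3 ∣ p) :
    ¬ RainbowColorable (hubGraphOfSizes ![p, q]) 3 := fun hcol => by
  have hle := card_le_nine_of_rainbowColorable hcol
  have hdvd := three_dvd_card_fiber_of_card_eq_nine hcol
  rw [card_sigma_pair] at hle hdvd
  rw [card_fiber_sigma] at hdvd
  simp only [Matrix.cons_val_zero] at hdvd
  omega

theorem not_rainbowColorable_three_triple
    (h : 10 ≤ p + q + r ∨ p + q + r = 9 ∧ ¬ p ≡ q [MOD 3]) :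
    ¬ RainbowColorable (hubGraphOfSizes ![p, q, r]) 3 := fun hcol => by
  have hle := card_le_nine_of_rainbowColorable hcol
  have hmod := card_fiber_modEq_of_card_eq_nine hcol
  rw [card_sigma_triple] at hle hmod
  rw [card_fiber_sigma, card_fiber_sigma] at hmod
  exact h.elim (fun h => by omega) fun h => h.2 (hmod h.1)

theorem G₂_values_three (hpq : q ≤ p) (hq : 1 ≤ q)
    (h : p + q ≤ 7 ∨ (p, q) ∈ ({(6, 2), (5, 3), (4, 4), (6, 3)} : Set (ℕ × ℕ))) :
    rc (G₂ p q) = 3 ∧ rcList (G₂ p q) = 3 := by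
  rw [rc_congr (G₂Iso p q), rcList_congr (G₂Iso p q)]
  refine hubGraphOfSizes_values_three (hubGraph_rainbowChoosable_of_isSmallPair
    (sigma_fst_surjective (one_le_pair (hq.trans hpq) hq)) (card_fiber_sigma _ 0)
    (card_fiber_sigma _ 1) ?_)
  simp only [Set.mem_insert_iff, Set.mem_singleton_iff, Prod.mk.injEq] at h
  change IsSmallPair p q
  unfold IsSmallPair
  omega

theorem G₂_values_four (hpq : q ≤ p) (hq : 1 ≤ q)
    (h : 10 ≤ p + q ∨ (p, q) ∈ ({(7, 1), (8, 1), (7, 2), (5, 4)} : Set (ℕ × ℕ))) :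
    rc (G₂ p q) = 4 ∧ rcList (G₂ p q) = 4 := by
  rw [rc_congr (G₂Iso p q), rcList_congr (G₂Iso p q)]
  refine hubGraphOfSizes_values_four (by decide) (one_le_pair (hq.trans hpq) hq) ?_
  simp only [Set.mem_insert_iff, Set.mem_singleton_iff, Prod.mk.injEq] at h
  by_cases h71 : p = 7 ∧ q = 1
  · obtain ⟨rfl, rfl⟩ := h71
    exact not_rainbowColorable_three_seven_one
  · exact not_rainbowColorable_three_pair (by omega)

theorem G₃_values_three (hpq : q ≤ p) (hqr : r ≤ q) (hr : 1 ≤ r)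
    (h : p + q + r ≤ 8 ∨
      (p, q, r) ∈ ({(7, 1, 1), (4, 4, 1), (5, 2, 2), (3, 3, 3)} : Set (ℕ × ℕ × ℕ))) :
    rc (G₃ p q r) = 3 ∧ rcList (G₃ p q r) = 3 := by
  rw [rc_congr (G₃Iso p q r), rcList_congr (G₃Iso p q r)]
  refine hubGraphOfSizes_values_three (hubGraph_rainbowChoosable_of_isSmallTriple
    (sigma_fst_surjective (one_le_triple (by omega) (by omega) hr)) (card_fiber_sigma _ 0)
    (card_fiber_sigma _ 1) (card_fiber_sigma _ 2) ?_)
  simp only [Set.mem_insert_iff, Set.mem_singleton_iff, Prod.mk.injEq] at h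
  change IsSmallTriple p q r
  unfold IsSmallTriple
  omega

theorem G₃_values_four (hpq : q ≤ p) (hqr : r ≤ q) (hr : 1 ≤ r)
    (h : 10 ≤ p + q + r ∨ (p, q, r) ∈ ({(6, 2, 1), (5, 3, 1), (4, 3, 2)} : Set (ℕ × ℕ × ℕ))) :
    rc (G₃ p q r) = 4 ∧ rcList (G₃ p q r) = 4 := by
  rw [rc_congr (G₃Iso p q r), rcList_congr (G₃Iso p q r)]
  refine hubGraphOfSizes_values_four le_rfl (one_le_triple (by omega) (by omega) hr)
    (not_rainbowColorable_three_triple ?_)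
  simp only [Set.mem_insert_iff, Set.mem_singleton_iff, Prod.mk.injEq] at h
  unfold Nat.ModEq
  omega

theorem G₂_values (hpq : q ≤ p) (hq : 1 ≤ q) :
    rc (G₂ p q) = 3 ∧ rcList (G₂ p q) = 3 ∨ rc (G₂ p q) = 4 ∧ rcList (G₂ p q) = 4 := by
  by_cases h : p + q ≤ 7 ∨ (p, q) ∈ ({(6, 2), (5, 3), (4, 4), (6, 3)} : Set (ℕ × ℕ))
  · exact .inl (G₂_values_three hpq hq h)
  · refine .inr (G₂_values_four hpq hq ?_)
    simp only [Set.mem_insert_iff, Set.mem_singleton_iff, Prod.mk.injEq] at h ⊢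
    omega

theorem G₃_values (hpq : q ≤ p) (hqr : r ≤ q) (hr : 1 ≤ r) :
    rc (G₃ p q r) = 3 ∧ rcList (G₃ p q r) = 3 ∨ rc (G₃ p q r) = 4 ∧ rcList (G₃ p q r) = 4 := by
  by_cases h : p + q + r ≤ 8 ∨
      (p, q, r) ∈ ({(7, 1, 1), (4, 4, 1), (5, 2, 2), (3, 3, 3)} : Set (ℕ × ℕ × ℕ))
  · exact .inl (G₃_values_three hpq hqr hr h)
  · refine .inr (G₃_values_four hpq hqr hr ?_)
    simp only [Set.mem_insert_iff, Set.mem_singleton_iff, Prod.mk.injEq] at h ⊢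
    omega

theorem rc_eq_rcList_and_mem_of_iso {V W : Type*} {G : SimpleGraph V} {H : SimpleGraph W}
    (φ : G ≃g H) (h : rc H = 3 ∧ rcList H = 3 ∨ rc H = 4 ∧ rcList H = 4) :
    rc G = rcList G ∧ rcList G ∈ ({3, 4} : Set ℕ) := by
  rw [rc_congr φ, rcList_congr φ]
  rcases h with ⟨h1, h2⟩ | ⟨h1, h2⟩ <;> simp [h1, h2]

end Values

end RainbowConnection

theorem mainTheorem1 :
    -- every graph of the family has equal parameters, with value 3 or 4
    (∀ {V : Type u} (G : SimpleGraph V), RainbowConnection.Family G →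
      RainbowConnection.rc G = RainbowConnection.rcList G ∧
        RainbowConnection.rcList G ∈ ({3, 4} : Set ℕ)) ∧
    -- the members of the family
    (∀ {V : Type u} (G : SimpleGraph V), RainbowConnection.Family G ↔
      Nonempty (G ≃g RainbowConnection.petersen) ∨
      (∃ p q : ℕ, p ≥ q ∧ q ≥ 1 ∧ Nonempty (G ≃g RainbowConnection.G₂ p q)) ∨
      (∃ p q r : ℕ, p ≥ q ∧ q ≥ r ∧ r ≥ 1 ∧ Nonempty (G ≃g RainbowConnection.G₃ p q r))) ∧
    -- the values
    (RainbowConnection.rc RainbowConnection.petersen = 3 ∧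
      RainbowConnection.rcList RainbowConnection.petersen = 3) ∧
    (∀ p q : ℕ, p ≥ q → q ≥ 1 →
      (p + q ≤ 7 ∨ (p, q) ∈ ({(6, 2), (5, 3), (4, 4), (6, 3)} : Set (ℕ × ℕ)) →
        RainbowConnection.rc (RainbowConnection.G₂ p q) = 3 ∧
          RainbowConnection.rcList (RainbowConnection.G₂ p q) = 3) ∧
      (p + q ≥ 10 ∨ (p, q) ∈ ({(7, 1), (8, 1), (7, 2), (5, 4)} : Set (ℕ × ℕ)) →
        RainbowConnection.rc (RainbowConnection.G₂ p q) = 4 ∧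
          RainbowConnection.rcList (RainbowConnection.G₂ p q) = 4)) ∧
    (∀ p q r : ℕ, p ≥ q → q ≥ r → r ≥ 1 →
      (p + q + r ≤ 8 ∨
          (p, q, r) ∈ ({(7, 1, 1), (4, 4, 1), (5, 2, 2), (3, 3, 3)} : Set (ℕ × ℕ × ℕ)) →
        RainbowConnection.rc (RainbowConnection.G₃ p q r) = 3 ∧
          RainbowConnection.rcList (RainbowConnection.G₃ p q r) = 3) ∧
      (p + q + r ≥ 10 ∨
          (p, q, r) ∈ ({(6, 2, 1), (5, 3, 1), (4, 3, 2)} : Set (ℕ × ℕ × ℕ)) →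
        RainbowConnection.rc (RainbowConnection.G₃ p q r) = 4 ∧
          RainbowConnection.rcList (RainbowConnection.G₃ p q r) = 4)) := by
  refine ⟨fun G hG => ?_, RainbowConnection.family_iff, RainbowConnection.petersen_values,
    fun p q hpq hq => ⟨RainbowConnection.G₂_values_three hpq hq,
      RainbowConnection.G₂_values_four hpq hq⟩,
    fun p q r hpq hqr hr => ⟨RainbowConnection.G₃_values_three hpq hqr hr,
      RainbowConnection.G₃_values_four hpq hqr hr⟩⟩
  obtain ⟨⟨φ⟩⟩ | ⟨p, q, hpq, hq, ⟨φ⟩⟩ | ⟨p, q, r, hpq, hqr, hr, ⟨φ⟩⟩ :=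
    (RainbowConnection.family_iff G).1 hG
  · exact RainbowConnection.rc_eq_rcList_and_mem_of_iso φ (.inl RainbowConnection.petersen_values)
  · exact RainbowConnection.rc_eq_rcList_and_mem_of_iso φ (RainbowConnection.G₂_values hpq hq)
  · exact RainbowConnection.rc_eq_rcList_and_mem_of_iso φ (RainbowConnection.G₃_values hpq hqr hr)
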